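/- **Gauss's Theorema Egregium.** *Conventions.* A *parametrized surface* is a $C^\infty$ injective map $r:D\to\mathbb R^3$ of a closed disk or closed rectangle $D\subset\mathbb R^2$ whose derivative is injective at every point of $D$. A *surface* is a compact set $\Pi\subset\mathbb R^3$ each of whose points has a closed neighbourhood $O$ in $\mathbb R^3$ such that $\Pi\cap O$ is the image of a parametrized surface; $\Pi$ *has smooth boundary* if only disks are needed here. A *coorientation* $n$ is a continuous field of unit normals on $\Pi$. $S$ denotes area (normalized two-dimensional Hausdorff measure). The *total Gaussian curvature* $K(\Pi)$ is the number such that, for some number $H$, the surface $\Pi_\varepsilon=\{P+\varepsilon n(P):P\in\Pi\}$ satisfies $S(\Pi_\varepsilon)=S(\Pi)+H\varepsilon+K(\Pi)\varepsilon^2$ for all sufficiently small $|\varepsilon|$. The *Gaussian curvature at* $P\in\Pi$ is $K_{\Pi,P}=\lim K(\Pi_P)/S(\Pi_P)$ as $\operatorname{diam}\Pi_P\to0$, over the images $\Pi_P\ni P$, $\Pi_P\subset\Pi$, of parametrized surfaces whose domain is a rectangle. The *signed area of the spherical image* of $\Pi$ under $n:\Pi\to S^2$ is $\int_{S^2}\sum_{P\in\Pi,\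 n(P)=q}\operatorname{sign}\det(dn_P)\,dS(q)$, where $dn_P$ is regarded as an endomorphism of the tangent plane $T_P\Pi$. A differentiable vector field $v(t)\in T_{\gamma(t)}\Pi$ along a curve $\gamma:[0,1]\to\Pi$ is *parallel* if $v'(t)\perp T_{\gamma(t)}\Pi$ for all $t$. If $\Pi$ has smooth boundary, let $\gamma_1,\dots,\gamma_m$ ($m\ge0$) be smooth regular simple closed curves with pairwise disjoint images which parametrize $\partial\Pi$ and are directed so that $n\times\gamma_i'$ points into $\Pi$; angles are counted counterclockwise as seen from the end of $n$. A *length preserving map* $f:\Pi\to\Pi'$ is a smooth map of surfaces which preserves the length of every smooth regular curve on $\Pi$; an *intrinsic isometry* is a bijective one. *Theorem.* 1. For every cooriented surface $\Pi$ the total Gaussian curvature $K(\Pi)$ exists, is unique, and is the signed area of the spherical image of $\Pi$. 2. Let $\Pi$ be a cooriented surface with smooth boundary and $\gamma_1,\dots,\gamma_m$ as above. Every tangent vector at $\gamma_i(0)$ can be transported parallelly along $\gamma_i$, and the transport along $\gamma_i$ is the rotation of $T_{\gamma_i(0)}\Pi$ by some angle $\theta_i\in\mathbb R/2\pi\mathbb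 Z$. The total rotation angle $\sigma(\Pi)=\sum_i\theta_i$ is equal modulo $2\pi$ to the signed area of the spherical image of $\Pi$, i.e. $\sigma(\Pi)=K(\Pi)$. 3. The equality holds in $\mathbb R$ if angles are measured from a tangent field: in the situation of 2, let $a$ be a continuous unit tangent vector field on $\Pi$, let $v_i$ be a parallel field along $\gamma_i$ with $v_i(0)\neq0$, and let $\varphi_i:[0,1]\to\mathbb R$ be a continuous choice of the oriented angle from $a(\gamma_i(t))$ to $v_i(t)$. Then $\sum_i(\varphi_i(1)-\varphi_i(0))=K(\Pi)$. 4. If $f:\Pi\to\Pi'$ is an intrinsic isometry between cooriented surfaces, then $K(\Pi)=K(\Pi')$. 5. If $f:\Pi\to\Pi'$ is a length preserving map between cooriented surfaces (in particular, if it is an intrinsic isometry), then for every $P\in\Pi$ the Gaussian curvature $K_{\Pi,P}$ exists, is unique, and $K_{\Pi,P}=K_{\Pi',f(P)}$. -/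

import Mathlib

open MeasureTheory Set Topology
open scoped ContDiff RealInnerProductSpace NNReal

noncomputable section

namespace SurfaceGeometry

/-- The plane of parameters. -/
abbrev E2 := EuclideanSpace ℝ (Fin 2)

/-- Euclidean three-space. -/
abbrev E3 := EuclideanSpace ℝ (Fin 3)

/-- The vector product in Euclidean three-space. -/
def cross (x y : E3) : E3 := WithLp.toLp 2 (crossProduct x.ofLp y.ofLp)

/-! ### Surfaces -/

/-- A closed disk of positive radius in the plane. -/
def IsClosedDisk (D : Set E2) : Prop :=
  ∃ (c : E2) (ρ : ℝ), 0 < ρ ∧ D = Metric.closedBall c ρ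

/-- A closed nondegenerate rectangle in the plane. -/
def IsClosedRectangle (D : Set E2) : Prop :=
  ∃ a b : Fin 2 → ℝ, (∀ i, a i < b i) ∧ D = {x : E2 | ∀ i, x i ∈ Icc (a i) (b i)}

/-- A parametrized surface `r : D → ℝ³`: smooth up to the edge of `D`, injective, with linearly
independent partial derivatives (that is, with injective derivative) at every point of `D`. -/
structure IsRegularParam (D : Set E2) (r : E2 → E3) : Prop where
  smooth : ContDiffOn ℝ ∞ r D
  inj : InjOn r D
  regular : ∀ x ∈ D, Function.Injective (fderivWithin ℝ r D x)

/-- A (compact, embedded, smooth) surface in three-space, possibly with boundary and corners: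
every point has a closed neighbourhood in space that meets the surface in the image of a
parametrized surface over a closed disk or rectangle. -/
def IsSurface (S : Set E3) : Prop :=
  IsCompact S ∧ ∀ P ∈ S, ∃ O ∈ 𝓝 P, IsClosed O ∧ ∃ (D : Set E2) (r : E2 → E3),
    (IsClosedDisk D ∨ IsClosedRectangle D) ∧ IsRegularParam D r ∧ S ∩ O = r '' D

/-- A surface with smooth (possibly empty) boundary: the same with disks only, so that no corners
can occur. -/
def IsSurfaceWithSmoothBoundary (S : Set E3) : Prop :=
  IsCompact S ∧ ∀ P ∈ S, ∃ O ∈ 𝓝 P, IsClosed O ∧ ∃ (D : Set E2) (r : E2 → E3),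
    IsClosedDisk D ∧ IsRegularParam D r ∧ S ∩ O = r '' D

/-- The boundary of a surface: the points that do not correspond to an inner point of the disk
in any parametrization of a neighbourhood. -/
def surfaceBoundary (S : Set E3) : Set E3 :=
  {P ∈ S | ¬ ∃ O ∈ 𝓝 P, IsClosed O ∧ ∃ (D : Set E2) (r : E2 → E3),
    IsClosedDisk D ∧ IsRegularParam D r ∧ S ∩ O = r '' D ∧ P ∈ r '' interior D}

/-- The tangent plane of a surface at a point, as a linear subspace. At a boundary point it is the
whole plane spanned by the tangent half-plane (or sector). -/
def tangentPlane (S : Set E3) (P : E3) : Submodule ℝ E3 :=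
  Submodule.span ℝ (tangentConeAt ℝ S P)

/-- A coorientation: a continuous field of unit normals. -/
structure IsCoorientation (S : Set E3) (n : E3 → E3) : Prop where
  cont : ContinuousOn n S
  unit : ∀ P ∈ S, ‖n P‖ = 1
  normal : ∀ P ∈ S, ∀ v ∈ tangentPlane S P, ⟪n P, v⟫ = 0

/-! ### Area, total Gaussian curvature, signed area of the spherical image -/

/-- Area: the two-dimensional Hausdorff measure, normalized to give the unit square area `1`. -/
def area (S : Set E3) : ℝ := (μHE[2] S).toReal

/-- The surface formed by the ends of the vectors `ε n(P)` drawn from the points `P` of `S`. -/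
def shifted (S : Set E3) (n : E3 → E3) (ε : ℝ) : Set E3 := (fun P => P + ε • n P) '' S

/-- `K` is the total Gaussian curvature of the cooriented surface `S`: for all sufficiently small
`ε` the area of the shifted surface is `area S + H ε + K ε²` for some number `H`. -/
def HasTotalGaussCurvature (S : Set E3) (n : E3 → E3) (K : ℝ) : Prop :=
  ∃ H : ℝ, ∃ ε₀ > 0, ∀ ε : ℝ, |ε| < ε₀ →
    area (shifted S n ε) = area S + H * ε + K * ε ^ 2

/-- The endomorphism of space that is the differential of the spherical map `n : S → S²` on the
tangent plane (the tangent planes to `S` at `P` and to the sphere at `n P` are parallel) and the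
identity on the normal line. -/
def sphericalDifferential (S : Set E3) (n : E3 → E3) (P : E3) : E3 →ₗ[ℝ] E3 where
  toFun v := fderivWithin ℝ n S P (v - ⟪n P, v⟫ • n P) + ⟪n P, v⟫ • n P
  map_add' v w := by
    simp only [inner_add_right, add_smul, map_add, map_sub]; abel
  map_smul' c v := by
    simp only [inner_smul_right, mul_smul, map_smul, map_sub, smul_add, smul_sub,
      RingHom.id_apply]

/-- The Jacobian determinant of the spherical map, the tangent planes at `P` and `n P` being
identified as parallel planes with the same normal. -/
def sphericalJacobian (S : Set E3) (n : E3 → E3) (P : E3) : ℝ :=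
  LinearMap.det (sphericalDifferential S n P)

/-- The signed area of the spherical image of a cooriented surface: the area on the unit sphere in
which every point of the image is counted once for each of its preimages at which the spherical map
preserves orientation, and minus once for each preimage at which it reverses orientation. (For a
piece on which the spherical map is injective this is plus or minus the area of its image.) -/
def signedSphericalArea (S : Set E3) (n : E3 → E3) : ℝ :=
  ∫ q in Metric.sphere (0 : E3) 1,
    (∑ᶠ P ∈ {P ∈ S | n P = q}, (SignType.sign (sphericalJacobian S n P) : ℝ)) ∂μHE[2]

/-- `k` is the Gaussian curvature of the cooriented surface `S` at the point `P`: the limit of the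
ratio of the total Gaussian curvature to the area, over the images in `S` of parametrized
rectangles that contain `P`, as the diameter of the image tends to zero. -/
def HasGaussCurvatureAt (S : Set E3) (n : E3 → E3) (P : E3) (k : ℝ) : Prop :=
  ∀ ε > 0, ∃ δ > 0, ∀ (D : Set E2) (r : E2 → E3),
    IsClosedRectangle D → IsRegularParam D r → r '' D ⊆ S → P ∈ r '' D →
    Metric.diam (r '' D) < δ →
    ∃ K : ℝ, HasTotalGaussCurvature (r '' D) n K ∧ |K / area (r '' D) - k| < ε

/-! ### Parallel transport and total sectional curvature -/

/-- `v` is a tangent vector field along the curve `γ : [0, 1] → S` that is parallel in the sense of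
Levi-Civita: its derivative is perpendicular to the tangent plane of `S` at all times. -/
structure IsParallelAlong (S : Set E3) (γ v : ℝ → E3) : Prop where
  diff : DifferentiableOn ℝ v (Icc 0 1)
  tangent : ∀ t ∈ Icc (0 : ℝ) 1, v t ∈ tangentPlane S (γ t)
  parallel : ∀ t ∈ Icc (0 : ℝ) 1, derivWithin v (Icc 0 1) t ∈ (tangentPlane S (γ t))ᗮ

/-- The curves `γ i` (closed, of period `1`) parametrize the boundary of `S`: they are smooth,
regular, simple and pairwise disjoint, they cover the boundary, and each is positively directed
with respect to the coorientation, i.e. `S` lies to the left of it as seen from the end of the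
normal: the vector `n × γ'` points into `S`. -/
structure IsBoundaryParam (S : Set E3) (n : E3 → E3) {m : ℕ} (γ : Fin m → ℝ → E3) : Prop where
  smooth : ∀ i, ContDiff ℝ ∞ (γ i)
  regular : ∀ i t, deriv (γ i) t ≠ 0
  closed : ∀ i, Function.Periodic (γ i) 1
  simple : ∀ i, InjOn (γ i) (Ico 0 1)
  disj : Pairwise fun i j => Disjoint (range (γ i)) (range (γ j))
  cover : ⋃ i, range (γ i) = surfaceBoundary S
  positive : ∀ i t, cross (n (γ i t)) (deriv (γ i) t) ∈ tangentConeAt ℝ≥0 S (γ i t)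

/-- Parallel transport along the closed curve `γ : [0, 1] → S` is defined on the whole tangent
plane at the initial point and is the rotation of this plane by the angle `θ` (counterclockwise as
seen from the end of the normal). -/
def IsTransportRotation (S : Set E3) (n : E3 → E3) (γ : ℝ → E3) (θ : Real.Angle) : Prop :=
  (∀ w ∈ tangentPlane S (γ 0), ∃ v, IsParallelAlong S γ v ∧ v 0 = w) ∧
  ∀ v, IsParallelAlong S γ v → v 1 = θ.cos • v 0 + θ.sin • cross (n (γ 0)) (v 0)

/-- `σ` is the total sectional curvature of `S`, whose boundary is parametrized by the curves
`γ i`: the angle (modulo `2π`) by which a tangent vector is rotated by parallel transport along the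
boundary, summed over the components of the boundary. -/
def IsTotalSectionalCurvature (S : Set E3) (n : E3 → E3) {m : ℕ} (γ : Fin m → ℝ → E3)
    (σ : Real.Angle) : Prop :=
  ∃ θ : Fin m → Real.Angle, (∀ i, IsTransportRotation S n (γ i) (θ i)) ∧ ∑ i, θ i = σ

/-- `a` is a continuous field of unit tangent vectors on `S`. -/
structure IsUnitTangentField (S : Set E3) (a : E3 → E3) : Prop where
  cont : ContinuousOn a S
  unit : ∀ P ∈ S, ‖a P‖ = 1
  tangent : ∀ P ∈ S, a P ∈ tangentPlane S P

/-- `φ` is a continuous choice of the oriented angle from the field `a` to the vector field `v`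
along the curve `γ : [0, 1] → S`. -/
def IsAngleFrom (n a : E3 → E3) (γ v : ℝ → E3) (φ : ℝ → ℝ) : Prop :=
  ContinuousOn φ (Icc 0 1) ∧ ∀ t ∈ Icc (0 : ℝ) 1,
    v t = ‖v t‖ • (Real.cos (φ t) • a (γ t) + Real.sin (φ t) • cross (n (γ t)) (a (γ t)))

/-! ### Intrinsic isometries -/

/-- `f` is smooth on the surface `S`: it is smooth in every parametrization of a piece of `S`. -/
def SmoothOnSurface (S : Set E3) (f : E3 → E3) : Prop :=
  ∀ (D : Set E2) (r : E2 → E3), IsClosedDisk D ∨ IsClosedRectangle D → IsRegularParam D r →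
    r '' D ⊆ S → ContDiffOn ℝ ∞ (f ∘ r) D

/-- `f` preserves the length of every (smooth regular) curve on `S`; the length of a curve is the
supremum of the lengths of inscribed polygonal lines. -/
def PreservesLengths (S : Set E3) (f : E3 → E3) : Prop :=
  ∀ (γ : ℝ → E3) (a b : ℝ), a < b → ContDiffOn ℝ ∞ γ (Icc a b) →
    (∀ t ∈ Icc a b, derivWithin γ (Icc a b) t ≠ 0) → MapsTo γ (Icc a b) S →
    eVariationOn (f ∘ γ) (Icc a b) = eVariationOn γ (Icc a b)

/-- A smooth map of the surface `S` into `S'` that preserves the lengths of all curves. -/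
structure IsLengthPreservingMap (S S' : Set E3) (f : E3 → E3) : Prop where
  mapsTo : MapsTo f S S'
  smooth : SmoothOnSurface S f
  lengths : PreservesLengths S f

/-- An intrinsic isometry between the surfaces `S` and `S'`. -/
structure IsIntrinsicIsometry (S S' : Set E3) (f : E3 → E3) : Prop
    extends IsLengthPreservingMap S S' f where
  bij : BijOn f S S'

end SurfaceGeometry

end

/-!
# Gauss's Theorema Egregium

Write `N` for the normal field and `J = det dN` for the Jacobian of the spherical map.

*Curvature as an integral.* The shift by `ε N` multiplies the area element by `1 + ε tr dN + ε² J`.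
It is injective for small `ε`, so the area formula gives `K = ∫ J`
(`hasTotalGaussCurvature_integral`). The area formula with multiplicities, applied to `N` on the
sets `J > 0` and `J < 0`, gives `∫ J g(N) = ∫ deg · g` over the sphere, where `deg` counts preimages
with sign (`integral_sphericalDegree`); `g = 1` is the statement on the signed area. The Hausdorff
measure version of the area formula for maps of class `C¹` on convex sets is proved first.

*Invariance.* `J` is a polynomial in the first fundamental form and its derivatives divided by the
square of its determinant (`sphericalJacobian_eq_of_metric_eq`). A length preserving map preserves
the first fundamental form (`IsLengthPreservingMap.inner_pd_eq`), hence `J`, and a bijective one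
preserves area as well, hence `∫ J`. The Gaussian curvature at a point, a limit of mean values of
`J`, is `J` there (`hasGaussCurvatureAt_iff`).

*Parallel transport.* Along a curve with a unit tangent frame `b`, parallel fields are those which
rotate relative to `b` at the rate `-⟪N × b, b'⟫` (`IsFrameAlong.isParallelAlong`). If `b` is
defined on the whole surface, this rate comes from the connection form `⟪N × b, db⟫`, whose exterior
derivative is `-J` times the area form (`curl_connection`). Stokes' formula (`stokes`, reduced to
Green's formula on a disk by a partition of unity) then expresses the total rotation as `∫ J`. A
continuous frame is homotopic to a smooth one (`IsUnitTangentField.exists_smooth`), which does not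
change the rotation along closed curves (`sum_angle_eq_integral`).

*Rotation modulo `2π`.* In general a surface has no tangent field. Instead a fixed vector
perpendicular to a unit vector `e` is carried to the tangent plane by the rotation that takes `e` to
`N` along a great circle (`poleFrame`). The frame is singular exactly where `N = -e`, and its
connection form is, up to sign, the pull-back of the form `(e × N) · dN / (1 + e · N)`. For almost
every `e` the boundary avoids the singularity and `-e` is a Lebesgue point of `deg` (`exists_pole`).
After the form is cut off near `-e`, Stokes' formula and the degree formula show that `∫ J` minus
the total rotation is the integral of `deg` against a weight of total mass `4π` supported near `-e`
(`integral_sub_sum_pole`). As the support shrinks the integral tends to `4π deg(-e)`, an integer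
multiple of `2π` (`integral_sub_sum_pole_eq`, `isTotalSectionalCurvature`). No triangulation and no
regular value of `N` are needed.
-/

noncomputable section

namespace SurfaceGeometry

set_option linter.unusedSectionVars false

/-! ### The area formula for immersions -/

section AreaFormula

open Module Filter
open scoped ENNReal

variable {E V : Type*} [NormedAddCommGroup E] [InnerProductSpace ℝ E] [FiniteDimensional ℝ E]
  [NormedAddCommGroup V] [InnerProductSpace ℝ V]

/-- `f` is continuously differentiable on the convex set `D`, with derivative `f'` within `D`.
Points of `D` on the edge are allowed. -/
structure HasC1DerivOn (f : E → V) (f' : E → E →L[ℝ] V) (D : Set E) : Prop where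
  convex : Convex ℝ D
  deriv : ∀ x ∈ D, HasFDerivWithinAt f (f' x) D x
  cont : ContinuousOn f' D

/-- The `d`-dimensional volume factor of a linear map from a `d`-dimensional space. -/
def volFactor (A : E →L[ℝ] V) : ℝ := A.toLinearMap.normDet

theorem volFactor_nonneg (A : E →L[ℝ] V) : 0 ≤ volFactor A := A.toLinearMap.normDet_nonneg

theorem volFactor_eq_sqrt (A : E →L[ℝ] V) {ι : Type*} [Fintype ι] [DecidableEq ι]
    (b : OrthonormalBasis ι ℝ E) :
    volFactor A = Real.sqrt (Matrix.gram ℝ fun i => A (b i)).det := by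
  have h := A.toLinearMap.normDet_sq_eq_det_gram b
  rw [← Real.sqrt_sq (volFactor_nonneg A)]
  exact congrArg Real.sqrt h

theorem continuous_volFactor : Continuous fun A : E →L[ℝ] V => volFactor A := by
  simp_rw [fun A : E →L[ℝ] V => volFactor_eq_sqrt A (stdOrthonormalBasis ℝ E)]
  refine Real.continuous_sqrt.comp (Continuous.matrix_det ?_)
  refine continuous_matrix fun i j => ?_
  simp only [Matrix.gram_apply]
  fun_prop

theorem volFactor_pos {A : E →L[ℝ] V} (hA : Function.Injective A) : 0 < volFactor A :=
  (volFactor_nonneg A).lt_of_ne'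
    ((A.toLinearMap.normDet_ne_zero_tfae.out 4 0).1 hA)

theorem volFactor_eq_zero {A : E →L[ℝ] V} (hA : ¬ Function.Injective A) : volFactor A = 0 :=
  (A.toLinearMap.normDet_eq_zero_tfae.out 5 0).1 hA

theorem HasC1DerivOn.approximates {f : E → V} {f' : E → E →L[ℝ] V} {D : Set E}
    (h : HasC1DerivOn f f' D) {x : E} (hx : x ∈ D) {δ : ℝ≥0} (hδ : 0 < δ) :
    ∃ r > 0, ApproximatesLinearOn f (f' x) (D ∩ Metric.ball x r) δ := by
  obtain ⟨r, r0, hr⟩ := Metric.continuousWithinAt_iff.1 (h.cont x hx) δ (by exact_mod_cast hδ)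
  refine ⟨r, r0, fun y hy z hz => ?_⟩
  refine (h.convex.inter (convex_ball x r)).norm_image_sub_le_of_norm_hasFDerivWithin_le'
    (fun w hw => (h.deriv w hw.1).mono inter_subset_left) (fun w hw => ?_) hz hy
  have := hr hw.1 hw.2
  rw [dist_eq_norm] at this
  exact this.le

theorem HasC1DerivOn.continuousOn {f : E → V} {f' : E → E →L[ℝ] V} {D : Set E}
    (h : HasC1DerivOn f f' D) : ContinuousOn f D := fun x hx => (h.deriv x hx).continuousWithinAt

variable [MeasurableSpace E] [BorelSpace E] [MeasurableSpace V] [BorelSpace V]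

theorem lipschitzOnWith_euclideanHausdorffMeasure_image_le {X Y : Type*} [EMetricSpace X]
    [EMetricSpace Y] [MeasurableSpace X] [BorelSpace X] [MeasurableSpace Y] [BorelSpace Y]
    {K : ℝ≥0} {f : X → Y} {s : Set X} (h : LipschitzOnWith K f s) (d : ℕ) :
    μHE[d] (f '' s) ≤ (K : ℝ≥0∞) ^ d * μHE[d] s := by
  simp only [Measure.euclideanHausdorffMeasure_def, Measure.smul_apply, ENNReal.smul_def,
    smul_eq_mul]
  have := h.hausdorffMeasure_image_le (d := d) (by positivity)
  rw [ENNReal.rpow_natCast] at this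
  calc _ ≤ _ := mul_le_mul_right this _
    _ = _ := by ring

/-- A map close enough to an injective linear map `A` distorts volumes by the factor `volFactor A`,
up to a factor as close to `1` as wanted: it factors through `A` by a map which is bi-Lipschitz
with constants close to `1`. -/
theorem exists_approximatesLinearOn_volume_bounds (A : E →L[ℝ] V) (hA : Function.Injective A)
    {c : ℝ≥0} (hc : 1 < c) : ∃ δ : ℝ≥0, 0 < δ ∧ ∀ (s : Set E) (f : E → V),
      ApproximatesLinearOn f A s δ →
      InjOn f s ∧
      μHE[finrank ℝ E] (f '' s) ≤ c * (ENNReal.ofReal (volFactor A) * volume s) ∧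
      ENNReal.ofReal (volFactor A) * volume s ≤ c * μHE[finrank ℝ E] (f '' s) := by
  -- The Lipschitz constant `k` has to satisfy `k ^ d ≤ c`, since `d`-dimensional volume scales
  -- with the `d`th power.
  obtain ⟨k, hk, hkc⟩ : ∃ k : ℝ≥0, 1 < k ∧ k ^ finrank ℝ E ≤ c := by
    have h1 : ∀ᶠ k : ℝ≥0 in 𝓝[>] 1, k ^ finrank ℝ E < c := by
      apply nhdsWithin_le_nhds
      apply (continuous_pow (finrank ℝ E)).continuousAt.eventually_lt continuousAt_const
      simpa using hc
    obtain ⟨k, h2, h3⟩ := (h1.and self_mem_nhdsWithin).exists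
    exact ⟨k, h3, h2.le⟩
  obtain ⟨K, hK, hKA⟩ := A.toLinearMap.exists_antilipschitzWith (LinearMap.ker_eq_bot.2 hA)
  have hk0 : (0 : ℝ) < k := lt_trans one_pos (by exact_mod_cast hk)
  have hk1 : (1 : ℝ) < k := by exact_mod_cast hk
  have hK' : (0 : ℝ) < K := by exact_mod_cast hK
  have hinv : (k : ℝ)⁻¹ < 1 := inv_lt_one_of_one_lt₀ hk1
  -- With this `δ` the error of the linear approximation is at most `(1 - k⁻¹) ‖A (x - y)‖`.
  have hδ0 : 0 < (1 - (k : ℝ)⁻¹) / K := div_pos (by linarith) hK'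
  obtain ⟨δ, hδ⟩ : ∃ δ : ℝ≥0, (δ : ℝ) = (1 - (k : ℝ)⁻¹) / K := ⟨⟨_, hδ0.le⟩, rfl⟩
  refine ⟨δ, by rw [← NNReal.coe_pos, hδ]; exact hδ0, fun s f hf => ?_⟩
  have hdist : ∀ x ∈ s, ∀ y ∈ s,
      ‖f x - f y - A (x - y)‖ ≤ (1 - (k : ℝ)⁻¹) * ‖A (x - y)‖ := by
    intro x hx y hy
    refine (hf x hx y hy).trans ?_
    have := hKA.le_mul_dist x y
    rw [dist_eq_norm, dist_eq_norm, ← map_sub] at this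
    rw [hδ]
    calc _ ≤ (1 - (k : ℝ)⁻¹) / K * (K * ‖A (x - y)‖) := by
          gcongr; exact this
      _ = _ := by field_simp
  -- So `f ∘ A⁻¹` and `A ∘ f⁻¹` are `k`-Lipschitz.
  have hup : ∀ x ∈ s, ∀ y ∈ s, ‖f x - f y‖ ≤ k * ‖A x - A y‖ := by
    intro x hx y hy
    have h1 := hdist x hx y hy
    have h2 : ‖f x - f y‖ ≤ ‖f x - f y - A (x - y)‖ + ‖A (x - y)‖ := by
      simpa using norm_add_le (f x - f y - A (x - y)) (A (x - y))
    rw [← map_sub]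
    have h3 : 2 - (k : ℝ)⁻¹ ≤ k := by
      have : (k : ℝ) * (k : ℝ)⁻¹ = 1 := mul_inv_cancel₀ hk0.ne'
      nlinarith [sq_nonneg ((k : ℝ) - 1), inv_pos.2 hk0]
    nlinarith [norm_nonneg (A (x - y))]
  have hlow : ∀ x ∈ s, ∀ y ∈ s, ‖A x - A y‖ ≤ k * ‖f x - f y‖ := by
    intro x hx y hy
    have h1 := hdist x hx y hy
    have h2 : ‖A (x - y)‖ ≤ ‖f x - f y - A (x - y)‖ + ‖f x - f y‖ := by
      have := norm_sub_le (f x - f y) (f x - f y - A (x - y))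
      rw [sub_sub_cancel] at this; linarith
    rw [← map_sub]
    have h3 : (k : ℝ)⁻¹ * ‖A (x - y)‖ ≤ ‖f x - f y‖ := by linarith
    calc ‖A (x - y)‖ = k * ((k : ℝ)⁻¹ * ‖A (x - y)‖) := by field_simp
      _ ≤ _ := by gcongr
  have hinj : InjOn f s := by
    intro x hx y hy hxy
    have := hlow x hx y hy
    rw [hxy, sub_self, norm_zero, mul_zero] at this
    exact hA (sub_eq_zero.1 (norm_le_zero_iff.1 this))
  have hAs : μHE[finrank ℝ E] (A '' s) = ENNReal.ofReal (volFactor A) * volume s :=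
    A.toLinearMap.euclideanHausdorffMeasure_image_eq_normDet_mul_volume s
  have hkc' : (k : ℝ≥0∞) ^ finrank ℝ E ≤ c := by exact_mod_cast hkc
  refine ⟨hinj, ?_, ?_⟩
  · have hl : LipschitzOnWith k (f ∘ Function.invFun A) (A '' s) := by
      refine LipschitzOnWith.of_dist_le_mul ?_
      rintro _ ⟨x, hx, rfl⟩ _ ⟨y, hy, rfl⟩
      simp only [Function.comp, Function.leftInverse_invFun hA _, dist_eq_norm]
      exact hup x hx y hy
    have := lipschitzOnWith_euclideanHausdorffMeasure_image_le hl (finrank ℝ E)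
    rw [image_image] at this
    simp only [Function.comp, Function.leftInverse_invFun hA _] at this
    rw [hAs] at this
    exact this.trans (by gcongr)
  · have hl : LipschitzOnWith k (A ∘ Function.invFunOn f s) (f '' s) := by
      refine LipschitzOnWith.of_dist_le_mul ?_
      rintro _ ⟨x, hx, rfl⟩ _ ⟨y, hy, rfl⟩
      simp only [Function.comp, hinj.leftInvOn_invFunOn hx, hinj.leftInvOn_invFunOn hy,
        dist_eq_norm]
      exact hlow x hx y hy
    have := lipschitzOnWith_euclideanHausdorffMeasure_image_le hl (finrank ℝ E)
    have himg : (A ∘ Function.invFunOn f s) '' (f '' s) = A '' s := by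
      rw [image_image]
      exact image_congr fun x hx => by simp only [Function.comp, hinj.leftInvOn_invFunOn hx]
    rw [himg, hAs] at this
    exact this.trans (by gcongr)

/-- Comparison of two set functions from a local comparison, by cutting a set into countably many
small pieces. -/
theorem le_of_locally_le {X : Type*} [TopologicalSpace X] [SecondCountableTopology X]
    [MeasurableSpace X] [OpensMeasurableSpace X] {s : Set X} (hs : MeasurableSet s)
    (p q : Set X → ℝ≥0∞) (hp0 : p ∅ = 0)
    (hp : ∀ t : ℕ → Set X, p (⋃ i, t i) ≤ ∑' i, p (t i))
    (hq : ∀ t : ℕ → Set X, (∀ i, MeasurableSet (t i)) → (∀ i, t i ⊆ s) →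
      Pairwise (Function.onFun Disjoint t) → ∑' i, q (t i) ≤ q (⋃ i, t i))
    (h : ∀ x ∈ s, ∃ U : Set X, IsOpen U ∧ x ∈ U ∧
      ∀ t ⊆ s ∩ U, MeasurableSet t → p t ≤ q t) : p s ≤ q s := by
  rcases s.eq_empty_or_nonempty with rfl | hne
  · simp [hp0]
  choose! U hUo hxU hU using h
  obtain ⟨T, hTs, hTc, hT⟩ := TopologicalSpace.countable_cover_nhdsWithin
    (fun x hx => mem_nhdsWithin_of_mem_nhds ((hUo x hx).mem_nhds (hxU x hx)))
  have hTne : T.Nonempty := by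
    obtain ⟨x, hx⟩ := hne
    obtain ⟨y, hy, -⟩ := mem_iUnion₂.1 (hT hx)
    exact ⟨y, hy⟩
  obtain ⟨e, rfl⟩ := hTc.exists_eq_range hTne
  have hes : ∀ i, e i ∈ s := fun i => hTs ⟨i, rfl⟩
  have hmeas : ∀ i, MeasurableSet (s ∩ disjointed (fun i => U (e i)) i) := fun i =>
    hs.inter (MeasurableSet.disjointed (fun i => (hUo _ (hes i)).measurableSet) i)
  have hcov : s = ⋃ i, s ∩ disjointed (fun i => U (e i)) i := by
    rw [← inter_iUnion, iUnion_disjointed, eq_comm, inter_eq_left]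
    intro x hx
    simpa using hT hx
  calc p s = p (⋃ i, s ∩ disjointed (fun i => U (e i)) i) := by rw [← hcov]
    _ ≤ ∑' i, p (s ∩ disjointed (fun i => U (e i)) i) := hp _
    _ ≤ ∑' i, q (s ∩ disjointed (fun i => U (e i)) i) := by
      refine ENNReal.tsum_le_tsum fun i => hU (e i) (hes i) _ ?_ (hmeas i)
      exact inter_subset_inter_right _ (disjointed_subset _ i)
    _ ≤ q (⋃ i, s ∩ disjointed (fun i => U (e i)) i) := by
      refine hq _ hmeas (fun i => inter_subset_left) ?_
      intro i j hij
      exact (disjoint_disjointed (fun i => U (e i)) hij).mono inter_subset_right inter_subset_right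
    _ = q s := by rw [← hcov]


variable {f : E → V} {f' : E → E →L[ℝ] V} {D s : Set E}

theorem HasC1DerivOn.aemeasurable_volFactor (h : HasC1DerivOn f f' D) (hs : MeasurableSet s)
    (hsD : s ⊆ D) : AEMeasurable (fun x => volFactor (f' x)) (volume.restrict s) :=
  ((continuous_volFactor.comp_continuousOn h.cont).mono hsD).aemeasurable hs

theorem HasC1DerivOn.measurableSet_image (h : HasC1DerivOn f f' D) (hs : MeasurableSet s)
    (hsD : s ⊆ D) (hinj : InjOn f s) : MeasurableSet (f '' s) :=
  hs.image_of_continuousOn_injOn (h.continuousOn.mono hsD) hinj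

/-- Around a point where the derivative is injective, image volumes and integrals of the volume
factor agree up to a factor close to `1`. -/
theorem HasC1DerivOn.exists_local_bounds (h : HasC1DerivOn f f' D) {x : E} (hx : x ∈ D)
    (hfx : Function.Injective (f' x)) {c : ℝ≥0} (hc : 1 < c) :
    ∃ U : Set E, IsOpen U ∧ x ∈ U ∧ InjOn f (D ∩ U) ∧ ∀ t ⊆ D ∩ U, MeasurableSet t →
      μHE[finrank ℝ E] (f '' t) ≤ c * (c * ∫⁻ y in t, ENNReal.ofReal (volFactor (f' y))) ∧
      ∫⁻ y in t, ENNReal.ofReal (volFactor (f' y)) ≤ c * (c * μHE[finrank ℝ E] (f '' t)) := by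
  obtain ⟨δ, hδ, H⟩ := exists_approximatesLinearOn_volume_bounds (f' x) hfx hc
  obtain ⟨r, hr, hap⟩ := h.approximates hx hδ
  have hJ : ContinuousWithinAt (fun y => volFactor (f' y)) D x :=
    (continuous_volFactor.comp_continuousOn h.cont) x hx
  have hpos := volFactor_pos hfx
  have hc' : (1 : ℝ) < c := by exact_mod_cast hc
  have e1 : ∀ᶠ y in 𝓝[D] x, volFactor (f' y) < c * volFactor (f' x) :=
    hJ.eventually_lt continuousWithinAt_const (by nlinarith)
  have e2 : ∀ᶠ y in 𝓝[D] x, volFactor (f' x) < c * volFactor (f' y) :=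
    continuousWithinAt_const.eventually_lt (continuousWithinAt_const.mul hJ)
      (by simp only [Pi.mul_apply]; nlinarith)
  obtain ⟨u, hu, hxu, hue⟩ := mem_nhdsWithin.1 (e1.and e2)
  refine ⟨Metric.ball x r ∩ u, Metric.isOpen_ball.inter hu, ⟨Metric.mem_ball_self hr, hxu⟩, ?_,
    fun t ht htm => ?_⟩
  · exact (H _ f hap).1.mono (inter_subset_inter_right _ inter_subset_left)
  obtain ⟨-, h1, h2⟩ := H t f (hap.mono_set (ht.trans (inter_subset_inter_right _ inter_subset_left)))
  have hconst : ∫⁻ _ in t, ENNReal.ofReal (volFactor (f' x)) =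
      ENNReal.ofReal (volFactor (f' x)) * volume t := by simp
  have hcc : ∀ a : ℝ, ENNReal.ofReal (c * a) = c * ENNReal.ofReal a := fun a => by
    rw [ENNReal.ofReal_mul c.coe_nonneg, ENNReal.ofReal_coe_nnreal]
  have hm := h.aemeasurable_volFactor htm (ht.trans inter_subset_left)
  constructor
  · refine h1.trans (mul_le_mul_right (?_ : ENNReal.ofReal (volFactor (f' x)) * volume t ≤
        c * ∫⁻ y in t, ENNReal.ofReal (volFactor (f' y))) _)
    · rw [← hconst, ← lintegral_const_mul'' _ hm.ennreal_ofReal]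
      refine setLIntegral_mono_ae' htm (Filter.Eventually.of_forall fun y hy => ?_)
      rw [← hcc]
      exact ENNReal.ofReal_le_ofReal (hue ⟨(ht hy).2.2, (ht hy).1⟩).2.le
  · calc _ ≤ ∫⁻ _ in t, ENNReal.ofReal (c * volFactor (f' x)) := by
          refine setLIntegral_mono_ae' htm (Filter.Eventually.of_forall fun y hy => ?_)
          exact ENNReal.ofReal_le_ofReal (hue ⟨(ht hy).2.2, (ht hy).1⟩).1.le
      _ = c * (ENNReal.ofReal (volFactor (f' x)) * volume t) := by
          rw [hcc, setLIntegral_const, mul_assoc]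
      _ ≤ _ := by gcongr

theorem ENNReal_le_of_forall_mul_le {a b : ℝ≥0∞} (h : ∀ c : ℝ≥0, 1 < c → a ≤ c * (c * b)) :
    a ≤ b := by
  have ht : Filter.Tendsto (fun c : ℝ≥0 => ((c * c : ℝ≥0) : ℝ≥0∞) * b) (𝓝[>] 1)
      (𝓝 (((1 * 1 : ℝ≥0) : ℝ≥0∞) * b)) := by
    refine Filter.Tendsto.mono_left ?_ nhdsWithin_le_nhds
    refine ENNReal.Tendsto.mul_const (ENNReal.tendsto_coe.2 ?_) (Or.inl (by simp))
    exact (continuous_id.mul continuous_id).tendsto _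
  simp only [mul_one, ENNReal.coe_one, one_mul] at ht
  refine ge_of_tendsto ht ?_
  filter_upwards [self_mem_nhdsWithin] with c hc
  rw [ENNReal.coe_mul, mul_assoc]
  exact h c hc

/-- **Area formula** for an injective immersion of class `C¹`, set version. -/
theorem HasC1DerivOn.measure_image_eq (h : HasC1DerivOn f f' D) (hs : MeasurableSet s)
    (hsD : s ⊆ D) (hinj : InjOn f s) (himm : ∀ x ∈ s, Function.Injective (f' x)) :
    μHE[finrank ℝ E] (f '' s) = ∫⁻ x in s, ENNReal.ofReal (volFactor (f' x)) := by
  refine le_antisymm (ENNReal_le_of_forall_mul_le fun c hc => ?_)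
    (ENNReal_le_of_forall_mul_le fun c hc => ?_)
  · refine le_of_locally_le hs (fun t => μHE[finrank ℝ E] (f '' t))
      (fun t => c * (c * ∫⁻ x in t, ENNReal.ofReal (volFactor (f' x)))) (by simp)
      (fun t => ?_) (fun t htm hts htd => ?_) (fun x hx => ?_)
    · rw [image_iUnion]; exact measure_iUnion_le _
    · rw [lintegral_iUnion htm htd, ENNReal.tsum_mul_left, ENNReal.tsum_mul_left]
    · obtain ⟨U, h1, h2, -, h3⟩ := h.exists_local_bounds (hsD hx) (himm x hx) hc
      exact ⟨U, h1, h2, fun t ht htm =>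
        (h3 t (ht.trans (inter_subset_inter_left _ hsD)) htm).1⟩
  · refine le_of_locally_le hs (fun t => ∫⁻ x in t, ENNReal.ofReal (volFactor (f' x)))
      (fun t => c * (c * μHE[finrank ℝ E] (f '' t))) (by simp)
      (fun t => lintegral_iUnion_le _ _) (fun t htm hts htd => ?_) (fun x hx => ?_)
    · rw [image_iUnion, measure_iUnion, ENNReal.tsum_mul_left, ENNReal.tsum_mul_left]
      · exact fun i j hij => (htd hij).image hinj (hts i) (hts j)
      · exact fun i => h.measurableSet_image (htm i) ((hts i).trans hsD) (hinj.mono (hts i))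
    · obtain ⟨U, h1, h2, -, h3⟩ := h.exists_local_bounds (hsD hx) (himm x hx) hc
      exact ⟨U, h1, h2, fun t ht htm =>
        (h3 t (ht.trans (inter_subset_inter_left _ hsD)) htm).2⟩

theorem HasC1DerivOn.measurableEmbedding (h : HasC1DerivOn f f' D) (hs : MeasurableSet s)
    (hsD : s ⊆ D) (hinj : InjOn f s) : MeasurableEmbedding (s.domRestrict f) :=
  (h.continuousOn.mono hsD).measurableEmbedding hs hinj

/-- The area formula as an identity of measures: the image under `f` of the measure with density
`volFactor` is the Hausdorff measure on `f '' s`. -/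
theorem HasC1DerivOn.map_withDensity_eq (h : HasC1DerivOn f f' D) (hs : MeasurableSet s)
    (hsD : s ⊆ D) (hinj : InjOn f s) (himm : ∀ x ∈ s, Function.Injective (f' x)) :
    Measure.map (s.domRestrict f)
      (Measure.comap (↑) (volume.withDensity fun x => ENNReal.ofReal (volFactor (f' x)))) =
      μHE[finrank ℝ E].restrict (f '' s) := by
  have hemb := h.measurableEmbedding hs hsD hinj
  refine Measure.ext fun t ht => ?_
  rw [hemb.map_apply, (MeasurableEmbedding.subtype_coe hs).comap_apply, Measure.restrict_apply ht]
  have h1 : (Subtype.val '' (s.domRestrict f ⁻¹' t)) = s ∩ f ⁻¹' t := by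
    ext x; simp [and_comm]
  have h2 : MeasurableSet (s ∩ f ⁻¹' t) := by
    rw [← h1]; exact (MeasurableEmbedding.subtype_coe hs).measurableSet_image.2 (hemb.measurable ht)
  rw [h1, withDensity_apply _ h2, ← h.measure_image_eq h2 (inter_subset_left.trans hsD)
    (hinj.mono inter_subset_left) (fun x hx => himm x hx.1), image_inter_preimage, inter_comm]

/-- **Area formula** for nonnegative functions. -/
theorem HasC1DerivOn.lintegral_image (h : HasC1DerivOn f f' D) (hs : MeasurableSet s)
    (hsD : s ⊆ D) (hinj : InjOn f s) (himm : ∀ x ∈ s, Function.Injective (f' x)) (g : V → ℝ≥0∞) :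
    ∫⁻ y in f '' s, g y ∂μHE[finrank ℝ E] =
      ∫⁻ x in s, ENNReal.ofReal (volFactor (f' x)) * g (f x) := by
  rw [← h.map_withDensity_eq hs hsD hinj himm, (h.measurableEmbedding hs hsD hinj).lintegral_map]
  simp only [Set.domRestrict_apply, ← Function.comp_apply (f := g)]
  rw [← (MeasurableEmbedding.subtype_coe hs).lintegral_map, map_comap_subtype_coe hs,
    setLIntegral_withDensity_eq_setLIntegral_mul_non_measurable₀ _ _ _ hs]
  · simp only [Pi.mul_apply, Function.comp]
  · simp only [Filter.eventually_true, ENNReal.ofReal_lt_top]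
  · exact (h.aemeasurable_volFactor hs hsD).ennreal_ofReal

theorem HasC1DerivOn.integrableOn_image_iff (h : HasC1DerivOn f f' D) (hs : MeasurableSet s)
    (hsD : s ⊆ D) (hinj : InjOn f s) (himm : ∀ x ∈ s, Function.Injective (f' x)) (g : V → ℝ) :
    IntegrableOn g (f '' s) μHE[finrank ℝ E] ↔
      IntegrableOn (fun x => volFactor (f' x) * g (f x)) s := by
  rw [IntegrableOn, ← h.map_withDensity_eq hs hsD hinj himm,
    (h.measurableEmbedding hs hsD hinj).integrable_map_iff]
  simp only [Set.domRestrict_eq, ← Function.comp_assoc, ENNReal.ofReal]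
  rw [← (MeasurableEmbedding.subtype_coe hs).integrable_map_iff, map_comap_subtype_coe hs,
    restrict_withDensity hs, integrable_withDensity_iff_integrable_coe_smul₀]
  · simp_rw [IntegrableOn, Real.coe_toNNReal _ (volFactor_nonneg _), Function.comp_apply,
      smul_eq_mul]
  · exact (h.aemeasurable_volFactor hs hsD).real_toNNReal

/-- **Area formula** for real functions. -/
theorem HasC1DerivOn.integral_image (h : HasC1DerivOn f f' D) (hs : MeasurableSet s)
    (hsD : s ⊆ D) (hinj : InjOn f s) (himm : ∀ x ∈ s, Function.Injective (f' x)) (g : V → ℝ) :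
    ∫ y in f '' s, g y ∂μHE[finrank ℝ E] = ∫ x in s, volFactor (f' x) * g (f x) := by
  rw [← h.map_withDensity_eq hs hsD hinj himm, (h.measurableEmbedding hs hsD hinj).integral_map]
  simp only [Set.domRestrict_apply, ← Function.comp_apply (f := g), ENNReal.ofReal]
  rw [← (MeasurableEmbedding.subtype_coe hs).integral_map, map_comap_subtype_coe hs,
    setIntegral_withDensity_eq_setIntegral_smul₀
      (h.aemeasurable_volFactor hs hsD).real_toNNReal _ hs]
  congr with x
  rw [NNReal.smul_def, Real.coe_toNNReal _ (volFactor_nonneg (f' x)), smul_eq_mul]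

end AreaFormula

/-! ### Vector algebra in three-space -/

theorem inner_e3 (x y : E3) : ⟪x, y⟫ = x 0 * y 0 + x 1 * y 1 + x 2 * y 2 := by
  simp [PiLp.inner_apply, Fin.sum_univ_three]; ring

@[simp] theorem cross_apply_zero (x y : E3) : cross x y 0 = x 1 * y 2 - x 2 * y 1 := by
  simp [cross, crossProduct]

@[simp] theorem cross_apply_one (x y : E3) : cross x y 1 = x 2 * y 0 - x 0 * y 2 := by
  simp [cross, crossProduct]

@[simp] theorem cross_apply_two (x y : E3) : cross x y 2 = x 0 * y 1 - x 1 * y 0 := by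
  simp [cross, crossProduct]

theorem ext_e3 {x y : E3} (h0 : x 0 = y 0) (h1 : x 1 = y 1) (h2 : x 2 = y 2) : x = y := by
  ext i; fin_cases i <;> assumption

theorem inner_cross_left (x y : E3) : ⟪x, cross x y⟫ = 0 := by
  simp [inner_e3]; ring

theorem inner_cross_right (x y : E3) : ⟪y, cross x y⟫ = 0 := by
  simp [inner_e3]; ring

theorem inner_cross_cross (a b c d : E3) :
    ⟪cross a b, cross c d⟫ = ⟪a, c⟫ * ⟪b, d⟫ - ⟪a, d⟫ * ⟪b, c⟫ := by
  simp [inner_e3]; ring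

/-- Cramer's rule in the basis `p`, `q`, `p × q`, without division by the determinant. -/
theorem cross_decomposition (p q v : E3) :
    ⟪cross p q, cross p q⟫ • v = ⟪cross v q, cross p q⟫ • p + ⟪cross p v, cross p q⟫ • q
      + ⟪v, cross p q⟫ • cross p q := by
  apply ext_e3 <;> simp only [inner_e3, PiLp.add_apply, PiLp.smul_apply, smul_eq_mul,
    cross_apply_zero, cross_apply_one, cross_apply_two] <;> ring

/-- The vector product as a continuous bilinear map. -/
def crossL : E3 →L[ℝ] E3 →L[ℝ] E3 :=
  LinearMap.toContinuousLinearMap (LinearMap.toContinuousLinearMap.toLinearMap ∘ₗ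
    LinearMap.mk₂ ℝ cross
      (fun x y z => by apply ext_e3 <;> simp <;> ring)
      (fun c x y => by apply ext_e3 <;> simp <;> ring)
      (fun x y z => by apply ext_e3 <;> simp <;> ring)
      (fun c x y => by apply ext_e3 <;> simp <;> ring))

theorem crossL_apply (x y : E3) : crossL x y = cross x y := rfl

theorem cross_add_left (x y z : E3) : cross (x + y) z = cross x z + cross y z := by
  simp [← crossL_apply]
theorem cross_add_right (x y z : E3) : cross x (y + z) = cross x y + cross x z := by
  simp [← crossL_apply]
theorem cross_smul_left (c : ℝ) (x y : E3) : cross (c • x) y = c • cross x y := by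
  simp [← crossL_apply]
theorem cross_smul_right (c : ℝ) (x y : E3) : cross x (c • y) = c • cross x y := by
  simp [← crossL_apply]

theorem cross_self (x : E3) : cross x x = 0 := by apply ext_e3 <;> simp <;> ring

theorem cross_anticomm (x y : E3) : cross y x = -cross x y := by
  apply ext_e3 <;> simp <;> ring

section UnitNormal

variable {n p q : E3} (hn : ‖n‖ = 1) (hp : ⟪n, p⟫ = 0) (hq : ⟪n, q⟫ = 0)
include hn hp hq

theorem sq_inner_normal_cross : ⟪n, cross p q⟫ ^ 2 = ‖cross p q‖ ^ 2 := by
  have h := congrArg (fun v => ⟪n, v⟫) (cross_decomposition p q n)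
  simp only [inner_add_right, inner_smul_right, hp, hq, mul_zero, zero_add,
    real_inner_self_eq_norm_sq, hn] at h
  nlinarith

theorem cross_eq_smul_normal : cross p q = ⟪n, cross p q⟫ • n := by
  rw [← sub_eq_zero, ← norm_eq_zero, ← sq_eq_zero_iff, @norm_sub_sq_real, norm_smul, hn,
    inner_smul_right, real_inner_comm n (cross p q)]
  have := sq_inner_normal_cross hn hp hq
  rw [Real.norm_eq_abs, mul_one, sq_abs]
  nlinarith

theorem inner_normal_cross_ne_zero (hN : cross p q ≠ 0) : ⟪n, cross p q⟫ ≠ 0 := by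
  intro h
  have := sq_inner_normal_cross hn hp hq
  rw [h] at this
  exact hN (norm_eq_zero.1 (pow_eq_zero_iff two_ne_zero |>.1 (by linarith)))

end UnitNormal

/-- The first coordinate of the tangential part of `w` in the basis `p`, `q`. -/
def coefU (p q w : E3) : ℝ := ⟪cross w q, cross p q⟫ / ⟪cross p q, cross p q⟫

/-- The second coordinate of the tangential part of `w` in the basis `p`, `q`. -/
def coefV (p q w : E3) : ℝ := ⟪cross p w, cross p q⟫ / ⟪cross p q, cross p q⟫

/-- The coordinates `coefU`, `coefV` recover the projection to the plane spanned by `p` and `q`. -/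
theorem tangential_part_eq {n p q : E3} (hn : ‖n‖ = 1) (hp : ⟪n, p⟫ = 0) (hq : ⟪n, q⟫ = 0)
    (hN : cross p q ≠ 0) (w : E3) :
    w - ⟪n, w⟫ • n = coefU p q w • p + coefV p q w • q := by
  have hNN : ⟪cross p q, cross p q⟫ ≠ 0 := inner_self_ne_zero.2 hN
  have h1 := cross_decomposition p q w
  have h2 : ⟪w, cross p q⟫ • cross p q = (⟪cross p q, cross p q⟫ * ⟪n, w⟫) • n := by
    rw [real_inner_self_eq_norm_sq, ← sq_inner_normal_cross hn hp hq]
    rw [cross_eq_smul_normal hn hp hq, inner_smul_right, inner_smul_right, smul_smul,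
      real_inner_self_eq_norm_sq, hn, real_inner_comm n w]
    congr 1; ring
  rw [h2] at h1
  have h3 := congrArg (fun v => (⟪cross p q, cross p q⟫)⁻¹ • v) h1
  simp only [smul_add, smul_smul, inv_mul_cancel₀ hNN, ← mul_assoc, one_mul, one_smul] at h3
  rw [sub_eq_iff_eq_add]
  nth_rewrite 1 [h3]
  simp only [coefU, coefV, div_eq_inv_mul]

theorem coefU_basis (p q : E3) (hN : cross p q ≠ 0) (a b : ℝ) :
    coefU p q (a • p + b • q) = a := by
  have hNN : ⟪cross p q, cross p q⟫ ≠ 0 := inner_self_ne_zero.2 hN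
  rw [coefU, div_eq_iff hNN, cross_add_left, cross_smul_left, cross_smul_left, cross_self,
    smul_zero, add_zero, inner_smul_left]
  rfl

theorem coefV_basis (p q : E3) (hN : cross p q ≠ 0) (a b : ℝ) :
    coefV p q (a • p + b • q) = b := by
  have hNN : ⟪cross p q, cross p q⟫ ≠ 0 := inner_self_ne_zero.2 hN
  rw [coefV, div_eq_iff hNN, cross_add_right, cross_smul_right, cross_smul_right, cross_self,
    smul_zero, zero_add, inner_smul_left]
  rfl

/-! ### Parameter domains and partial derivatives -/

/-- The standard basis of the plane of parameters. -/
abbrev e2 (i : Fin 2) : E2 := EuclideanSpace.single i 1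

theorem e2_decomposition (x : E2) : x = x 0 • e2 0 + x 1 • e2 1 := by
  ext i; fin_cases i <;> simp

/-- A closed disk or a closed rectangle. -/
def IsParamDomain (D : Set E2) : Prop := IsClosedDisk D ∨ IsClosedRectangle D

/-- The partial derivative with respect to the `i`th coordinate, within `D`. -/
def pd {F : Type*} [NormedAddCommGroup F] [NormedSpace ℝ F] (D : Set E2) (f : E2 → F) (i : Fin 2)
    (x : E2) : F := fderivWithin ℝ f D x (e2 i)

theorem IsClosedRectangle.eq_preimage {D : Set E2} (h : IsClosedRectangle D) :
    ∃ a b : Fin 2 → ℝ, (∀ i, a i < b i) ∧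
      D = (EuclideanSpace.equiv (Fin 2) ℝ) ⁻¹' Icc a b := by
  obtain ⟨a, b, hab, rfl⟩ := h
  refine ⟨a, b, hab, ?_⟩
  ext x
  simp [Pi.le_def, forall_and, EuclideanSpace.equiv]

theorem IsParamDomain.convex {D : Set E2} (h : IsParamDomain D) : Convex ℝ D := by
  rcases h with ⟨c, ρ, -, rfl⟩ | h
  · exact convex_closedBall c ρ
  · obtain ⟨a, b, -, rfl⟩ := h.eq_preimage
    exact (convex_Icc a b).linear_preimage (EuclideanSpace.equiv (Fin 2) ℝ).toLinearMap

theorem IsParamDomain.isCompact {D : Set E2} (h : IsParamDomain D) : IsCompact D := by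
  rcases h with ⟨c, ρ, -, rfl⟩ | h
  · exact isCompact_closedBall c ρ
  · obtain ⟨a, b, -, rfl⟩ := h.eq_preimage
    exact (EuclideanSpace.equiv (Fin 2) ℝ).toHomeomorph.isCompact_preimage.2 isCompact_Icc

theorem IsParamDomain.nonempty_interior {D : Set E2} (h : IsParamDomain D) :
    (interior D).Nonempty := by
  rcases h with ⟨c, ρ, h, rfl⟩ | h
  · exact ⟨c, mem_interior_iff_mem_nhds.2 (Metric.closedBall_mem_nhds c h)⟩
  · obtain ⟨a, b, hab, rfl⟩ := h.eq_preimage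
    have : (EuclideanSpace.equiv (Fin 2) ℝ).toHomeomorph ⁻¹' (interior (Icc a b)) =
        interior ((EuclideanSpace.equiv (Fin 2) ℝ).toHomeomorph ⁻¹' (Icc a b)) :=
      Homeomorph.preimage_interior _ _
    change (interior ((EuclideanSpace.equiv (Fin 2) ℝ).toHomeomorph ⁻¹' (Icc a b))).Nonempty
    rw [← this]
    refine Set.Nonempty.preimage ?_ (Homeomorph.surjective _)
    rw [← pi_univ_Icc, interior_pi_set finite_univ]
    refine univ_pi_nonempty_iff.2 fun i => ?_
    rw [interior_Icc]
    exact nonempty_Ioo.2 (hab i)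

theorem IsParamDomain.isClosed {D : Set E2} (h : IsParamDomain D) : IsClosed D :=
  h.isCompact.isClosed

theorem IsParamDomain.measurableSet {D : Set E2} (h : IsParamDomain D) : MeasurableSet D :=
  h.isClosed.measurableSet

theorem IsParamDomain.uniqueDiffOn {D : Set E2} (h : IsParamDomain D) : UniqueDiffOn ℝ D :=
  uniqueDiffOn_convex h.convex h.nonempty_interior

theorem IsParamDomain.closure_interior {D : Set E2} (h : IsParamDomain D) :
    closure (interior D) = D := by
  rw [h.convex.closure_interior_eq_closure_of_nonempty_interior h.nonempty_interior,
    h.isClosed.closure_eq]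

section Partial

variable {F : Type*} [NormedAddCommGroup F] [NormedSpace ℝ F] {D : Set E2} {f : E2 → F}

theorem fderivWithin_eq_pd (D : Set E2) (f : E2 → F) (x ξ : E2) :
    fderivWithin ℝ f D x ξ = ξ 0 • pd D f 0 x + ξ 1 • pd D f 1 x := by
  conv_lhs => rw [e2_decomposition ξ]
  rw [map_add, map_smul, map_smul]; rfl

theorem contDiffOn_pd (hD : IsParamDomain D) (hf : ContDiffOn ℝ ∞ f D) (i : Fin 2) :
    ContDiffOn ℝ ∞ (pd D f i) D :=
  (hf.fderivWithin hD.uniqueDiffOn (by simp)).clm_apply contDiffOn_const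

theorem hasFDerivWithinAt_of_contDiffOn (hf : ContDiffOn ℝ ∞ f D) {x : E2} (hx : x ∈ D) :
    HasFDerivWithinAt f (fderivWithin ℝ f D x) D x :=
  (hf.differentiableOn (by simp) x hx).hasFDerivWithinAt

theorem pd_congr {g : E2 → F} (h : EqOn f g D) {x : E2} (hx : x ∈ D) (i : Fin 2) :
    pd D f i x = pd D g i x := by
  rw [pd, pd, fderivWithin_congr h (h hx)]

theorem pd_eq_of_hasFDerivWithinAt (hD : IsParamDomain D) {x : E2} (hx : x ∈ D)
    {f' : E2 →L[ℝ] F} (h : HasFDerivWithinAt f f' D x) (i : Fin 2) : pd D f i x = f' (e2 i) := by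
  rw [pd, h.fderivWithin (hD.uniqueDiffOn x hx)]

end Partial

theorem hasC1DerivOn_of_contDiffOn {V : Type*} [NormedAddCommGroup V] [InnerProductSpace ℝ V]
    {D : Set E2} {f : E2 → V} (hD : IsParamDomain D) (hf : ContDiffOn ℝ ∞ f D) :
    HasC1DerivOn f (fderivWithin ℝ f D) D where
  convex := hD.convex
  deriv x hx := hasFDerivWithinAt_of_contDiffOn hf hx
  cont := hf.continuousOn_fderivWithin hD.uniqueDiffOn (by simp)

theorem volFactor_eq_norm_cross (A : E2 →L[ℝ] E3) :
    volFactor A = ‖cross (A (e2 0)) (A (e2 1))‖ := by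
  rw [volFactor_eq_sqrt A (EuclideanSpace.basisFun (Fin 2) ℝ), @norm_eq_sqrt_real_inner]
  congr 1
  rw [Matrix.det_fin_two, inner_cross_cross]
  simp [Matrix.gram_apply]

theorem cross_ne_zero_of_injective {A : E2 →L[ℝ] E3} (hA : Function.Injective A) :
    cross (A (e2 0)) (A (e2 1)) ≠ 0 := by
  rw [← norm_ne_zero_iff, ← volFactor_eq_norm_cross]
  exact (volFactor_pos hA).ne'

theorem injective_of_cross_ne_zero {A : E2 →L[ℝ] E3} (hA : cross (A (e2 0)) (A (e2 1)) ≠ 0) :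
    Function.Injective A := by
  by_contra h
  rw [← norm_ne_zero_iff, ← volFactor_eq_norm_cross, volFactor_eq_zero h] at hA
  exact hA rfl

/-! ### Patches -/

/-- A parametrized piece of the set `S`. -/
structure IsPatch (S : Set E3) (D : Set E2) (r : E2 → E3) : Prop where
  domain : IsParamDomain D
  param : IsRegularParam D r
  sub : r '' D ⊆ S

/-- A smooth immersion of a closed disk or rectangle into the set `S`; it need not be injective. -/
structure IsImmersedPatch (S : Set E3) (D : Set E2) (r : E2 → E3) : Prop where
  domain : IsParamDomain D
  smooth : ContDiffOn ℝ ∞ r D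
  regular : ∀ x ∈ D, Function.Injective (fderivWithin ℝ r D x)
  mapsTo : MapsTo r D S

theorem IsPatch.immersed {S : Set E3} {D : Set E2} {r : E2 → E3} (h : IsPatch S D r) :
    IsImmersedPatch S D r :=
  ⟨h.domain, h.param.smooth, h.param.regular, mapsTo_iff_image_subset.2 h.sub⟩

/-- The vector product of the partial derivatives of a parametrization. -/
def nrm (D : Set E2) (r : E2 → E3) (x : E2) : E3 := cross (pd D r 0 x) (pd D r 1 x)

theorem volFactor_fderivWithin (D : Set E2) (r : E2 → E3) (x : E2) :
    volFactor (fderivWithin ℝ r D x) = ‖nrm D r x‖ := volFactor_eq_norm_cross _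

section PatchCalculus

variable {S : Set E3} {D : Set E2} {r : E2 → E3}

theorem IsImmersedPatch.nrm_ne_zero (h : IsImmersedPatch S D r) {x : E2} (hx : x ∈ D) :
    nrm D r x ≠ 0 := cross_ne_zero_of_injective (h.regular x hx)

theorem IsImmersedPatch.c1 (h : IsImmersedPatch S D r) :
    HasC1DerivOn r (fderivWithin ℝ r D) D := hasC1DerivOn_of_contDiffOn h.domain h.smooth

theorem IsImmersedPatch.contDiffOn_nrm (h : IsImmersedPatch S D r) :
    ContDiffOn ℝ ∞ (nrm D r) D :=
  ((crossL.contDiff.comp_contDiffOn (contDiffOn_pd h.domain h.smooth 0)).clm_apply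
    (contDiffOn_pd h.domain h.smooth 1))

/-- The inverse of a parametrization is Lipschitz. -/
theorem IsPatch.exists_antilipschitz (h : IsPatch S D r) :
    ∃ K : ℝ, 0 < K ∧ ∀ x ∈ D, ∀ y ∈ D, ‖x - y‖ ≤ K * ‖r x - r y‖ := by
  have hcomp : IsCompact (D ×ˢ D) := h.domain.isCompact.prod h.domain.isCompact
  have hr : ContinuousOn r D := h.param.smooth.continuousOn
  let p : Set (E2 × E2) → Prop := fun T => ∃ K : ℝ, 0 < K ∧ ∀ z ∈ T,
    ‖z.1 - z.2‖ ≤ K * ‖r z.1 - r z.2‖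
  -- By compactness of `D ×ˢ D`, a local estimate near each pair `(x, y)` is enough.
  have main : p (D ×ˢ D) := by
    refine hcomp.induction_on (p := p) ⟨1, one_pos, by simp⟩ ?_ ?_ ?_
    · rintro s t hst ⟨K, hK, H⟩
      exact ⟨K, hK, fun z hz => H z (hst hz)⟩
    · rintro s t ⟨K, hK, H⟩ ⟨K', hK', H'⟩
      refine ⟨max K K', lt_max_of_lt_left hK, ?_⟩
      rintro z (hz | hz)
      · exact (H z hz).trans (by gcongr; exact le_max_left _ _)
      · exact (H' z hz).trans (by gcongr; exact le_max_right _ _)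
    · rintro ⟨x, y⟩ ⟨hx, hy⟩
      by_cases hxy : x = y
      · subst hxy
        -- Near the diagonal `r` is close to its derivative, which is injective.
        obtain ⟨K, hK, hKA⟩ := (fderivWithin ℝ r D x).toLinearMap.exists_antilipschitzWith
          (LinearMap.ker_eq_bot.2 (h.param.regular x hx))
        have hK' : (0 : ℝ) < K := by exact_mod_cast hK
        obtain ⟨δ, hδ⟩ : ∃ δ : ℝ≥0, (δ : ℝ) = (2 * (K : ℝ))⁻¹ :=
          ⟨⟨(2 * (K : ℝ))⁻¹, by positivity⟩, rfl⟩
        obtain ⟨ε, hε, H⟩ := h.immersed.c1.approximates hx (δ := δ)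
          (by rw [← NNReal.coe_pos, hδ]; positivity)
        refine ⟨(D ∩ Metric.ball x ε) ×ˢ (D ∩ Metric.ball x ε), ?_, 2 * K, by positivity, ?_⟩
        · rw [nhdsWithin_prod_eq]
          exact Filter.prod_mem_prod (inter_mem_nhdsWithin _ (Metric.ball_mem_nhds x hε))
            (inter_mem_nhdsWithin _ (Metric.ball_mem_nhds x hε))
        · rintro ⟨a, b⟩ ⟨ha, hb⟩
          have h1 := H a ha b hb
          have h2 := hKA.le_mul_dist a b
          rw [dist_eq_norm, dist_eq_norm, ← map_sub] at h2
          simp only at h2 ⊢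
          have h3 : ‖fderivWithin ℝ r D x (a - b)‖ ≤
              ‖r a - r b‖ + ‖r a - r b - fderivWithin ℝ r D x (a - b)‖ := by
            have := norm_sub_le (r a - r b) (r a - r b - fderivWithin ℝ r D x (a - b))
            rwa [sub_sub_cancel] at this
          rw [hδ] at h1
          have h4 : ‖a - b‖ ≤ K * (‖r a - r b‖ + (2 * (K : ℝ))⁻¹ * ‖a - b‖) :=
            h2.trans (by gcongr; exact h3.trans (by linarith))
          have h5 : (K : ℝ) * (‖r a - r b‖ + (2 * (K : ℝ))⁻¹ * ‖a - b‖) =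
            K * ‖r a - r b‖ + ‖a - b‖ / 2 := by field_simp
          rw [h5] at h4; linarith
      · have hne : r x - r y ≠ 0 := fun h0 => hxy (h.param.inj hx hy (sub_eq_zero.1 h0))
        -- Off the diagonal `‖r x - r y‖` is bounded below by continuity.
        have hpos : 0 < ‖r x - r y‖ := norm_pos_iff.2 hne
        have hc : ContinuousWithinAt (fun z : E2 × E2 => ‖r z.1 - r z.2‖) (D ×ˢ D) (x, y) := by
          have : ContinuousOn (fun z : E2 × E2 => ‖r z.1 - r z.2‖) (D ×ˢ D) :=
            ((hr.comp continuousOn_fst fun z hz => hz.1).sub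
              (hr.comp continuousOn_snd fun z hz => hz.2)).norm
          exact this _ ⟨hx, hy⟩
        have hc2 : ContinuousWithinAt (fun z : E2 × E2 => ‖z.1 - z.2‖) (D ×ˢ D) (x, y) := by
          fun_prop
        have hxy0 : 0 ≤ ‖x - y‖ := norm_nonneg _
        have ev : ∀ᶠ z in 𝓝[D ×ˢ D] (x, y), ‖z.1 - z.2‖ <
            ((‖x - y‖ + 1) * 2 / ‖r x - r y‖) * ‖r z.1 - r z.2‖ := by
          refine hc2.eventually_lt (continuousWithinAt_const.mul hc) ?_
          simp only [Pi.mul_apply]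
          field_simp
          nlinarith
        exact ⟨_, ev, _, by positivity, fun z hz => le_of_lt hz⟩
  obtain ⟨K, hK, H⟩ := main
  exact ⟨K, hK, fun x hx y hy => H (x, y) ⟨hx, hy⟩⟩

/-- A left inverse of the linear map with columns `p`, `q`, vanishing on the normal line. -/
def leftInv (p q : E3) : E3 →L[ℝ] E2 :=
  LinearMap.toContinuousLinearMap
    { toFun := fun w => coefU p q w • e2 0 + coefV p q w • e2 1
      map_add' := fun v w => by
        simp only [coefU, coefV, cross_add_left, cross_add_right, inner_add_left, add_div,
          add_smul]
        abel
      map_smul' := fun c v => by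
        simp only [coefU, coefV, cross_smul_left, cross_smul_right, inner_smul_left,
          RingHom.id_apply, smul_add, smul_smul, mul_div_assoc, conj_trivial] }

theorem leftInv_apply (p q w : E3) :
    leftInv p q w = coefU p q w • e2 0 + coefV p q w • e2 1 := rfl

theorem IsImmersedPatch.leftInv_fderivWithin (h : IsImmersedPatch S D r) {x : E2} (hx : x ∈ D)
    (ξ : E2) : leftInv (pd D r 0 x) (pd D r 1 x) (fderivWithin ℝ r D x ξ) = ξ := by
  rw [fderivWithin_eq_pd, leftInv_apply, coefU_basis _ _ (h.nrm_ne_zero hx),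
    coefV_basis _ _ (h.nrm_ne_zero hx), ← e2_decomposition]

theorem IsPatch.tendsto_invFunOn (h : IsPatch S D r) {x : E2} (hx : x ∈ D) :
    Filter.Tendsto (Function.invFunOn r D) (𝓝[r '' D] (r x)) (𝓝[D] x) := by
  obtain ⟨K, hK, H⟩ := h.exists_antilipschitz
  rw [tendsto_nhdsWithin_iff]
  constructor
  · rw [tendsto_iff_norm_sub_tendsto_zero]
    have h1 : Filter.Tendsto (fun y => K * ‖y - r x‖) (𝓝[r '' D] (r x)) (𝓝 0) := by
      have : Continuous fun y : E3 => K * ‖y - r x‖ := by fun_prop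
      have := (this.tendsto (r x)).mono_left (nhdsWithin_le_nhds (s := r '' D))
      simpa using this
    refine squeeze_zero' (Filter.Eventually.of_forall fun _ => norm_nonneg _) ?_ h1
    filter_upwards [self_mem_nhdsWithin]
    rintro _ ⟨y, hy, rfl⟩
    rw [h.param.inj.leftInvOn_invFunOn hy]
    exact H y hy x hx
  · filter_upwards [self_mem_nhdsWithin]
    rintro _ ⟨y, hy, rfl⟩
    rwa [h.param.inj.leftInvOn_invFunOn hy]

/-- The inverse of a parametrization is differentiable within the patch: it is Lipschitz, so errors
that are small in the image are small in the domain. -/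
theorem IsPatch.hasFDerivWithinAt_invFunOn (h : IsPatch S D r) {x : E2} (hx : x ∈ D) :
    HasFDerivWithinAt (Function.invFunOn r D) (leftInv (pd D r 0 x) (pd D r 1 x))
      (r '' D) (r x) := by
  obtain ⟨K, hK, H⟩ := h.exists_antilipschitz
  have ht := h.tendsto_invFunOn hx
  have h1 := (hasFDerivWithinAt_of_contDiffOn h.param.smooth hx).isLittleO.comp_tendsto ht
  have h2 : (fun y => Function.invFunOn r D y - x) =O[𝓝[r '' D] (r x)] fun y => y - r x := by
    refine Asymptotics.IsBigO.of_bound K ?_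
    filter_upwards [self_mem_nhdsWithin]
    rintro _ ⟨y, hy, rfl⟩
    rw [h.param.inj.leftInvOn_invFunOn hy]
    exact H y hy x hx
  have h3 := h1.trans_isBigO h2
  have h4 := ((leftInv (pd D r 0 x) (pd D r 1 x)).isBigO_comp _ _).trans_isLittleO h3
  refine HasFDerivWithinAt.of_isLittleO (h4.neg_left.congr' ?_ Filter.EventuallyEq.rfl)
  filter_upwards [self_mem_nhdsWithin]
  rintro _ ⟨y, hy, rfl⟩
  simp only [Function.comp, h.param.inj.leftInvOn_invFunOn hy, h.param.inj.leftInvOn_invFunOn hx]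
  rw [map_sub, h.immersed.leftInv_fderivWithin hx]
  abel

theorem IsSurface.exists_patch (hS : IsSurface S) {P : E3} (hP : P ∈ S) :
    ∃ D r, IsPatch S D r ∧ ∃ O ∈ 𝓝 P, S ∩ O = r '' D := by
  obtain ⟨O, hO, -, D, r, hD, hr, h⟩ := hS.2 P hP
  exact ⟨D, r, ⟨hD, hr, h ▸ inter_subset_left⟩, O, hO, h⟩

theorem IsSurfaceWithSmoothBoundary.isSurface (hS : IsSurfaceWithSmoothBoundary S) :
    IsSurface S := ⟨hS.1, fun P hP => by
  obtain ⟨O, hO, hc, D, r, hD, h⟩ := hS.2 P hP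
  exact ⟨O, hO, hc, D, r, Or.inl hD, h⟩⟩

theorem IsSurface.exists_patch_point (hS : IsSurface S) {P : E3} (hP : P ∈ S) :
    ∃ D r x, IsPatch S D r ∧ x ∈ D ∧ r x = P ∧ 𝓝[S] P = 𝓝[r '' D] P := by
  obtain ⟨D, r, h, O, hO, hSO⟩ := hS.exists_patch hP
  have : P ∈ r '' D := hSO ▸ ⟨hP, mem_of_mem_nhds hO⟩
  obtain ⟨x, hx, rfl⟩ := this
  refine ⟨D, r, x, h, hx, rfl, ?_⟩
  rw [← hSO, nhdsWithin_inter_of_mem' (mem_nhdsWithin_of_mem_nhds hO)]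

/-- Functions on a surface are continuous when they are so in the patches. -/
theorem IsSurface.continuousOn_of_patches (hS : IsSurface S) {X : Type*} [TopologicalSpace X]
    {f : E3 → X} (hf : ∀ D r, IsPatch S D r → ContinuousOn (f ∘ r) D) : ContinuousOn f S := by
  intro P hP
  obtain ⟨D, r, x, h, hx, rfl, hnhds⟩ := hS.exists_patch_point hP
  have h1 : Filter.Tendsto f (𝓝[r '' D] (r x)) (𝓝 (f (r x))) := by
    have h2 : Filter.Tendsto (f ∘ r ∘ Function.invFunOn r D) (𝓝[r '' D] (r x)) (𝓝 (f (r x))) :=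
      ((hf D r h) x hx).tendsto.comp (h.tendsto_invFunOn hx)
    refine h2.congr' ?_
    filter_upwards [self_mem_nhdsWithin]
    rintro _ ⟨y, hy, rfl⟩
    simp only [Function.comp, h.param.inj.leftInvOn_invFunOn hy]
  rw [ContinuousWithinAt, hnhds]
  exact h1

/-- `f` is smooth in every patch of `S`. -/
def IsSmoothOn {F : Type*} [NormedAddCommGroup F] [NormedSpace ℝ F] (S : Set E3) (f : E3 → F) :
    Prop := ∀ D r, IsPatch S D r → ContDiffOn ℝ ∞ (f ∘ r) D

variable {F : Type*} [NormedAddCommGroup F] [NormedSpace ℝ F] {f : E3 → F}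

theorem IsSmoothOn.differentiableWithinAt (hS : IsSurface S) (hf : IsSmoothOn S f) {P : E3}
    (hP : P ∈ S) : DifferentiableWithinAt ℝ f S P := by
  obtain ⟨D, r, x, h, hx, rfl, hnhds⟩ := hS.exists_patch_point hP
  have h1 : HasFDerivWithinAt ((f ∘ r) ∘ Function.invFunOn r D)
      ((fderivWithin ℝ (f ∘ r) D x).comp (leftInv (pd D r 0 x) (pd D r 1 x))) (r '' D) (r x) := by
    refine HasFDerivWithinAt.comp (t := D) (r x) (g := f ∘ r) (g' := fderivWithin ℝ (f ∘ r) D x) ?_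
      (h.hasFDerivWithinAt_invFunOn hx) ?_
    · rw [h.param.inj.leftInvOn_invFunOn hx]
      exact hasFDerivWithinAt_of_contDiffOn (hf D r h) hx
    · rintro _ ⟨y, hy, rfl⟩
      rwa [h.param.inj.leftInvOn_invFunOn hy]
  have h2 := h1.congr (f₁ := f) ?_ ?_
  rotate_left
  · rintro _ ⟨y, hy, rfl⟩
    simp only [Function.comp, h.param.inj.leftInvOn_invFunOn hy]
  · simp only [Function.comp, h.param.inj.leftInvOn_invFunOn hx]
  exact ⟨_, h2.mono_of_mem_nhdsWithin (hnhds ▸ self_mem_nhdsWithin)⟩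

theorem IsSmoothOn.continuousOn (hS : IsSurface S) (hf : IsSmoothOn S f) : ContinuousOn f S :=
  fun _ hP => (hf.differentiableWithinAt hS hP).continuousWithinAt

/-- The derivative of a map into `S` is tangent to `S`. This includes points on the edge of the
domain, as long as the tangent cone there still spans the whole space. -/
theorem fderivWithin_mem_tangentPlane {E : Type*} [NormedAddCommGroup E] [NormedSpace ℝ E]
    [FiniteDimensional ℝ E] {T : Set E} {c : E → E3} {c' : E →L[ℝ] E3} {t : E}
    (hc : HasFDerivWithinAt c c' T t) (hT : UniqueDiffWithinAt ℝ T t) (hcS : MapsTo c T S)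
    (ξ : E) : c' ξ ∈ tangentPlane S (c t) := by
  have h1 : Submodule.span ℝ (tangentConeAt ℝ T t) = ⊤ := by
    have h2 := hT.dense_tangentConeAt
    have h3 : IsClosed (Submodule.span ℝ (tangentConeAt ℝ T t) : Set E) :=
      Submodule.closed_of_finiteDimensional _
    rw [Submodule.eq_top_iff']
    intro y
    have := h2 y
    rwa [h3.closure_eq] at this
  have h4 : (⊤ : Submodule ℝ E) ≤ (tangentPlane S (c t)).comap c'.toLinearMap := by
    rw [← h1, Submodule.span_le]
    intro v hv
    exact Submodule.subset_span (tangentConeAt_mono hcS.image_subset (hc.mapsTo_tangent_cone hv))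
  exact h4 (Submodule.mem_top (x := ξ))

end PatchCalculus

section Cooriented

variable {S : Set E3} {n : E3 → E3} {D : Set E2} {r : E2 → E3}

theorem IsImmersedPatch.pd_mem_tangentPlane (h : IsImmersedPatch S D r) {x : E2} (hx : x ∈ D)
    (i : Fin 2) : pd D r i x ∈ tangentPlane S (r x) :=
  fderivWithin_mem_tangentPlane (h.c1.deriv x hx) (h.domain.uniqueDiffOn x hx) h.mapsTo _

theorem IsImmersedPatch.inner_normal_pd (h : IsImmersedPatch S D r) (hn : IsCoorientation S n)
    {x : E2} (hx : x ∈ D) (i : Fin 2) : ⟪n (r x), pd D r i x⟫ = 0 :=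
  hn.normal _ (h.mapsTo hx) _ (h.pd_mem_tangentPlane hx i)

/-- The tangent plane, defined through the tangent cone, is the full orthogonal complement of the
normal, also at boundary points of the surface. -/
theorem IsCoorientation.mem_tangentPlane_iff (hS : IsSurface S) (hn : IsCoorientation S n)
    {P : E3} (hP : P ∈ S) (v : E3) : v ∈ tangentPlane S P ↔ ⟪n P, v⟫ = 0 := by
  refine ⟨fun hv => hn.normal P hP v hv, fun hv => ?_⟩
  obtain ⟨D, r, x, h, hx, rfl, -⟩ := hS.exists_patch_point hP
  have h1 := tangential_part_eq (hn.unit _ hP) (h.immersed.inner_normal_pd hn hx 0)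
    (h.immersed.inner_normal_pd hn hx 1) (h.immersed.nrm_ne_zero hx) v
  rw [hv, zero_smul, sub_zero] at h1
  rw [h1]
  exact Submodule.add_mem _ (Submodule.smul_mem _ _ (h.immersed.pd_mem_tangentPlane hx 0))
    (Submodule.smul_mem _ _ (h.immersed.pd_mem_tangentPlane hx 1))

/-- The normal is, up to a constant sign, the normalized vector product of the partial
derivatives. -/
theorem IsImmersedPatch.exists_sign (h : IsImmersedPatch S D r) (hn : IsCoorientation S n) :
    ∃ s : ℝ, (s = 1 ∨ s = -1) ∧ ∀ x ∈ D, ⟪n (r x), nrm D r x⟫ = s * ‖nrm D r x‖ := by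
  have hc1 : ContinuousOn (fun x => ⟪n (r x), nrm D r x⟫) D :=
    (hn.cont.comp h.smooth.continuousOn h.mapsTo).inner h.contDiffOn_nrm.continuousOn
  have hc2 : ContinuousOn (fun x => ‖nrm D r x‖) D := h.contDiffOn_nrm.continuousOn.norm
  have hsq : EqOn ((fun x => ⟪n (r x), nrm D r x⟫) ^ 2) ((fun x => ‖nrm D r x‖) ^ 2) D :=
    fun x hx => sq_inner_normal_cross (hn.unit _ (h.mapsTo hx)) (h.inner_normal_pd hn hx 0)
      (h.inner_normal_pd hn hx 1)
  rcases h.domain.convex.isPreconnected.eq_or_eq_neg_of_sq_eq hc1 hc2 hsq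
    (fun {x} hx => norm_ne_zero_iff.2 (h.nrm_ne_zero hx)) with h1 | h1
  · exact ⟨1, Or.inl rfl, fun x hx => by simpa using h1 hx⟩
  · exact ⟨-1, Or.inr rfl, fun x hx => by simpa using h1 hx⟩

theorem IsImmersedPatch.nrm_eq (h : IsImmersedPatch S D r) (hn : IsCoorientation S n)
    {x : E2} (hx : x ∈ D) : nrm D r x = ⟪n (r x), nrm D r x⟫ • n (r x) :=
  cross_eq_smul_normal (hn.unit _ (h.mapsTo hx)) (h.inner_normal_pd hn hx 0)
    (h.inner_normal_pd hn hx 1)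

/-- A coorientation, assumed only continuous, is smooth. -/
theorem IsImmersedPatch.contDiffOn_normal (h : IsImmersedPatch S D r)
    (hn : IsCoorientation S n) : ContDiffOn ℝ ∞ (n ∘ r) D := by
  obtain ⟨s, hs, H⟩ := h.exists_sign hn
  have h1 : ContDiffOn ℝ ∞ (fun x => (s * ‖nrm D r x‖)⁻¹ • nrm D r x) D := by
    refine ContDiffOn.smul (ContDiffOn.inv (contDiffOn_const.mul
      (h.contDiffOn_nrm.norm ℝ fun x hx => h.nrm_ne_zero hx)) fun x hx => ?_) h.contDiffOn_nrm
    have := norm_ne_zero_iff.2 (h.nrm_ne_zero hx)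
    rcases hs with rfl | rfl <;> simpa using h.nrm_ne_zero hx
  refine h1.congr fun x hx => ?_
  have h2 := h.nrm_eq hn hx
  rw [H x hx] at h2
  have h3 : s * ‖nrm D r x‖ ≠ 0 := by
    rcases hs with rfl | rfl <;> simpa using h.nrm_ne_zero hx
  nth_rewrite 2 [h2]
  rw [smul_smul, inv_mul_cancel₀ h3, one_smul, Function.comp]

theorem IsCoorientation.isSmoothOn (hn : IsCoorientation S n) : IsSmoothOn S n :=
  fun _ _ h => h.immersed.contDiffOn_normal hn

variable {F : Type*} [NormedAddCommGroup F] [NormedSpace ℝ F] {f : E3 → F}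

/-- The differential of a function on a cooriented surface, extended by zero to the normal
line. -/
def surfDeriv (S : Set E3) (n : E3 → E3) (f : E3 → F) (P : E3) : E3 →L[ℝ] F :=
  (fderivWithin ℝ f S P).comp
    (ContinuousLinearMap.id ℝ E3 - (innerSL ℝ (n P)).smulRight (n P))

theorem surfDeriv_apply (S : Set E3) (n : E3 → E3) (f : E3 → F) (P w : E3) :
    surfDeriv S n f P w = fderivWithin ℝ f S P (w - ⟪n P, w⟫ • n P) := by
  simp [surfDeriv]

theorem surfDeriv_normal (hn : IsCoorientation S n) {P : E3} (hP : P ∈ S) :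
    surfDeriv S n f P (n P) = 0 := by
  rw [surfDeriv_apply, real_inner_self_eq_norm_sq, hn.unit P hP]
  simp

/-- The chain rule for a map into a surface followed by a function on the surface. -/
theorem IsSmoothOn.hasFDerivWithinAt_comp (hS : IsSurface S) (hn : IsCoorientation S n)
    (hf : IsSmoothOn S f) {E : Type*} [NormedAddCommGroup E] [NormedSpace ℝ E]
    [FiniteDimensional ℝ E] {T : Set E} {c : E → E3} {c' : E →L[ℝ] E3} {t : E} (ht : t ∈ T)
    (hc : HasFDerivWithinAt c c' T t) (hT : UniqueDiffWithinAt ℝ T t) (hcS : MapsTo c T S) :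
    HasFDerivWithinAt (f ∘ c) ((surfDeriv S n f (c t)).comp c') T t := by
  have h1 := (hf.differentiableWithinAt hS (hcS ht)).hasFDerivWithinAt.comp t hc hcS
  convert h1 using 1
  ext ξ
  rw [ContinuousLinearMap.comp_apply, surfDeriv_apply, hn.normal _ (hcS ht) _
    (fderivWithin_mem_tangentPlane hc hT hcS ξ), zero_smul, sub_zero,
    ContinuousLinearMap.comp_apply]

theorem IsSmoothOn.pd_comp (hS : IsSurface S) (hn : IsCoorientation S n) (hf : IsSmoothOn S f)
    (h : IsImmersedPatch S D r) {x : E2} (hx : x ∈ D) (i : Fin 2) :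
    pd D (f ∘ r) i x = surfDeriv S n f (r x) (pd D r i x) :=
  pd_eq_of_hasFDerivWithinAt h.domain hx
    (hf.hasFDerivWithinAt_comp hS hn hx (h.c1.deriv x hx) (h.domain.uniqueDiffOn x hx) h.mapsTo) i

/-- The differential of a function on the surface in the coordinates of a patch. -/
theorem IsSmoothOn.surfDeriv_eq (hS : IsSurface S) (hn : IsCoorientation S n)
    (hf : IsSmoothOn S f) (h : IsImmersedPatch S D r) {x : E2} (hx : x ∈ D) (w : E3) :
    surfDeriv S n f (r x) w = coefU (pd D r 0 x) (pd D r 1 x) w • pd D (f ∘ r) 0 x +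
      coefV (pd D r 0 x) (pd D r 1 x) w • pd D (f ∘ r) 1 x := by
  have h1 := tangential_part_eq (hn.unit _ (h.mapsTo hx)) (h.inner_normal_pd hn hx 0)
    (h.inner_normal_pd hn hx 1) (h.nrm_ne_zero hx) w
  rw [hf.pd_comp hS hn h hx, hf.pd_comp hS hn h hx, ← map_smul, ← map_smul, ← map_add, ← h1,
    map_sub, map_smul, surfDeriv_normal hn (h.mapsTo hx), smul_zero, sub_zero]

theorem IsSmoothOn.continuousOn_surfDeriv (hS : IsSurface S) (hn : IsCoorientation S n)
    (hf : IsSmoothOn S f) (w : E3) : ContinuousOn (fun P => surfDeriv S n f P w) S := by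
  refine hS.continuousOn_of_patches fun D r h => ?_
  have hp : ∀ i, ContinuousOn (pd D r i) D := fun i =>
    (contDiffOn_pd h.domain h.param.smooth i).continuousOn
  have hfp : ∀ i, ContinuousOn (pd D (f ∘ r) i) D := fun i =>
    (contDiffOn_pd h.domain (hf D r h) i).continuousOn
  have hN : ContinuousOn (nrm D r) D := h.immersed.contDiffOn_nrm.continuousOn
  have hNN : ∀ x ∈ D, ⟪nrm D r x, nrm D r x⟫ ≠ 0 := fun x hx =>
    inner_self_ne_zero.2 (h.immersed.nrm_ne_zero hx)
  have hcu : ContinuousOn (fun x => coefU (pd D r 0 x) (pd D r 1 x) w) D :=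
    ContinuousOn.div (ContinuousOn.inner (((crossL w).continuous).comp_continuousOn (hp 1)) hN)
      (hN.inner hN) hNN
  have hcv : ContinuousOn (fun x => coefV (pd D r 0 x) (pd D r 1 x) w) D :=
    ContinuousOn.div (ContinuousOn.inner
      ((crossL.continuous.comp_continuousOn (hp 0)).clm_apply continuousOn_const) hN)
      (hN.inner hN) hNN
  refine ((hcu.smul (hfp 0)).add (hcv.smul (hfp 1))).congr fun x hx => ?_
  exact hf.surfDeriv_eq hS hn h.immersed hx w

end Cooriented

/-! ### The Jacobian of the spherical map -/

/-- The standard basis of three-space. -/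
abbrev e3 (i : Fin 3) : E3 := EuclideanSpace.single i 1

theorem map_e3 {F : Type*} [AddCommGroup F] [Module ℝ F] (A : E3 →ₗ[ℝ] F) (w : E3) :
    A w = w 0 • A (e3 0) + w 1 • A (e3 1) + w 2 • A (e3 2) := by
  rw [← map_smul, ← map_smul, ← map_smul, ← map_add, ← map_add]
  congr 1
  apply ext_e3 <;> simp

/-- A linear map multiplies triple products by its determinant. -/
theorem triple_product_map (A : E3 →ₗ[ℝ] E3) (p q w : E3) :
    ⟪cross (A p) (A q), A w⟫ = LinearMap.det A * ⟪cross p q, w⟫ := by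
  rw [← LinearMap.det_toMatrix (EuclideanSpace.basisFun (Fin 3) ℝ).toBasis, Matrix.det_fin_three]
  simp only [LinearMap.toMatrix_apply, OrthonormalBasis.coe_toBasis, EuclideanSpace.basisFun_apply,
    OrthonormalBasis.coe_toBasis_repr_apply, EuclideanSpace.basisFun_repr]
  rw [map_e3 A p, map_e3 A q, map_e3 A w]
  simp only [inner_e3, PiLp.add_apply, PiLp.smul_apply, smul_eq_mul,
    cross_apply_zero, cross_apply_one, cross_apply_two]
  ring

theorem sphericalDifferential_apply (S : Set E3) (n : E3 → E3) (P v : E3) :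
    sphericalDifferential S n P v = surfDeriv S n n P v + ⟪n P, v⟫ • n P := by
  rw [surfDeriv_apply]; rfl

section Jacobian

variable {S : Set E3} {n : E3 → E3} {D : Set E2} {r : E2 → E3}

theorem IsImmersedPatch.inner_normal_pd_normal (h : IsImmersedPatch S D r)
    (hn : IsCoorientation S n) {x : E2} (hx : x ∈ D) (i : Fin 2) :
    ⟪n (r x), pd D (n ∘ r) i x⟫ = 0 := by
  have hd := hasFDerivWithinAt_of_contDiffOn (h.contDiffOn_normal hn) hx
  have h1 := (hd.inner ℝ hd)
  have h2 : HasFDerivWithinAt (fun y => ⟪(n ∘ r) y, (n ∘ r) y⟫) (0 : E2 →L[ℝ] ℝ) D x := by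
    refine (hasFDerivWithinAt_const (1 : ℝ) x D).congr (fun y hy => ?_) ?_
    · rw [real_inner_self_eq_norm_sq, Function.comp, hn.unit _ (h.mapsTo hy)]; norm_num
    · rw [real_inner_self_eq_norm_sq, Function.comp, hn.unit _ (h.mapsTo hx)]; norm_num
  have h3 := congrArg (fun L => L (e2 i)) ((h.domain.uniqueDiffOn x hx).eq h1 h2)
  simp only [ContinuousLinearMap.comp_apply, fderivInnerCLM_apply, ContinuousLinearMap.prod_apply,
    zero_apply] at h3
  rw [real_inner_comm ((n ∘ r) x)] at h3
  have h4 : ⟪(n ∘ r) x, fderivWithin ℝ (n ∘ r) D x (e2 i)⟫ = 0 := by linarith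
  exact h4

/-- The spherical map multiplies oriented area elements by its Jacobian. -/
theorem IsImmersedPatch.cross_pd_normal (hS : IsSurface S) (h : IsImmersedPatch S D r)
    (hn : IsCoorientation S n) {x : E2} (hx : x ∈ D) :
    nrm D (n ∘ r) x = sphericalJacobian S n (r x) • nrm D r x := by
  have hP := h.mapsTo hx
  have hA : ∀ i, sphericalDifferential S n (r x) (pd D r i x) = pd D (n ∘ r) i x := fun i => by
    rw [sphericalDifferential_apply, h.inner_normal_pd hn hx, zero_smul, add_zero,
      hn.isSmoothOn.pd_comp hS hn h hx]
  have hAn : sphericalDifferential S n (r x) (n (r x)) = n (r x) := by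
    rw [sphericalDifferential_apply, surfDeriv_normal hn hP, real_inner_self_eq_norm_sq,
      hn.unit _ hP]
    simp
  have h1 := triple_product_map (sphericalDifferential S n (r x)) (pd D r 0 x) (pd D r 1 x)
    (n (r x))
  rw [hA, hA, hAn] at h1
  rw [h.nrm_eq hn hx, nrm, cross_eq_smul_normal (hn.unit _ hP)
    (h.inner_normal_pd_normal hn hx 0) (h.inner_normal_pd_normal hn hx 1), smul_smul]
  congr 1
  rw [real_inner_comm, h1, real_inner_comm]
  rfl

/-- The differential of the spherical map takes values in the tangent plane. -/
theorem inner_normal_surfDeriv_normal (hS : IsSurface S) (hn : IsCoorientation S n) {P : E3}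
    (hP : P ∈ S) (w : E3) : ⟪n P, surfDeriv S n n P w⟫ = 0 := by
  obtain ⟨D, r, x, h, hx, rfl, -⟩ := hS.exists_patch_point hP
  rw [hn.isSmoothOn.surfDeriv_eq hS hn h.immersed hx, inner_add_right, inner_smul_right,
    inner_smul_right, h.immersed.inner_normal_pd_normal hn hx,
    h.immersed.inner_normal_pd_normal hn hx]
  simp

/-- The trace of the differential of the spherical map: twice the mean curvature. -/
def sphericalTrace (S : Set E3) (n : E3 → E3) (P : E3) : ℝ :=
  surfDeriv S n n P (e3 0) 0 + surfDeriv S n n P (e3 1) 1 + surfDeriv S n n P (e3 2) 2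

/-- The polarization of `IsImmersedPatch.cross_pd_normal`: it gives the part linear in `ε` of the
area element of the shifted surface. -/
theorem IsImmersedPatch.cross_pd_normal_add (hS : IsSurface S) (h : IsImmersedPatch S D r)
    (hn : IsCoorientation S n) {x : E2} (hx : x ∈ D) :
    cross (pd D (n ∘ r) 0 x) (pd D r 1 x) + cross (pd D r 0 x) (pd D (n ∘ r) 1 x) =
      sphericalTrace S n (r x) • nrm D r x := by
  set A := surfDeriv S n n (r x) with hAdef
  have h0 : ∀ w, ⟪A w, nrm D r x⟫ = 0 := fun w => by
    rw [h.nrm_eq hn hx, inner_smul_right, real_inner_comm (n (r x)) (A w),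
      inner_normal_surfDeriv_normal hS hn (h.mapsTo hx), mul_zero]
  -- For any linear `A`, the derivation extending `A` to vector products is `tr A` minus the
  -- transpose of `A`.
  have key : ∀ p q : E3, cross (A p) q + cross p (A q) +
      (WithLp.toLp 2 fun i => ⟪A (e3 i), cross p q⟫ : E3) =
      ((A (e3 0)) 0 + (A (e3 1)) 1 + (A (e3 2)) 2) • cross p q := by
    intro p q
    have h1 := map_e3 A.toLinearMap p
    have h2 := map_e3 A.toLinearMap q
    simp only [ContinuousLinearMap.coe_coe] at h1 h2
    rw [h1, h2]
    apply ext_e3 <;> simp only [inner_e3, PiLp.add_apply, PiLp.smul_apply, smul_eq_mul,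
      cross_apply_zero, cross_apply_one, cross_apply_two] <;> ring
  have h3 := key (pd D r 0 x) (pd D r 1 x)
  have h4 : (WithLp.toLp 2 fun i => ⟪A (e3 i), cross (pd D r 0 x) (pd D r 1 x)⟫ : E3) = 0 := by
    ext i; exact h0 _
  rw [h4, add_zero] at h3
  rw [hn.isSmoothOn.pd_comp hS hn h hx, hn.isSmoothOn.pd_comp hS hn h hx]
  exact h3

theorem continuousOn_sphericalTrace (hS : IsSurface S) (hn : IsCoorientation S n) :
    ContinuousOn (sphericalTrace S n) S := by
  have h : ∀ i j : Fin 3, ContinuousOn (fun P => surfDeriv S n n P (e3 i) j) S := fun i j =>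
    (EuclideanSpace.proj (𝕜 := ℝ) j).continuous.comp_continuousOn
      (hn.isSmoothOn.continuousOn_surfDeriv hS hn (e3 i))
  exact ((h 0 0).add (h 1 1)).add (h 2 2)

theorem continuousOn_sphericalJacobian (hS : IsSurface S) (hn : IsCoorientation S n) :
    ContinuousOn (sphericalJacobian S n) S := by
  have h : ∀ w : E3, ContinuousOn (fun P => surfDeriv S n n P w + ⟪n P, w⟫ • n P) S := fun w =>
    (hn.isSmoothOn.continuousOn_surfDeriv hS hn w).add
      ((hn.cont.inner continuousOn_const).fun_smul hn.cont)
  refine ((((crossL.continuous.comp_continuousOn (h (e3 0))).clm_apply (h (e3 1)))).inner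
    (h (e3 2))).congr fun P _ => ?_
  have h1 := triple_product_map (sphericalDifferential S n P) (e3 0) (e3 1) (e3 2)
  have h2 : ⟪cross (e3 0) (e3 1), e3 2⟫ = 1 := by simp [inner_e3]
  rw [h2, mul_one] at h1
  simp only [sphericalDifferential_apply] at h1
  exact h1.symm

end Jacobian

/-! ### Area on a surface -/

theorem measurableSet_inter_preimage {X Y : Type*} [TopologicalSpace X] [MeasurableSpace X]
    [BorelSpace X] [TopologicalSpace Y] [MeasurableSpace Y] [BorelSpace Y] {f : X → Y} {D : Set X}
    {t : Set Y} (hD : MeasurableSet D) (hf : ContinuousOn f D) (ht : MeasurableSet t) :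
    MeasurableSet (D ∩ f ⁻¹' t) := by
  have h1 := (continuousOn_iff_continuous_domRestrict.1 hf).measurable ht
  have h2 := hD.subtype_image h1
  convert h2 using 1
  ext x; simp [and_comm]

theorem finrank_e2 : Module.finrank ℝ E2 = 2 := by simp

section SurfaceArea

open scoped ENNReal

variable {S : Set E3} {n : E3 → E3} {D : Set E2} {r : E2 → E3}

theorem IsPatch.lintegral_image (h : IsPatch S D r) {B : Set E2} (hB : MeasurableSet B)
    (hBD : B ⊆ D) (g : E3 → ℝ≥0∞) :
    ∫⁻ P in r '' B, g P ∂μHE[2] = ∫⁻ x in B, ENNReal.ofReal ‖nrm D r x‖ * g (r x) := by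
  have := h.immersed.c1.lintegral_image hB hBD (h.param.inj.mono hBD)
    (fun x hx => h.param.regular x (hBD hx)) g
  simpa only [finrank_e2, volFactor_fderivWithin] using this

theorem IsPatch.integral_image (h : IsPatch S D r) {B : Set E2} (hB : MeasurableSet B)
    (hBD : B ⊆ D) (g : E3 → ℝ) :
    ∫ P in r '' B, g P ∂μHE[2] = ∫ x in B, ‖nrm D r x‖ * g (r x) := by
  have := h.immersed.c1.integral_image hB hBD (h.param.inj.mono hBD)
    (fun x hx => h.param.regular x (hBD hx)) g
  simpa only [finrank_e2, volFactor_fderivWithin] using this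

theorem IsSurface.measurableSet (hS : IsSurface S) : MeasurableSet S := hS.1.isClosed.measurableSet

theorem IsPatch.measure_image_lt_top (h : IsPatch S D r) : μHE[2] (r '' D) < ⊤ := by
  rw [← setLIntegral_one, h.lintegral_image h.domain.measurableSet le_rfl]
  obtain ⟨C, hC⟩ := h.domain.isCompact.exists_bound_of_continuousOn
    h.immersed.contDiffOn_nrm.continuousOn
  calc _ ≤ ∫⁻ _ in D, ENNReal.ofReal C := by
        refine setLIntegral_mono_ae' h.domain.measurableSet (Filter.Eventually.of_forall ?_)
        intro x hx
        rw [mul_one]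
        exact ENNReal.ofReal_le_ofReal (hC x hx)
    _ = ENNReal.ofReal C * volume D := by rw [setLIntegral_const]
    _ < ⊤ := ENNReal.mul_lt_top ENNReal.ofReal_lt_top h.domain.isCompact.measure_lt_top

theorem IsSurface.area_lt_top (hS : IsSurface S) : μHE[2] S < ⊤ := by
  refine hS.1.measure_lt_top_of_nhdsWithin fun P hP => ?_
  obtain ⟨D, r, x, h, hx, rfl, hnhds⟩ := hS.exists_patch_point hP
  exact ⟨r '' D, hnhds ▸ self_mem_nhdsWithin, h.measure_image_lt_top⟩

theorem IsSurface.integrableOn (hS : IsSurface S) {g : E3 → ℝ} (hg : ContinuousOn g S) :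
    IntegrableOn g S μHE[2] := by
  obtain ⟨C, hC⟩ := hS.1.exists_bound_of_continuousOn hg
  refine ⟨hg.aestronglyMeasurable hS.measurableSet,
    .restrict_of_bounded (C := C) hS.area_lt_top ?_⟩
  exact (ae_restrict_iff' hS.measurableSet).2 (Filter.Eventually.of_forall hC)

/-- The area formula for a map `f` of a surface into space which multiplies area elements by
`w`. -/
theorem IsSurface.area_image (hS : IsSurface S) {f : E3 → E3} (hf : IsSmoothOn S f) {w : E3 → ℝ}
    {A : Set E3} (hA : MeasurableSet A) (hAS : A ⊆ S) (hinj : InjOn f A)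
    (hpos : ∀ P ∈ A, 0 < w P)
    (hw : ∀ D r, IsPatch S D r → ∀ x ∈ D, r x ∈ A →
      ‖nrm D (f ∘ r) x‖ = w (r x) * ‖nrm D r x‖) :
    μHE[2] (f '' A) = ∫⁻ P in A, ENNReal.ofReal (w P) ∂μHE[2] := by
  -- Inside a patch both sides are integrals over the parameter domain. The two inequalities
  -- between the set functions then follow by cutting `A` into small pieces.
  have hloc : ∀ P ∈ A, ∃ U : Set E3, IsOpen U ∧ P ∈ U ∧ ∀ t ⊆ A ∩ U, MeasurableSet t →
      μHE[2] (f '' t) = ∫⁻ P in t, ENNReal.ofReal (w P) ∂μHE[2] := by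
    intro P hP
    obtain ⟨D, r, h, O, hO, hSO⟩ := hS.exists_patch (hAS hP)
    refine ⟨interior O, isOpen_interior, mem_interior_iff_mem_nhds.2 hO, fun t ht htm => ?_⟩
    have htr : t ⊆ r '' D := fun y hy => by
      rw [← hSO]; exact ⟨hAS (ht hy).1, interior_subset (ht hy).2⟩
    set B := D ∩ r ⁻¹' t with hBdef
    have hB : MeasurableSet B :=
      measurableSet_inter_preimage h.domain.measurableSet h.param.smooth.continuousOn htm
    have hBD : B ⊆ D := inter_subset_left
    have hrB : r '' B = t := by
      rw [hBdef, image_inter_preimage, inter_eq_right]; exact htr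
    have hreg : ∀ x ∈ B, ‖nrm D (f ∘ r) x‖ = w (r x) * ‖nrm D r x‖ := fun x hx =>
      hw D r h x hx.1 (ht hx.2).1
    have h1 := (hasC1DerivOn_of_contDiffOn h.domain (hf D r h)).measure_image_eq hB hBD
      (by
        intro x hx y hy hxy
        exact h.param.inj hx.1 hy.1 (hinj (ht hx.2).1 (ht hy.2).1 hxy))
      (fun x hx => injective_of_cross_ne_zero (by
        have h2 := hreg x hx
        have h3 : 0 < w (r x) * ‖nrm D r x‖ := mul_pos (hpos _ (ht hx.2).1)
          (norm_pos_iff.2 (h.immersed.nrm_ne_zero hx.1))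
        rw [← h2] at h3
        exact norm_pos_iff.1 h3))
    rw [finrank_e2, image_comp, hrB] at h1
    rw [h1]
    conv_rhs => rw [← hrB]
    rw [h.lintegral_image hB hBD]
    refine setLIntegral_congr_fun hB fun x hx => ?_
    rw [volFactor_fderivWithin, hreg x hx, ENNReal.ofReal_mul (hpos _ (ht hx.2).1).le, mul_comm]
  have hmeas : ∀ t ⊆ A, MeasurableSet t → MeasurableSet (f '' t) := fun t ht htm =>
    htm.image_of_continuousOn_injOn ((hf.continuousOn hS).mono (ht.trans hAS)) (hinj.mono ht)
  refine le_antisymm ?_ ?_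
  · refine le_of_locally_le hA (fun t => μHE[2] (f '' t))
      (fun t => ∫⁻ P in t, ENNReal.ofReal (w P) ∂μHE[2]) (by simp)
      (fun t => by rw [image_iUnion]; exact measure_iUnion_le _)
      (fun t htm hts htd => by rw [lintegral_iUnion htm htd]) (fun P hP => ?_)
    obtain ⟨U, hU, hPU, H⟩ := hloc P hP
    exact ⟨U, hU, hPU, fun t ht htm => (H t ht htm).le⟩
  · refine le_of_locally_le hA (fun t => ∫⁻ P in t, ENNReal.ofReal (w P) ∂μHE[2])
      (fun t => μHE[2] (f '' t)) (by simp) (fun t => lintegral_iUnion_le _ _)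
      (fun t htm hts htd => ?_) (fun P hP => ?_)
    · rw [image_iUnion, measure_iUnion]
      · exact fun i j hij => (htd hij).image hinj (hts i) (hts j)
      · exact fun i => hmeas _ (hts i) (htm i)
    obtain ⟨U, hU, hPU, H⟩ := hloc P hP
    exact ⟨U, hU, hPU, fun t ht htm => (H t ht htm).ge⟩

/-! ### The area of parallel surfaces -/

/-- A smooth function on a surface is Lipschitz, by compactness and the Lipschitz inverses of the
patches. -/
theorem IsSmoothOn.exists_lipschitz (hS : IsSurface S) {f : E3 → E3} (hf : IsSmoothOn S f) :
    ∃ K : ℝ≥0, LipschitzOnWith K f S := by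
  refine LocallyLipschitzOn.exists_lipschitzOnWith_of_compact hS.1 fun P hP => ?_
  obtain ⟨D, r, x, h, hx, rfl, hnhds⟩ := hS.exists_patch_point hP
  obtain ⟨K, hK, H⟩ := h.exists_antilipschitz
  have hc1 := hasC1DerivOn_of_contDiffOn h.domain (hf D r h)
  obtain ⟨C, hC⟩ := h.domain.isCompact.exists_bound_of_continuousOn hc1.cont
  have hC0 : 0 ≤ C := (norm_nonneg _).trans (hC x hx)
  refine ⟨(C * K).toNNReal, r '' D, hnhds ▸ self_mem_nhdsWithin, LipschitzOnWith.of_dist_le_mul ?_⟩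
  rintro _ ⟨a, ha, rfl⟩ _ ⟨b, hb, rfl⟩
  rw [Real.coe_toNNReal _ (by positivity), dist_eq_norm, dist_eq_norm]
  have h1 := h.domain.convex.norm_image_sub_le_of_norm_hasFDerivWithin_le hc1.deriv hC hb ha
  calc _ ≤ C * ‖a - b‖ := h1
    _ ≤ C * (K * ‖r a - r b‖) := by gcongr; exact H a ha b hb
    _ = _ := by ring

theorem HasTotalGaussCurvature.unique {K K' : ℝ} (h : HasTotalGaussCurvature S n K)
    (h' : HasTotalGaussCurvature S n K') : K = K' := by
  obtain ⟨H, ε, hε, h⟩ := h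
  obtain ⟨H', ε', hε', h'⟩ := h'
  set d := min ε ε' / 2 with hd
  have hd0 : 0 < d := by have := lt_min hε hε'; positivity
  have hdm : d < min ε ε' := half_lt_self (lt_min hε hε')
  have a1 : |d| < ε := by rw [abs_of_pos hd0]; exact hdm.trans_le (min_le_left _ _)
  have a2 : |d| < ε' := by rw [abs_of_pos hd0]; exact hdm.trans_le (min_le_right _ _)
  -- The even part of the area polynomial at `± d` determines the quadratic coefficient.
  have e1 := h d a1
  have e2 := h' d a2
  have e3 := h (-d) (by rwa [abs_neg])
  have e4 := h' (-d) (by rwa [abs_neg])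
  have : (K - K') * d ^ 2 = 0 := by nlinarith
  rcases mul_eq_zero.1 this with h0 | h0
  · linarith
  · exact absurd h0 (by positivity)

/-- The total Gaussian curvature is the integral of the Jacobian of the spherical map: the area
element is multiplied by `1 + ε tr + ε² det` under the shift by `ε n`. -/
theorem hasTotalGaussCurvature_integral (hS : IsSurface S) (hn : IsCoorientation S n) :
    HasTotalGaussCurvature S n (∫ P in S, sphericalJacobian S n P ∂μHE[2]) := by
  have ht := continuousOn_sphericalTrace hS hn
  have hJ := continuousOn_sphericalJacobian hS hn
  obtain ⟨C₁, hC₁⟩ := hS.1.exists_bound_of_continuousOn ht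
  obtain ⟨C₂, hC₂⟩ := hS.1.exists_bound_of_continuousOn hJ
  obtain ⟨L, hL⟩ := hn.isSmoothOn.exists_lipschitz hS
  -- For `|ε| M < 1` the shift is injective, by the Lipschitz constant `L` of the normal, and the
  -- factor of the area element is positive.
  set M : ℝ := 1 + |C₁| + |C₂| + L with hM
  have hM1 : 1 ≤ M := by
    have := abs_nonneg C₁; have := abs_nonneg C₂; have := L.coe_nonneg; linarith
  refine ⟨∫ P in S, sphericalTrace S n P ∂μHE[2], M⁻¹, by positivity, fun ε hε => ?_⟩
  have hεM : |ε| * M < 1 := by rwa [← one_div, lt_div_iff₀ (by positivity)] at hε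
  have hinj : InjOn (fun P => P + ε • n P) S := by
    intro P hP Q hQ hPQ
    have h1 : P - Q = ε • (n Q - n P) := by
      rw [smul_sub, sub_eq_sub_iff_add_eq_add]
      simp only at hPQ
      rw [hPQ, add_comm]
    have h2 : ‖P - Q‖ ≤ |ε| * (L * ‖P - Q‖) := by
      calc ‖P - Q‖ = |ε| * ‖n Q - n P‖ := by rw [h1, norm_smul, Real.norm_eq_abs]
        _ ≤ _ := by
          gcongr
          have := hL.dist_le_mul Q hQ P hP
          rwa [dist_eq_norm, dist_eq_norm, norm_sub_rev Q P] at this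
    have h3 : |ε| * L ≤ |ε| * M := by
      gcongr
      have := abs_nonneg C₁; have := abs_nonneg C₂; linarith
    by_contra hne
    have h4 : 0 < ‖P - Q‖ := norm_pos_iff.2 (sub_ne_zero.2 hne)
    nlinarith
  have hsm : IsSmoothOn S (fun P => P + ε • n P) := fun D r h =>
    h.param.smooth.add (contDiffOn_const.fun_smul (hn.isSmoothOn D r h))
  set w : E3 → ℝ := fun P => 1 + ε * sphericalTrace S n P + ε ^ 2 * sphericalJacobian S n P
    with hwdef
  have hw0 : ∀ P ∈ S, 0 < w P := by
    intro P hP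
    have h1 := (hC₁ P hP).trans (le_abs_self C₁)
    have h2 := (hC₂ P hP).trans (le_abs_self C₂)
    rw [Real.norm_eq_abs] at h1 h2
    have hε1 : |ε| ≤ 1 := by nlinarith [abs_nonneg ε]
    have h3 : |ε * sphericalTrace S n P| ≤ |ε| * |C₁| := by rw [abs_mul]; gcongr
    have h4 : |ε ^ 2 * sphericalJacobian S n P| ≤ |ε| * |C₂| := by
      rw [abs_mul, abs_pow]
      have : |ε| ^ 2 ≤ |ε| := by nlinarith [abs_nonneg ε]
      gcongr
    have h5 : |ε| * |C₁| + |ε| * |C₂| < 1 := by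
      have := mul_nonneg (abs_nonneg ε) L.coe_nonneg
      nlinarith [abs_nonneg ε]
    simp only [hwdef]
    linarith [(abs_le.1 h3).1, (abs_le.1 h4).1]
  have harea := hS.area_image hsm hS.measurableSet le_rfl hinj hw0 (by
    intro D r h x hx _
    have hpd : ∀ i, pd D ((fun P => P + ε • n P) ∘ r) i x =
        pd D r i x + ε • pd D (n ∘ r) i x := fun i =>
      pd_eq_of_hasFDerivWithinAt h.domain hx ((hasFDerivWithinAt_of_contDiffOn h.param.smooth
        hx).add ((hasFDerivWithinAt_of_contDiffOn (hn.isSmoothOn D r h) hx).const_smul ε)) i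
    have h1 : nrm D ((fun P => P + ε • n P) ∘ r) x = w (r x) • nrm D r x := by
      have h2 := h.immersed.cross_pd_normal hS hn hx
      have h3 := h.immersed.cross_pd_normal_add hS hn hx
      simp only [hwdef, add_smul, one_smul, mul_smul]
      rw [← h2, ← h3]
      simp only [nrm, hpd, cross_add_left, cross_add_right, cross_smul_left, cross_smul_right,
        smul_add, smul_smul, pow_two]
      abel
    rw [h1, norm_smul, Real.norm_eq_abs, abs_of_pos (hw0 _ (h.sub ⟨x, hx, rfl⟩))])
  have hcont : ContinuousOn w S := (continuousOn_const.add (continuousOn_const.mul ht)).add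
    (continuousOn_const.mul hJ)
  have hint : area (shifted S n ε) = ∫ P in S, w P ∂μHE[2] := by
    rw [area, shifted, harea, integral_eq_lintegral_of_nonneg_ae
      ((ae_restrict_iff' hS.measurableSet).2 (Filter.Eventually.of_forall fun P hP =>
        (hw0 P hP).le)) (hcont.aestronglyMeasurable hS.measurableSet)]
  have i1 := hS.integrableOn (g := fun _ => (1 : ℝ)) continuousOn_const
  have i2 := (hS.integrableOn ht).const_mul ε
  have i3 := (hS.integrableOn hJ).const_mul (ε ^ 2)
  rw [hint]
  have h5 : ∫ P in S, w P ∂μHE[2] = (∫ _ in S, (1 : ℝ) ∂μHE[2]) +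
      ε * (∫ P in S, sphericalTrace S n P ∂μHE[2]) +
      ε ^ 2 * ∫ P in S, sphericalJacobian S n P ∂μHE[2] := by
    have i12 : Integrable (fun P => 1 + ε * sphericalTrace S n P) (μHE[2].restrict S) := i1.add i2
    rw [← integral_const_mul, ← integral_const_mul, ← integral_add i1 i2, ← integral_add i12 i3]
  rw [h5, setIntegral_const, smul_eq_mul, mul_one]
  simp only [area, Measure.real]
  ring

end SurfaceArea

/-! ### The degree of the spherical map -/

section Degree

open scoped ENNReal

variable {S : Set E3} {n : E3 → E3} {D : Set E2} {r : E2 → E3}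

/-- The inverse function theorem for the spherical map, up to the boundary of the surface. -/
theorem exists_injOn_nhds (hS : IsSurface S) (hn : IsCoorientation S n) {P : E3} (hP : P ∈ S)
    (hJ : sphericalJacobian S n P ≠ 0) : ∃ U : Set E3, IsOpen U ∧ P ∈ U ∧ InjOn n (S ∩ U) := by
  obtain ⟨D, r, x, h, hx, rfl, hnhds⟩ := hS.exists_patch_point hP
  have hc1 := hasC1DerivOn_of_contDiffOn h.domain (hn.isSmoothOn D r h)
  have hi : Function.Injective (fderivWithin ℝ (n ∘ r) D x) := by
    refine injective_of_cross_ne_zero ?_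
    have := h.immersed.cross_pd_normal hS hn hx
    rw [nrm] at this
    change cross (pd D (n ∘ r) 0 x) (pd D (n ∘ r) 1 x) ≠ 0
    rw [this]
    exact smul_ne_zero hJ (h.immersed.nrm_ne_zero hx)
  obtain ⟨V, hV, hxV, hinj, -⟩ := hc1.exists_local_bounds hx hi (c := 2) (by norm_num)
  -- Injectivity near the parameter `x` becomes injectivity near `r x`, since the inverse of the
  -- patch is continuous.
  have h1 : ∀ᶠ P in 𝓝[S] (r x), P ∈ r '' D ∧ Function.invFunOn r D P ∈ D ∩ V := by
    rw [hnhds]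
    refine Filter.Eventually.and self_mem_nhdsWithin ?_
    exact h.tendsto_invFunOn hx (inter_mem_nhdsWithin _ (hV.mem_nhds hxV))
  obtain ⟨U, hU, hPU, hUs⟩ := mem_nhdsWithin.1 h1
  refine ⟨U, hU, hPU, ?_⟩
  rintro P ⟨hPS, hPU⟩ Q ⟨hQS, hQU⟩ hPQ
  obtain ⟨⟨a, ha, rfl⟩, ha'⟩ := hUs ⟨hPU, hPS⟩
  obtain ⟨⟨b, hb, rfl⟩, hb'⟩ := hUs ⟨hQU, hQS⟩
  rw [h.param.inj.leftInvOn_invFunOn ha] at ha'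
  rw [h.param.inj.leftInvOn_invFunOn hb] at hb'
  rw [hinj ha' hb' hPQ]

/-- The regular part of a surface is a countable disjoint union of measurable sets on which the
spherical map is injective. -/
theorem exists_injOn_partition (hS : IsSurface S) (hn : IsCoorientation S n) {R : Set E3}
    (hR : MeasurableSet R) (hRS : R ⊆ S) (hJ : ∀ P ∈ R, sphericalJacobian S n P ≠ 0) :
    ∃ A : ℕ → Set E3, (∀ i, MeasurableSet (A i)) ∧ Pairwise (Function.onFun Disjoint A) ∧
      ⋃ i, A i = R ∧ ∀ i, InjOn n (A i) := by
  rcases R.eq_empty_or_nonempty with rfl | hne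
  · exact ⟨fun _ => ∅, fun _ => MeasurableSet.empty, fun i j _ => by simp [Function.onFun],
      by simp, by simp⟩
  choose! U hUo hPU hU using fun P (hP : P ∈ R) => exists_injOn_nhds hS hn (hRS hP) (hJ P hP)
  obtain ⟨T, hTs, hTc, hT⟩ := TopologicalSpace.countable_cover_nhdsWithin
    (fun x hx => mem_nhdsWithin_of_mem_nhds ((hUo x hx).mem_nhds (hPU x hx)))
  have hTne : T.Nonempty := by
    obtain ⟨x, hx⟩ := hne
    obtain ⟨y, hy, -⟩ := mem_iUnion₂.1 (hT hx)
    exact ⟨y, hy⟩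
  obtain ⟨e, rfl⟩ := hTc.exists_eq_range hTne
  have hes : ∀ i, e i ∈ R := fun i => hTs ⟨i, rfl⟩
  refine ⟨fun i => R ∩ disjointed (fun i => U (e i)) i, fun i => hR.inter
    (MeasurableSet.disjointed (fun i => (hUo _ (hes i)).measurableSet) i), ?_, ?_, fun i => ?_⟩
  · intro i j hij
    exact (disjoint_disjointed (fun i => U (e i)) hij).mono inter_subset_right inter_subset_right
  · rw [← inter_iUnion, iUnion_disjointed, inter_eq_left]
    intro x hx
    simpa using hT hx
  · exact (hU _ (hes i)).mono (inter_subset_inter hRS (disjointed_subset _ i))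

/-- The number of points of `R` with normal `q`. -/
def fiberCount (n : E3 → E3) (R : Set E3) (q : E3) : ℝ≥0∞ := Measure.count (R ∩ n ⁻¹' {q})

/-- Each of the pieces on which the spherical map is injective contains at most one preimage. -/
theorem fiberCount_eq_tsum (hn : ContinuousOn n S) {R : Set E3} (hRS : R ⊆ S) {A : ℕ → Set E3}
    (hA : ∀ i, MeasurableSet (A i)) (hAd : Pairwise (Function.onFun Disjoint A))
    (hAR : ⋃ i, A i = R) (hinj : ∀ i, InjOn n (A i)) (q : E3) :
    fiberCount n R q = ∑' i, (n '' A i).indicator (fun _ => (1 : ℝ≥0∞)) q := by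
  have hAS : ∀ i, A i ⊆ S := fun i => (subset_iUnion A i).trans (hAR.le.trans hRS)
  rw [fiberCount, ← hAR, iUnion_inter, measure_iUnion]
  · congr 1
    ext i
    by_cases hq : q ∈ n '' A i
    · obtain ⟨P, hP, rfl⟩ := hq
      have : A i ∩ n ⁻¹' {n P} = {P} := by
        ext Q
        simp only [mem_inter_iff, mem_preimage, mem_singleton_iff]
        exact ⟨fun h => hinj i h.1 hP h.2, fun h => by subst h; exact ⟨hP, rfl⟩⟩
      rw [this, Measure.count_singleton, indicator_of_mem (mem_image_of_mem n hP)]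
    · have : A i ∩ n ⁻¹' {q} = ∅ := by
        ext Q
        simp only [mem_inter_iff, mem_preimage, mem_singleton_iff, mem_empty_iff_false, iff_false]
        rintro ⟨h1, h2⟩
        exact hq ⟨Q, h1, h2⟩
      rw [this, measure_empty, indicator_of_notMem hq]
  · exact fun i j hij => (hAd hij).mono inter_subset_left inter_subset_left
  · exact fun i => measurableSet_inter_preimage (hA i) (hn.mono (hAS i)) (measurableSet_singleton q)

section Count

variable (hS : IsSurface S) (hn : IsCoorientation S n) {R : Set E3} (hR : MeasurableSet R)
  (hRS : R ⊆ S) (hJ : ∀ P ∈ R, sphericalJacobian S n P ≠ 0)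
include hS hn hR hRS hJ

theorem measurable_fiberCount : Measurable (fiberCount n R) := by
  obtain ⟨A, hA, hAd, hAR, hinj⟩ := exists_injOn_partition hS hn hR hRS hJ
  have hAS : ∀ i, A i ⊆ S := fun i => (subset_iUnion A i).trans (hAR.le.trans hRS)
  rw [funext (fiberCount_eq_tsum hn.cont hRS hA hAd hAR hinj)]
  refine Measurable.tsum fun i => measurable_const.indicator ?_
  exact (hA i).image_of_continuousOn_injOn (hn.cont.mono (hAS i)) (hinj i)

/-- The area formula with multiplicities for the spherical map. -/
theorem setLIntegral_fiberCount {B : Set E3} (hB : MeasurableSet B) :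
    ∫⁻ q in B, fiberCount n R q ∂μHE[2] =
      ∫⁻ P in R ∩ n ⁻¹' B, ENNReal.ofReal |sphericalJacobian S n P| ∂μHE[2] := by
  obtain ⟨A, hA, hAd, hAR, hinj⟩ := exists_injOn_partition hS hn hR hRS hJ
  have hAi : ∀ i, A i ⊆ R := fun i => (subset_iUnion A i).trans hAR.le
  have hAS : ∀ i, A i ⊆ S := fun i => (hAi i).trans hRS
  have hAm : ∀ i, MeasurableSet (n '' A i) := fun i =>
    (hA i).image_of_continuousOn_injOn (hn.cont.mono (hAS i)) (hinj i)
  have hABm : ∀ i, MeasurableSet (A i ∩ n ⁻¹' B) := fun i =>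
    measurableSet_inter_preimage (hA i) (hn.cont.mono (hAS i)) hB
  rw [funext (fiberCount_eq_tsum hn.cont hRS hA hAd hAR hinj),
    lintegral_tsum fun i => (measurable_const.indicator (hAm i)).aemeasurable]
  have hRB : R ∩ n ⁻¹' B = ⋃ i, A i ∩ n ⁻¹' B := by rw [← hAR, iUnion_inter]
  rw [hRB, lintegral_iUnion hABm]
  swap
  · exact fun i j hij => (hAd hij).mono inter_subset_left inter_subset_left
  congr 1
  ext i
  rw [lintegral_indicator (hAm i), setLIntegral_one, Measure.restrict_apply (hAm i),
    ← image_inter_preimage]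
  refine hS.area_image hn.isSmoothOn (hABm i) (inter_subset_left.trans (hAS i))
    ((hinj i).mono inter_subset_left) (fun P hP => abs_pos.2 (hJ P (hAi i hP.1))) ?_
  intro D r h x hx _
  rw [h.immersed.cross_pd_normal hS hn hx, norm_smul, Real.norm_eq_abs]

theorem lintegral_fiberCount_lt_top : ∫⁻ q, fiberCount n R q ∂μHE[2] < ⊤ := by
  have h1 := setLIntegral_fiberCount hS hn hR hRS hJ MeasurableSet.univ
  rw [setLIntegral_univ, preimage_univ, inter_univ] at h1
  rw [h1]
  have := (hS.integrableOn (continuousOn_sphericalJacobian hS hn).abs).mono_set hRS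
  have h2 := this.hasFiniteIntegral
  rw [hasFiniteIntegral_iff_ofReal (Filter.Eventually.of_forall fun _ => abs_nonneg _)] at h2
  exact h2

/-- The spherical map carries the measure with density `|J|` on `R` to the measure on the sphere
with density the number of preimages in `R`. -/
theorem integral_fiberCount {g : E3 → ℝ} (hg : Continuous g) :
    Integrable (fun q => (fiberCount n R q).toReal) (μHE[2] : Measure E3) ∧
    ∫ q in Metric.sphere (0 : E3) 1, (fiberCount n R q).toReal * g q ∂μHE[2] =
      ∫ P in R, |sphericalJacobian S n P| * g (n P) ∂μHE[2] := by
  have hm := measurable_fiberCount hS hn hR hRS hJ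
  have hfin := lintegral_fiberCount_lt_top hS hn hR hRS hJ
  have hnR : ContinuousOn n R := hn.cont.mono hRS
  have hJm : AEMeasurable (fun P => sphericalJacobian S n P) (μHE[2].restrict R) :=
    ((continuousOn_sphericalJacobian hS hn).mono hRS).aemeasurable hR
  have hnm : AEMeasurable n (μHE[2].restrict R) := hnR.aemeasurable hR
  refine ⟨integrable_toReal_of_lintegral_ne_top hm.aemeasurable hfin.ne, ?_⟩
  have hnm' : AEMeasurable n ((μHE[2].restrict R).withDensity
      fun P => ENNReal.ofReal |sphericalJacobian S n P|) :=
    hnm.mono_ac (withDensity_absolutelyContinuous _ _)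
  have hmap : Measure.map n ((μHE[2].restrict R).withDensity
      fun P => ENNReal.ofReal |sphericalJacobian S n P|) =
      (μHE[2].restrict (Metric.sphere (0 : E3) 1)).withDensity (fiberCount n R) := by
    refine Measure.ext fun B hB => ?_
    have hBm : NullMeasurableSet (n ⁻¹' B) (μHE[2].restrict R) := hnm.nullMeasurableSet_preimage hB
    rw [Measure.map_apply_of_aemeasurable hnm' hB, withDensity_apply₀ _ hBm, withDensity_apply _ hB,
      Measure.restrict_restrict hB, Measure.restrict_restrict₀ hBm,
      setLIntegral_fiberCount hS hn hR hRS hJ (hB.inter Metric.isClosed_sphere.measurableSet)]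
    congr 2
    ext P
    simp only [mem_inter_iff, mem_preimage, mem_sphere_iff_norm, sub_zero]
    exact ⟨fun h => ⟨h.2, h.1, hn.unit P (hRS h.2)⟩, fun h => ⟨h.2.1, h.1⟩⟩
  have hae : ∀ᵐ q ∂(μHE[2] : Measure E3).restrict (Metric.sphere (0 : E3) 1),
      fiberCount n R q < ⊤ := ae_restrict_of_ae (ae_lt_top hm hfin.ne)
  have h1 : ∫ q, g q ∂((μHE[2].restrict (Metric.sphere (0 : E3) 1)).withDensity
      (fiberCount n R)) =
      ∫ q in Metric.sphere (0 : E3) 1, (fiberCount n R q).toReal * g q ∂μHE[2] := by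
    rw [integral_withDensity_eq_integral_toReal_smul hm hae]
    rfl
  rw [← h1, ← hmap, integral_map hnm' hg.aestronglyMeasurable,
    integral_withDensity_eq_integral_toReal_smul₀ hJm.abs.ennreal_ofReal (by simp)]
  simp only [ENNReal.toReal_ofReal (abs_nonneg _), smul_eq_mul]

end Count

/-- The set where the spherical map preserves orientation (`s = 1`) or reverses it (`s = -1`). -/
def signedPart (S : Set E3) (n : E3 → E3) (s : ℝ) : Set E3 :=
  {P ∈ S | 0 < s * sphericalJacobian S n P}

theorem mem_signedPart {s : ℝ} {P : E3} :
    P ∈ signedPart S n s ↔ P ∈ S ∧ 0 < s * sphericalJacobian S n P := Iff.rfl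

theorem measurableSet_signedPart (hS : IsSurface S) (hn : IsCoorientation S n) (s : ℝ) :
    MeasurableSet (signedPart S n s) :=
  measurableSet_inter_preimage hS.measurableSet
    (continuousOn_const.mul (continuousOn_sphericalJacobian hS hn)) measurableSet_Ioi

/-- The number of preimages of `q` under the spherical map, counted with sign. Where infinitely many
preimages count, a null set of `q`, the finite sum has the value `0`. -/
def sphericalDegree (S : Set E3) (n : E3 → E3) (q : E3) : ℝ :=
  ∑ᶠ P ∈ {P ∈ S | n P = q}, (SignType.sign (sphericalJacobian S n P) : ℝ)

theorem exists_int_sphericalDegree (S : Set E3) (n : E3 → E3) (q : E3) :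
    ∃ k : ℤ, sphericalDegree S n q = k := by
  refine finsum_induction (fun x : ℝ => ∃ k : ℤ, x = k) ⟨0, by simp⟩ ?_ fun P => ?_
  · rintro _ _ ⟨a, rfl⟩ ⟨b, rfl⟩
    exact ⟨a + b, by push_cast; ring⟩
  · refine finsum_induction (fun x : ℝ => ∃ k : ℤ, x = k) ⟨0, by simp⟩ ?_ fun _ => ?_
    · rintro _ _ ⟨a, rfl⟩ ⟨b, rfl⟩
      exact ⟨a + b, by push_cast; ring⟩
    · exact ⟨(SignType.sign (sphericalJacobian S n P) : ℤ), by
        rcases SignType.sign (sphericalJacobian S n P) <;> simp⟩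

theorem sphericalDegree_eq {q : E3} (h1 : fiberCount n (signedPart S n 1) q ≠ ⊤)
    (h2 : fiberCount n (signedPart S n (-1)) q ≠ ⊤) :
    sphericalDegree S n q = (fiberCount n (signedPart S n 1) q).toReal -
      (fiberCount n (signedPart S n (-1)) q).toReal := by
  classical
  have f1 := Measure.count_apply_lt_top.1 (lt_top_iff_ne_top.2 h1)
  have f2 := Measure.count_apply_lt_top.1 (lt_top_iff_ne_top.2 h2)
  rw [fiberCount, fiberCount, Measure.count_apply_finite _ f1, Measure.count_apply_finite _ f2]
  have hd : Disjoint f1.toFinset f2.toFinset := by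
    rw [Finset.disjoint_left]
    intro P hP hP'
    have a1 := ((f1.mem_toFinset).1 hP).1.2
    have a2 := ((f2.mem_toFinset).1 hP').1.2
    linarith
  have h3 : sphericalDegree S n q = ∑ P ∈ f1.toFinset ∪ f2.toFinset,
      (SignType.sign (sphericalJacobian S n P) : ℝ) := by
    refine finsum_mem_eq_sum_of_inter_support_eq _ ?_
    ext P
    simp only [mem_inter_iff, Function.mem_support, Finset.coe_union,
      Set.Finite.coe_toFinset, mem_union, mem_signedPart, mem_preimage, mem_singleton_iff]
    rw [show P ∈ {P | P ∈ S ∧ n P = q} ↔ P ∈ S ∧ n P = q from Iff.rfl]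
    constructor
    · rintro ⟨⟨hP, hq⟩, hs⟩
      have hne : sphericalJacobian S n P ≠ 0 := by rintro h0; simp [h0] at hs
      rcases lt_or_gt_of_ne hne with h | h
      · exact ⟨Or.inr ⟨⟨hP, by linarith⟩, hq⟩, hs⟩
      · exact ⟨Or.inl ⟨⟨hP, by linarith⟩, hq⟩, hs⟩
    · rintro ⟨⟨⟨hP, h⟩, hq⟩ | ⟨⟨hP, h⟩, hq⟩, hs⟩ <;> exact ⟨⟨hP, hq⟩, hs⟩
  rw [h3, Finset.sum_union hd]
  have h4 : ∑ P ∈ f1.toFinset, (SignType.sign (sphericalJacobian S n P) : ℝ) =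
      ∑ P ∈ f1.toFinset, 1 := Finset.sum_congr rfl fun P hP => by
    have a1 := ((f1.mem_toFinset).1 hP).1.2
    rw [one_mul] at a1
    simp [sign_pos a1]
  have h5 : ∑ P ∈ f2.toFinset, (SignType.sign (sphericalJacobian S n P) : ℝ) =
      ∑ P ∈ f2.toFinset, (-1) := Finset.sum_congr rfl fun P hP => by
    have a1 := ((f2.mem_toFinset).1 hP).1.2
    simp [sign_neg (show sphericalJacobian S n P < 0 by linarith)]
  rw [h4, h5]
  simp
  ring

/-- **Degree formula**: integration of a function over the sphere against the degree of the
spherical map is integration over the surface against the Jacobian of the spherical map. -/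
theorem integral_sphericalDegree (hS : IsSurface S) (hn : IsCoorientation S n) {g : E3 → ℝ}
    (hg : Continuous g) :
    IntegrableOn (sphericalDegree S n) (Metric.sphere (0 : E3) 1) μHE[2] ∧
    ∫ q in Metric.sphere (0 : E3) 1, sphericalDegree S n q * g q ∂μHE[2] =
      ∫ P in S, sphericalJacobian S n P * g (n P) ∂μHE[2] := by
  have hRm := fun s => measurableSet_signedPart hS hn s
  have hRS : ∀ s, signedPart S n s ⊆ S := fun s P hP => hP.1
  have hJ : ∀ s, ∀ P ∈ signedPart S n s, sphericalJacobian S n P ≠ 0 := fun s P hP h0 => by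
    have := hP.2; rw [h0, mul_zero] at this; exact lt_irrefl _ this
  have key := fun s => integral_fiberCount hS hn (hRm s) (hRS s) (hJ s) hg
  have hae : ∀ᵐ q ∂(μHE[2] : Measure E3).restrict (Metric.sphere (0 : E3) 1),
      sphericalDegree S n q = (fiberCount n (signedPart S n 1) q).toReal -
      (fiberCount n (signedPart S n (-1)) q).toReal := by
    have hfin := fun s => ae_restrict_of_ae (s := Metric.sphere (0 : E3) 1)
      (ae_lt_top (measurable_fiberCount hS hn (hRm s) (hRS s) (hJ s))
      (lintegral_fiberCount_lt_top hS hn (hRm s) (hRS s) (hJ s)).ne)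
    filter_upwards [hfin 1, hfin (-1)] with q h1 h2
    exact sphericalDegree_eq h1.ne h2.ne
  have hi := fun s => (key s).1.integrableOn (s := Metric.sphere (0 : E3) 1)
  refine ⟨((hi 1).sub (hi (-1))).congr (hae.mono fun q hq => hq.symm), ?_⟩
  obtain ⟨C, hC⟩ := (isCompact_sphere (0 : E3) 1).exists_bound_of_continuousOn hg.continuousOn
  have hig : ∀ s, IntegrableOn (fun q => (fiberCount n (signedPart S n s) q).toReal * g q)
      (Metric.sphere (0 : E3) 1) μHE[2] := fun s =>
    (hi s).mul_bdd (c := C) hg.aestronglyMeasurable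
      ((ae_restrict_iff' Metric.isClosed_sphere.measurableSet).2 (Filter.Eventually.of_forall hC))
  have h1 : ∫ q in Metric.sphere (0 : E3) 1, sphericalDegree S n q * g q ∂μHE[2] =
      ∫ q in Metric.sphere (0 : E3) 1, ((fiberCount n (signedPart S n 1) q).toReal * g q -
      (fiberCount n (signedPart S n (-1)) q).toReal * g q) ∂μHE[2] :=
    integral_congr_ae (hae.mono fun q hq => by simp only [hq]; ring)
  rw [h1, integral_sub (hig 1) (hig (-1)), (key 1).2, (key (-1)).2]
  set F : E3 → ℝ := fun P => sphericalJacobian S n P * g (n P) with hF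
  have hFi : IntegrableOn F S μHE[2] := hS.integrableOn
    ((continuousOn_sphericalJacobian hS hn).mul (hg.comp_continuousOn hn.cont))
  have h2 : ∫ P in signedPart S n 1, |sphericalJacobian S n P| * g (n P) ∂μHE[2] =
      ∫ P in signedPart S n 1, F P ∂μHE[2] := setIntegral_congr_fun (hRm 1) fun P hP => by
    have := hP.2
    rw [one_mul] at this
    simp only [hF, abs_of_pos this]
  have h3 : ∫ P in signedPart S n (-1), |sphericalJacobian S n P| * g (n P) ∂μHE[2] =
      ∫ P in signedPart S n (-1), -F P ∂μHE[2] := setIntegral_congr_fun (hRm (-1)) fun P hP => by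
    have := hP.2
    simp only [hF, abs_of_neg (show sphericalJacobian S n P < 0 by linarith)]; ring
  have hd : Disjoint (signedPart S n 1) (signedPart S n (-1)) := by
    rw [Set.disjoint_left]
    intro P hP hP'
    have := hP.2; have := hP'.2; linarith
  rw [h2, h3, integral_neg, sub_neg_eq_add, ← setIntegral_union hd (hRm (-1))
    (hFi.mono_set (hRS 1)) (hFi.mono_set (hRS (-1)))]
  symm
  refine setIntegral_eq_of_subset_of_forall_sdiff_eq_zero hS.measurableSet
    (union_subset (hRS 1) (hRS (-1))) fun P hP => ?_
  have : sphericalJacobian S n P = 0 := by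
    by_contra hne
    rcases lt_or_gt_of_ne hne with h | h
    · exact hP.2 (Or.inr ⟨hP.1, by linarith⟩)
    · exact hP.2 (Or.inl ⟨hP.1, by linarith⟩)
  simp only [this, zero_mul]

theorem signedSphericalArea_eq_integral (hS : IsSurface S) (hn : IsCoorientation S n) :
    signedSphericalArea S n = ∫ P in S, sphericalJacobian S n P ∂μHE[2] := by
  have := (integral_sphericalDegree hS hn (g := fun _ => 1) continuous_const).2
  simp only [mul_one] at this
  exact this

theorem hasTotalGaussCurvature_iff (hS : IsSurface S) (hn : IsCoorientation S n) (K : ℝ) :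
    HasTotalGaussCurvature S n K ↔ K = ∫ P in S, sphericalJacobian S n P ∂μHE[2] :=
  ⟨fun h => h.unique (hasTotalGaussCurvature_integral hS hn),
    fun h => h ▸ hasTotalGaussCurvature_integral hS hn⟩

end Degree

/-! ### The Gauss equation -/

section SecondOrder

variable {D : Set E2}

theorem pd_inner (hD : IsParamDomain D) {u v : E2 → E3} (hu : ContDiffOn ℝ ∞ u D)
    (hv : ContDiffOn ℝ ∞ v D) {x : E2} (hx : x ∈ D) (i : Fin 2) :
    pd D (fun y => ⟪u y, v y⟫) i x = ⟪u x, pd D v i x⟫ + ⟪pd D u i x, v x⟫ := by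
  rw [pd_eq_of_hasFDerivWithinAt hD hx ((hasFDerivWithinAt_of_contDiffOn hu hx).inner ℝ
    (hasFDerivWithinAt_of_contDiffOn hv hx))]
  simp [pd]

theorem pd_comm {F : Type*} [NormedAddCommGroup F] [NormedSpace ℝ F] (hD : IsParamDomain D)
    {u : E2 → F} (hu : ContDiffOn ℝ ∞ u D) {x : E2} (hx : x ∈ D) (i j : Fin 2) :
    pd D (pd D u i) j x = pd D (pd D u j) i x := by
  have hdd : DifferentiableWithinAt ℝ (fderivWithin ℝ u D) D x :=
    ((hu.fderivWithin hD.uniqueDiffOn (m := ∞) (by simp)).differentiableOn (by simp)) x hx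
  have key : ∀ i j, pd D (pd D u i) j x =
      fderivWithin ℝ (fderivWithin ℝ u D) D x (e2 j) (e2 i) := fun i j => by
    change fderivWithin ℝ (fun y => fderivWithin ℝ u D y (e2 i)) D x (e2 j) = _
    rw [fderivWithin_clm_apply (hD.uniqueDiffOn x hx) hdd (differentiableWithinAt_const _)]
    simp
  have hsym : IsSymmSndFDerivWithinAt ℝ u D x :=
    (hu x hx).isSymmSndFDerivWithinAt
      (by simp only [minSmoothness_of_isRCLikeNormedField]; exact WithTop.coe_le_coe.2 le_top)
      hD.uniqueDiffOn
      (by rw [hD.closure_interior]; exact hx) hx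
  rw [key, key, hsym]

/-- The product of two triple products as a Gram determinant. -/
theorem inner_cross_mul_inner_cross (p q a c : E3) :
    ⟪cross p q, a⟫ * ⟪cross p q, c⟫ =
      ⟪p, p⟫ * (⟪q, q⟫ * ⟪a, c⟫ - ⟪c, q⟫ * ⟪a, q⟫) - ⟪p, q⟫ * (⟪p, q⟫ * ⟪a, c⟫ - ⟪c, q⟫ * ⟪a, p⟫)
        + ⟪c, p⟫ * (⟪p, q⟫ * ⟪a, q⟫ - ⟪q, q⟫ * ⟪a, p⟫) := by
  simp only [inner_e3, cross_apply_zero, cross_apply_one, cross_apply_two]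
  ring

/-- The coefficients `⟪r_ij, r_k⟫` (Christoffel symbols of the first kind) depend only on the
first fundamental form. -/
theorem inner_pd_pd_eq_of_metric_eq (hD : IsParamDomain D) {r R : E2 → E3}
    (hr : ContDiffOn ℝ ∞ r D) (hR : ContDiffOn ℝ ∞ R D)
    (hm : ∀ x ∈ D, ∀ i j, ⟪pd D R i x, pd D R j x⟫ = ⟪pd D r i x, pd D r j x⟫)
    {x : E2} (hx : x ∈ D) (i j k : Fin 2) :
    ⟪pd D (pd D R i) j x, pd D R k x⟫ = ⟪pd D (pd D r i) j x, pd D r k x⟫ := by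
  have hd : ∀ i j k, ⟪pd D R i x, pd D (pd D R j) k x⟫ + ⟪pd D (pd D R i) k x, pd D R j x⟫ =
      ⟪pd D r i x, pd D (pd D r j) k x⟫ + ⟪pd D (pd D r i) k x, pd D r j x⟫ := fun i j k => by
    rw [← pd_inner hD (contDiffOn_pd hD hR i) (contDiffOn_pd hD hR j) hx,
      ← pd_inner hD (contDiffOn_pd hD hr i) (contDiffOn_pd hD hr j) hx]
    exact pd_congr (fun y hy => hm y hy i j) hx k
  -- The cyclic combination that gives the Christoffel symbols.
  have h1 := hd i k j
  have h2 := hd j k i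
  have h3 := hd i j k
  rw [pd_comm hD hR hx j i, pd_comm hD hr hx j i] at h2
  rw [pd_comm hD hR hx i k, pd_comm hD hr hx i k] at h3
  rw [pd_comm hD hR hx j k, pd_comm hD hr hx j k] at h3
  simp only [real_inner_comm] at h1 h2 h3 ⊢
  linarith

/-- The combination of products of second derivatives that enters the curvature is determined by the
first fundamental form: it is a difference of derivatives of Christoffel symbols. -/
theorem inner_sub_inner_eq_of_metric_eq (hD : IsParamDomain D) {r R : E2 → E3}
    (hr : ContDiffOn ℝ ∞ r D) (hR : ContDiffOn ℝ ∞ R D)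
    (hm : ∀ x ∈ D, ∀ i j, ⟪pd D R i x, pd D R j x⟫ = ⟪pd D r i x, pd D r j x⟫)
    {x : E2} (hx : x ∈ D) :
    ⟪pd D (pd D R 0) 0 x, pd D (pd D R 1) 1 x⟫ - ⟪pd D (pd D R 0) 1 x, pd D (pd D R 0) 1 x⟫ =
      ⟪pd D (pd D r 0) 0 x, pd D (pd D r 1) 1 x⟫ -
        ⟪pd D (pd D r 0) 1 x, pd D (pd D r 0) 1 x⟫ := by
  -- The third derivatives of `u` cancel in the difference on the right.
  have key : ∀ {u : E2 → E3}, ContDiffOn ℝ ∞ u D →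
      ⟪pd D (pd D u 0) 0 x, pd D (pd D u 1) 1 x⟫ - ⟪pd D (pd D u 0) 1 x, pd D (pd D u 0) 1 x⟫ =
      pd D (fun y => ⟪pd D (pd D u 0) 0 y, pd D u 1 y⟫) 1 x -
        pd D (fun y => ⟪pd D (pd D u 0) 1 y, pd D u 1 y⟫) 0 x := fun {u} hu => by
    have h0 := contDiffOn_pd hD hu 0
    have h1 := contDiffOn_pd hD hu 1
    rw [pd_inner hD (contDiffOn_pd hD h0 0) h1 hx, pd_inner hD (contDiffOn_pd hD h0 1) h1 hx,
      pd_comm hD h0 hx 0 1, pd_comm hD hu hx 1 0]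
    ring
  have hc := fun i j k (y : E2) (hy : y ∈ D) => inner_pd_pd_eq_of_metric_eq hD hr hR hm hy i j k
  rw [key hr, key hR, pd_congr (fun y hy => hc 0 0 1 y hy) hx,
    pd_congr (fun y hy => hc 0 1 1 y hy) hx]

end SecondOrder

section Gauss

variable {S S' : Set E3} {n n' f : E3 → E3} {D : Set E2} {r R : E2 → E3}

theorem norm_nrm_sq (D : Set E2) (r : E2 → E3) (x : E2) :
    ‖nrm D r x‖ ^ 2 = ⟪pd D r 0 x, pd D r 0 x⟫ * ⟪pd D r 1 x, pd D r 1 x⟫ -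
      ⟪pd D r 0 x, pd D r 1 x⟫ ^ 2 := by
  rw [← real_inner_self_eq_norm_sq, nrm, inner_cross_cross,
    real_inner_comm (pd D r 0 x) (pd D r 1 x)]
  ring

/-- The Jacobian of the spherical map in terms of the second derivatives of a parametrization. -/
theorem IsImmersedPatch.sphericalJacobian_mul (hS : IsSurface S) (h : IsImmersedPatch S D r)
    (hn : IsCoorientation S n) {x : E2} (hx : x ∈ D) :
    sphericalJacobian S n (r x) * ‖nrm D r x‖ ^ 4 =
      ⟪nrm D r x, pd D (pd D r 0) 0 x⟫ * ⟪nrm D r x, pd D (pd D r 1) 1 x⟫ -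
        ⟪nrm D r x, pd D (pd D r 0) 1 x⟫ ^ 2 := by
  have hD := h.domain
  have hns := h.contDiffOn_normal hn
  -- Differentiation of `⟪N, r_j⟫ = 0`.
  have hnp : ∀ i j, ⟪pd D (n ∘ r) i x, pd D r j x⟫ = -⟪n (r x), pd D (pd D r j) i x⟫ := by
    intro i j
    have h1 := pd_inner hD hns (contDiffOn_pd hD h.smooth j) hx i
    have h2 : pd D (fun y => ⟪(n ∘ r) y, pd D r j y⟫) i x = 0 := by
      rw [pd_congr (f := fun y => ⟪(n ∘ r) y, pd D r j y⟫) (g := fun _ => (0 : ℝ))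
        (fun y hy => h.inner_normal_pd hn hy j) hx]
      simp [pd]
    rw [h2] at h1
    simp only [Function.comp_apply] at h1
    change 0 = ⟪n (r x), _⟫ + ⟪pd D (n ∘ r) i x, _⟫ at h1
    linarith
  have h1 := congrArg (fun w => ⟪w, nrm D r x⟫) (h.cross_pd_normal hS hn hx)
  simp only [inner_smul_left, conj_trivial, real_inner_self_eq_norm_sq] at h1
  rw [nrm, nrm, inner_cross_cross, hnp, hnp, hnp, hnp, ← nrm, pd_comm hD h.smooth hx 1 0] at h1
  have h2 : ∀ w, ⟪nrm D r x, w⟫ = ⟪n (r x), nrm D r x⟫ * ⟪n (r x), w⟫ := fun w => by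
    conv_lhs => rw [h.nrm_eq hn hx, inner_smul_left, conj_trivial]
  have h3 := h2 (nrm D r x)
  rw [real_inner_self_eq_norm_sq] at h3
  rw [h2, h2, h2]
  linear_combination (-‖nrm D r x‖ ^ 2) * h1 + (⟪n (r x), pd D (pd D r 0) 0 x⟫ *
    ⟪n (r x), pd D (pd D r 1) 1 x⟫ - ⟪n (r x), pd D (pd D r 0) 1 x⟫ ^ 2) * h3

/-- **Theorema egregium**, infinitesimal form: the Jacobian of the spherical map depends only on
the first fundamental form. -/
theorem sphericalJacobian_eq_of_metric_eq (hS : IsSurface S) (hS' : IsSurface S')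
    (hn : IsCoorientation S n) (hn' : IsCoorientation S' n') (h : IsImmersedPatch S D r)
    (h' : IsImmersedPatch S' D R)
    (hm : ∀ x ∈ D, ∀ i j, ⟪pd D R i x, pd D R j x⟫ = ⟪pd D r i x, pd D r j x⟫)
    {x : E2} (hx : x ∈ D) : sphericalJacobian S' n' (R x) = sphericalJacobian S n (r x) := by
  have hnrm : ‖nrm D R x‖ ^ 2 = ‖nrm D r x‖ ^ 2 := by
    rw [norm_nrm_sq, norm_nrm_sq, hm x hx, hm x hx, hm x hx]
  have h0 : ‖nrm D r x‖ ≠ 0 := norm_ne_zero_iff.2 (h.nrm_ne_zero hx)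
  have e1 := h.sphericalJacobian_mul hS hn hx
  have e2 := h'.sphericalJacobian_mul hS' hn' hx
  have hc := inner_pd_pd_eq_of_metric_eq h.domain h.smooth h'.smooth hm hx
  have hs := inner_sub_inner_eq_of_metric_eq h.domain h.smooth h'.smooth hm hx
  rw [show ‖nrm D R x‖ ^ 4 = (‖nrm D R x‖ ^ 2) ^ 2 by ring, hnrm, sq ⟪nrm D R x, _⟫] at e2
  rw [sq ⟪nrm D r x, _⟫] at e1
  simp only [nrm] at e1 e2
  -- Both sides are now polynomials in the `⟪r_i, r_j⟫`, the `⟪r_ij, r_k⟫` and the products of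
  -- second derivatives covered by `hs`.
  rw [inner_cross_mul_inner_cross, inner_cross_mul_inner_cross] at e1 e2
  simp only [hm x hx, hc] at e2
  refine mul_right_cancel₀ (pow_ne_zero 4 h0) ?_
  simp only [nrm]
  rw [e1]
  linear_combination e2 + (⟪pd D r 0 x, pd D r 0 x⟫ * ⟪pd D r 1 x, pd D r 1 x⟫ -
    ⟪pd D r 0 x, pd D r 1 x⟫ ^ 2) * hs

/-! ### Length preserving maps -/

/-- If the chords of `δ` from `δ 0` are at most as long as the arcs of `γ` from `γ 0`, then the
initial speed of `δ` is at most that of `γ`. -/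
theorem norm_deriv_le_of_edist_le_eVariationOn {γ δ : ℝ → E3} {γ' : ℝ → E3} {δ' : E3} {b : ℝ}
    (hb : 0 < b) (hγ : ∀ t ∈ Icc 0 b, HasDerivWithinAt γ (γ' t) (Icc 0 b) t)
    (hγc : ContinuousOn γ' (Icc 0 b)) (hδ : HasDerivWithinAt δ δ' (Icc 0 b) 0)
    (hle : ∀ h, 0 < h → h ≤ b → edist (δ 0) (δ h) ≤ eVariationOn γ (Icc 0 h)) :
    ‖δ'‖ ≤ ‖γ' 0‖ := by
  refine le_of_forall_gt fun C hC => ?_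
  have h0 : (0 : ℝ) ∈ Icc 0 b := ⟨le_rfl, hb.le⟩
  -- For a constant `K` between `‖γ' 0‖` and `C`, the curve `γ` is `K`-Lipschitz near `0`.
  obtain ⟨K, hK⟩ : ∃ K : ℝ≥0, (K : ℝ) = (‖γ' 0‖ + C) / 2 :=
    ⟨⟨(‖γ' 0‖ + C) / 2, by linarith [norm_nonneg (γ' 0)]⟩, rfl⟩
  refine lt_of_le_of_lt ?_ (show (K : ℝ) < C by rw [hK]; linarith)
  have hev : ∀ᶠ t in 𝓝[Icc 0 b] 0, ‖γ' t‖ < K :=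
    (hγc 0 h0).norm.eventually_lt_const (by rw [hK]; linarith)
  obtain ⟨ε, hε, hεs⟩ := Metric.mem_nhdsWithin_iff.1 hev
  have hmem : Icc 0 b ∈ 𝓝[>] (0 : ℝ) := Icc_mem_nhdsGT hb
  have hslope := (hasDerivWithinAt_iff_tendsto_slope.1 hδ).mono_left
    (nhdsWithin_mono 0 (s := Ioc 0 b) (t := Icc 0 b \ {0})
      fun t ht => ⟨⟨ht.1.le, ht.2⟩, fun h => by simp only [mem_singleton_iff] at h; linarith [ht.1]⟩)
  have hne : (𝓝[Ioc 0 b] (0 : ℝ)).NeBot := by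
    rw [nhdsWithin_Ioc_eq_nhdsGT hb]; infer_instance
  refine le_of_tendsto hslope.norm ?_
  have hsmall : ∀ᶠ t in 𝓝[Ioc 0 b] (0 : ℝ), t < ε :=
    mem_nhdsWithin_of_mem_nhds (Iio_mem_nhds hε)
  filter_upwards [hsmall, self_mem_nhdsWithin] with h hhε hhb
  have hsub : Icc 0 h ⊆ Icc 0 b := Icc_subset_Icc le_rfl hhb.2
  have hlip : LipschitzOnWith K γ (Icc 0 h) :=
    (convex_Icc 0 h).lipschitzOnWith_of_nnnorm_hasDerivWithin_le
      (fun t ht => (hγ t (hsub ht)).mono hsub) fun t ht => by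
        have : ‖γ' t‖ < K := hεs ⟨by
          rw [Metric.mem_ball, Real.dist_eq, sub_zero, abs_of_nonneg ht.1]
          exact ht.2.trans_lt hhε, hsub ht⟩
        exact_mod_cast this.le
  have hvar : eVariationOn γ (Icc 0 h) ≤ K * ENNReal.ofReal h := by
    have h1 := hlip.comp_eVariationOn_le (g := id) (s := Icc 0 h) (fun t ht => ht)
    refine h1.trans (mul_le_mul_right ?_ _)
    have h2 := (monotoneOn_id (s := Icc (0 : ℝ) h)).eVariationOn_eq
      (left_mem_Icc.2 hhb.1.le) (right_mem_Icc.2 hhb.1.le)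
    rw [inter_self, id, id, sub_zero] at h2
    exact h2.le
  have h3 := (hle h hhb.1 hhb.2).trans hvar
  rw [edist_dist, dist_comm, dist_eq_norm, ← ENNReal.ofReal_coe_nnreal,
    ← ENNReal.ofReal_mul K.coe_nonneg,
    ENNReal.ofReal_le_ofReal_iff (mul_nonneg K.coe_nonneg hhb.1.le)] at h3
  rw [slope_def_module, sub_zero, norm_smul, norm_inv, Real.norm_eq_abs, abs_of_pos hhb.1,
    inv_mul_le_iff₀ hhb.1]
  linarith

/-- A length preserving map preserves the first fundamental form. At inner points of the domain the
speeds of the images of straight segments are compared; the rest is polarization and continuity. -/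
theorem IsLengthPreservingMap.inner_pd_eq (hf : IsLengthPreservingMap S S' f)
    (h : IsPatch S D r) {x : E2} (hx : x ∈ D) (i j : Fin 2) :
    ⟪pd D (f ∘ r) i x, pd D (f ∘ r) j x⟫ = ⟪pd D r i x, pd D r j x⟫ := by
  have hsm : ContDiffOn ℝ ∞ (f ∘ r) D := hf.smooth D r h.domain h.param h.sub
  have hnorm : ∀ y ∈ interior D, ∀ ξ : E2,
      ‖fderivWithin ℝ (f ∘ r) D y ξ‖ = ‖fderivWithin ℝ r D y ξ‖ := by
    intro y hy ξ
    by_cases hξ : ξ = 0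
    · simp [hξ]
    set c : ℝ → E2 := fun t => y + t • ξ with hc
    have hcc : Continuous c := by fun_prop
    have hcd : ContDiff ℝ ∞ c := by fun_prop
    have hcder : ∀ t, HasDerivAt c ξ t := fun t => by
      simpa [hc] using ((hasDerivAt_id t).smul_const ξ).const_add y
    obtain ⟨b, hb, hbD⟩ : ∃ b > 0, ∀ t ∈ Icc 0 b, c t ∈ interior D := by
      have : ∀ᶠ t in 𝓝 (0 : ℝ), c t ∈ interior D :=
        hcc.continuousAt.eventually (isOpen_interior.mem_nhds (by simpa [hc] using hy))
      obtain ⟨ε, hε, h1⟩ := Metric.eventually_nhds_iff.1 this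
      refine ⟨ε / 2, by positivity, fun t ht => h1 ?_⟩
      rw [Real.dist_eq, sub_zero, abs_of_nonneg ht.1]
      linarith [ht.2]
    have hcD : MapsTo c (Icc 0 b) D := fun t ht => interior_subset (hbD t ht)
    have hder : ∀ {u : E2 → E3}, ContDiffOn ℝ ∞ u D → ∀ t ∈ Icc 0 b,
        HasDerivWithinAt (u ∘ c) (fderivWithin ℝ u D (c t) ξ) (Icc 0 b) t := fun {u} hu t ht =>
      (hasFDerivWithinAt_of_contDiffOn hu (hcD ht)).comp_hasDerivWithinAt t
        (hcder t).hasDerivWithinAt hcD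
    have hcont : ∀ {u : E2 → E3}, ContDiffOn ℝ ∞ u D →
        ContinuousOn (fun t => fderivWithin ℝ u D (c t) ξ) (Icc 0 b) := fun {u} hu =>
      ((hu.continuousOn_fderivWithin h.domain.uniqueDiffOn (by simp)).comp hcc.continuousOn
        hcD).clm_apply continuousOn_const
    have hc0 : c 0 = y := by simp [hc]
    have hlen : ∀ t, 0 < t → t ≤ b →
        eVariationOn ((f ∘ r) ∘ c) (Icc 0 t) = eVariationOn (r ∘ c) (Icc 0 t) := by
      intro t ht htb
      have hsub : Icc 0 t ⊆ Icc 0 b := Icc_subset_Icc le_rfl htb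
      refine hf.lengths (r ∘ c) 0 t ht (h.param.smooth.comp hcd.contDiffOn (hcD.mono_left hsub))
        (fun s hs => ?_) fun s hs => h.sub ⟨c s, hcD (hsub hs), rfl⟩
      rw [((hder h.param.smooth s (hsub hs)).mono hsub).derivWithin (uniqueDiffOn_Icc ht s hs)]
      intro h0
      exact hξ (h.param.regular (c s) (hcD (hsub hs)) (by rw [h0, map_zero]))
    have h0 : (0 : ℝ) ∈ Icc 0 b := ⟨le_rfl, hb.le⟩
    refine le_antisymm ?_ ?_
    · have := norm_deriv_le_of_edist_le_eVariationOn hb (hder h.param.smooth) (hcont h.param.smooth)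
        (hder hsm 0 h0) fun t ht htb => by
          rw [← hlen t ht htb]
          exact eVariationOn.edist_le _ (left_mem_Icc.2 ht.le) (right_mem_Icc.2 ht.le)
      simpa only [hc0] using this
    · have := norm_deriv_le_of_edist_le_eVariationOn hb (hder hsm) (hcont hsm)
        (hder h.param.smooth 0 h0) fun t ht htb => by
          rw [hlen t ht htb]
          exact eVariationOn.edist_le _ (left_mem_Icc.2 ht.le) (right_mem_Icc.2 ht.le)
      simpa only [hc0] using this
  have hint : EqOn (fun y => ⟪pd D (f ∘ r) i y, pd D (f ∘ r) j y⟫)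
      (fun y => ⟪pd D r i y, pd D r j y⟫) (interior D) := fun y hy => by
    simp only [pd]
    rw [real_inner_eq_norm_add_mul_self_sub_norm_mul_self_sub_norm_mul_self_div_two,
      real_inner_eq_norm_add_mul_self_sub_norm_mul_self_sub_norm_mul_self_div_two,
      ← map_add, ← map_add, hnorm y hy, hnorm y hy, hnorm y hy]
  refine hint.of_subset_closure ?_ ?_ interior_subset h.domain.closure_interior.ge hx
  · exact (contDiffOn_pd h.domain hsm i).continuousOn.inner (contDiffOn_pd h.domain hsm j).continuousOn
  · exact (contDiffOn_pd h.domain h.param.smooth i).continuousOn.inner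
      (contDiffOn_pd h.domain h.param.smooth j).continuousOn

theorem IsLengthPreservingMap.norm_nrm_comp (hf : IsLengthPreservingMap S S' f)
    (h : IsPatch S D r) {x : E2} (hx : x ∈ D) : ‖nrm D (f ∘ r) x‖ = ‖nrm D r x‖ := by
  rw [← sq_eq_sq₀ (norm_nonneg _) (norm_nonneg _), norm_nrm_sq, norm_nrm_sq,
    hf.inner_pd_eq h hx, hf.inner_pd_eq h hx, hf.inner_pd_eq h hx]

theorem IsLengthPreservingMap.isImmersedPatch_comp (hf : IsLengthPreservingMap S S' f)
    (h : IsPatch S D r) : IsImmersedPatch S' D (f ∘ r) where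
  domain := h.domain
  smooth := hf.smooth D r h.domain h.param h.sub
  regular := fun x hx => injective_of_cross_ne_zero <| norm_ne_zero_iff.1 <| by
    have := hf.norm_nrm_comp h hx
    rw [nrm] at this
    change ‖cross (pd D (f ∘ r) 0 x) (pd D (f ∘ r) 1 x)‖ ≠ 0
    rw [this]
    exact norm_ne_zero_iff.2 (h.immersed.nrm_ne_zero hx)
  mapsTo := fun x hx => hf.mapsTo (h.sub ⟨x, hx, rfl⟩)

/-- Length preserving maps preserve the Jacobian of the spherical map. -/
theorem IsLengthPreservingMap.sphericalJacobian_eq (hf : IsLengthPreservingMap S S' f)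
    (hS : IsSurface S) (hS' : IsSurface S') (hn : IsCoorientation S n)
    (hn' : IsCoorientation S' n') {P : E3} (hP : P ∈ S) :
    sphericalJacobian S' n' (f P) = sphericalJacobian S n P := by
  obtain ⟨D, r, x, h, hx, rfl, -⟩ := hS.exists_patch_point hP
  exact sphericalJacobian_eq_of_metric_eq hS hS' hn hn' h.immersed (hf.isImmersedPatch_comp h)
    (fun y hy => hf.inner_pd_eq h hy) hx

theorem IsIntrinsicIsometry.integral_sphericalJacobian_eq (hf : IsIntrinsicIsometry S S' f)
    (hS : IsSurface S) (hS' : IsSurface S') (hn : IsCoorientation S n)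
    (hn' : IsCoorientation S' n') :
    ∫ P in S', sphericalJacobian S' n' P ∂μHE[2] = ∫ P in S, sphericalJacobian S n P ∂μHE[2] := by
  have hsm : IsSmoothOn S f := fun D r h => hf.smooth D r h.domain h.param h.sub
  have hfc : ContinuousOn f S := hsm.continuousOn hS
  have hfm : AEMeasurable f (μHE[2].restrict S) := hfc.aemeasurable hS.measurableSet
  -- A bijection that preserves the first fundamental form preserves area.
  have hmap : Measure.map f (μHE[2].restrict S) = μHE[2].restrict S' := by
    refine Measure.ext fun B hB => ?_
    have hm := measurableSet_inter_preimage hS.measurableSet hfc hB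
    rw [Measure.map_apply_of_aemeasurable hfm hB, Measure.restrict_apply hB,
      Measure.restrict_apply₀ (hfm.nullMeasurableSet_preimage hB), inter_comm (f ⁻¹' B)]
    have h1 := hS.area_image hsm hm inter_subset_left (hf.bij.injOn.mono inter_subset_left)
      (w := fun _ => 1) (fun _ _ => one_pos)
      (fun D r h x hx _ => by rw [hf.norm_nrm_comp h hx, one_mul])
    rw [image_inter_preimage, hf.bij.image_eq] at h1
    rw [inter_comm B, h1]
    simp
  rw [← hmap, integral_map hfm]
  · exact setIntegral_congr_fun hS.measurableSet fun P hP =>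
      hf.toIsLengthPreservingMap.sphericalJacobian_eq hS hS' hn hn' hP
  · rw [hmap]
    exact (continuousOn_sphericalJacobian hS' hn').aestronglyMeasurable hS'.measurableSet

/-! ### The Gaussian curvature at a point -/

theorem IsPatch.isSurface_image (h : IsPatch S D r) : IsSurface (r '' D) :=
  ⟨h.domain.isCompact.image_of_continuousOn h.param.smooth.continuousOn, fun _ _ =>
    ⟨univ, Filter.univ_mem, isClosed_univ, D, r, h.domain, h.param, inter_univ _⟩⟩

theorem IsCoorientation.mono (hn : IsCoorientation S n) {T : Set E3} (hT : T ⊆ S) :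
    IsCoorientation T n where
  cont := hn.cont.mono hT
  unit := fun P hP => hn.unit P (hT hP)
  normal := fun P hP v hv => hn.normal P (hT hP) v
    (Submodule.span_mono (tangentConeAt_mono hT) hv)

/-- The Jacobian of the spherical map is local: it may be computed on a patch. -/
theorem IsPatch.sphericalJacobian_image (hS : IsSurface S) (h : IsPatch S D r)
    (hn : IsCoorientation S n) {P : E3} (hP : P ∈ r '' D) :
    sphericalJacobian (r '' D) n P = sphericalJacobian S n P := by
  obtain ⟨x, hx, rfl⟩ := hP
  have h1 := h.immersed.cross_pd_normal hS hn hx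
  have h' : IsPatch (r '' D) D r := ⟨h.domain, h.param, subset_rfl⟩
  have h2 := h'.immersed.cross_pd_normal h.isSurface_image (hn.mono h.sub) hx
  rw [h1] at h2
  exact (smul_left_injective ℝ (h.immersed.nrm_ne_zero hx) h2).symm

theorem IsPatch.area_image_pos (h : IsPatch S D r) : 0 < area (r '' D) := by
  refine ENNReal.toReal_pos ?_ h.measure_image_lt_top.ne
  have h1 := h.lintegral_image h.domain.measurableSet subset_rfl (fun _ => 1)
  rw [setLIntegral_one] at h1
  rw [h1]
  simp only [mul_one]
  have hm : AEMeasurable (fun x => ENNReal.ofReal ‖nrm D r x‖) (volume.restrict D) :=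
    (h.immersed.contDiffOn_nrm.continuousOn.norm.aemeasurable h.domain.measurableSet).ennreal_ofReal
  rw [ne_eq, lintegral_eq_zero_iff' hm]
  intro h0
  have h2 : ∀ᵐ x ∂(volume : Measure E2).restrict D, False := by
    filter_upwards [h0, ae_restrict_mem h.domain.measurableSet] with x hx hxD
    have := h.immersed.nrm_ne_zero hxD
    simp only [Pi.zero_apply, ENNReal.ofReal_eq_zero] at hx
    exact this (norm_le_zero_iff.1 hx)
  rw [Filter.eventually_false_iff_eq_bot, ae_eq_bot, Measure.restrict_eq_zero] at h2
  exact (isOpen_interior.measure_pos volume h.domain.nonempty_interior).ne'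
    (measure_mono_null interior_subset h2)

/-- Every point of a surface lies in arbitrarily small parametrized rectangles. -/
theorem IsSurface.exists_small_rectangle (hS : IsSurface S) {P : E3} (hP : P ∈ S) {δ : ℝ}
    (hδ : 0 < δ) : ∃ D r, IsClosedRectangle D ∧ IsRegularParam D r ∧ r '' D ⊆ S ∧ P ∈ r '' D ∧
      Metric.diam (r '' D) < δ := by
  obtain ⟨D, r, x, h, hx, rfl, -⟩ := hS.exists_patch_point hP
  -- a triangle in the domain with a vertex at `x`
  obtain ⟨z, w, hz, hw, hzw⟩ : ∃ z w, z ∈ D ∧ w ∈ D ∧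
      (z 0 - x 0) * (w 1 - x 1) - (z 1 - x 1) * (w 0 - x 0) ≠ 0 := by
    obtain ⟨y, hy⟩ := h.domain.nonempty_interior
    obtain ⟨ρ, hρ, hball⟩ := Metric.isOpen_iff.1 isOpen_interior y hy
    have hmem : ∀ i, y + (ρ / 2) • e2 i ∈ D := fun i => interior_subset <| hball <| by
      rw [mem_ball_iff_norm, add_sub_cancel_left, norm_smul, Real.norm_eq_abs,
        abs_of_pos (by positivity)]
      simp; linarith
    by_cases h0 : y 0 - x 0 = 0
    · by_cases h1 : y 1 - x 1 = 0
      · refine ⟨_, _, hmem 0, hmem 1, ?_⟩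
        simp
        rw [show y 0 = x 0 by linarith, show y 1 = x 1 by linarith]
        ring_nf
        positivity
      · refine ⟨y, _, interior_subset hy, hmem 0, ?_⟩
        simp [h0]
        rw [show y 0 = x 0 by linarith]
        exact ⟨h1, by simpa using hρ.ne'⟩
    · refine ⟨y, _, interior_subset hy, hmem 1, ?_⟩
      simp
      intro h2
      have : (y 0 - x 0) * (ρ / 2) = 0 := by linear_combination h2
      rcases mul_eq_zero.1 this with h3 | h3
      · exact h0 h3
      · linarith
  set L : E2 →L[ℝ] E2 := (EuclideanSpace.proj 0 : E2 →L[ℝ] ℝ).smulRight (z - x) +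
    (EuclideanSpace.proj 1 : E2 →L[ℝ] ℝ).smulRight (w - x) with hL
  have hLa : ∀ s : E2, L s = s 0 • (z - x) + s 1 • (w - x) := fun s => by simp [hL]
  have hLinj : Function.Injective L := by
    refine (injective_iff_map_eq_zero L).2 fun s hs => ?_
    rw [hLa] at hs
    have a0 := congrFun (congrArg WithLp.ofLp hs) 0
    have a1 := congrFun (congrArg WithLp.ofLp hs) 1
    simp at a0 a1
    have b0 : s 0 = 0 := by
      refine (mul_eq_zero.1 (?_ : s 0 * _ = 0)).resolve_right hzw
      linear_combination a0 * (w 1 - x 1) - a1 * (w 0 - x 0)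
    have b1 : s 1 = 0 := by
      refine (mul_eq_zero.1 (?_ : s 1 * _ = 0)).resolve_right hzw
      linear_combination a1 * (z 0 - x 0) - a0 * (z 1 - x 1)
    ext i
    fin_cases i <;> simp [b0, b1]
  set A : E2 → E2 := fun s => x + L s with hA
  have hAd : ∀ s, HasFDerivAt A L s := fun s => (L.hasFDerivAt).const_add x
  have hAD : ∀ s : E2, 0 ≤ s 0 → 0 ≤ s 1 → s 0 + s 1 ≤ 1 → A s ∈ D := by
    intro s h0 h1 h2
    have : A s = (1 - s 0 - s 1) • x + s 0 • z + s 1 • w := by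
      simp only [hA, hLa]; module
    rw [this]
    have hsum := h.domain.convex.sum_mem (t := (Finset.univ : Finset (Fin 3)))
      (w := ![1 - s 0 - s 1, s 0, s 1]) (z := ![x, z, w])
      (by intro i _; fin_cases i <;> simp <;> linarith) (by simp only [Fin.sum_univ_three]; simp; ring)
      (by intro i _; fin_cases i <;> simp [hx, hz, hw])
    simpa [Fin.sum_univ_three] using hsum
  have hA0 : A 0 = x := by simp [hA]
  -- the square of side `τ`
  have hsq : ∀ τ, 0 < τ → IsClosedRectangle {s : E2 | ∀ i, s i ∈ Icc (0 : ℝ) τ} := fun τ hτ =>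
    ⟨fun _ => 0, fun _ => τ, fun _ => hτ, rfl⟩
  have hcont : ContinuousOn (r ∘ A) (A ⁻¹' D) :=
    h.param.smooth.continuousOn.comp (by fun_prop) fun s hs => hs
  have hnear : ∀ᶠ s in 𝓝[A ⁻¹' D] (0 : E2), dist (r (A s)) (r x) < δ / 3 := by
    have h1 : ContinuousWithinAt (r ∘ A) (A ⁻¹' D) 0 :=
      hcont 0 (by rw [mem_preimage, hA0]; exact hx)
    have := h1.eventually (Metric.ball_mem_nhds _ (show (0 : ℝ) < δ / 3 by positivity))
    simpa [hA0] using this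
  obtain ⟨η, hη, hηs⟩ := Metric.mem_nhdsWithin_iff.1 hnear
  set τ := min (1 / 2) (η / 2) with hτ
  have hτ0 : 0 < τ := by positivity
  have hτ1 : τ ≤ 1 / 2 := min_le_left _ _
  have hτ2 : τ ≤ η / 2 := min_le_right _ _
  set Q := {s : E2 | ∀ i, s i ∈ Icc (0 : ℝ) τ} with hQ
  have hQd : IsParamDomain Q := Or.inr (hsq τ hτ0)
  have hQD : MapsTo A Q D := fun s hs => hAD s (hs 0).1 (hs 1).1 (by linarith [(hs 0).2, (hs 1).2])
  have hclose : ∀ s ∈ Q, dist (r (A s)) (r x) < δ / 3 := fun s hs => hηs ⟨by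
    rw [mem_ball_zero_iff, EuclideanSpace.norm_eq, Real.sqrt_lt' hη]
    simp only [Fin.sum_univ_two, Real.norm_eq_abs, sq_abs]
    nlinarith [(hs 0).1, (hs 1).1, (hs 0).2, (hs 1).2], hQD hs⟩
  refine ⟨Q, r ∘ A, hsq τ hτ0, ⟨?_, ?_, ?_⟩, ?_, ⟨0, ?_, by simp [hA0]⟩, ?_⟩
  · exact h.param.smooth.comp (by fun_prop) hQD
  · intro s hs t ht hst
    have := h.param.inj (hQD hs) (hQD ht) hst
    exact hLinj (by simpa [hA] using this)
  · intro s hs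
    rw [((hasFDerivWithinAt_of_contDiffOn h.param.smooth (hQD hs)).comp s
      (hAd s).hasFDerivWithinAt hQD).fderivWithin (hQd.uniqueDiffOn s hs)]
    exact (h.param.regular _ (hQD hs)).comp hLinj
  · rintro _ ⟨s, hs, rfl⟩
    exact h.sub ⟨A s, hQD hs, rfl⟩
  · intro i
    exact ⟨by simp, by simpa using hτ0.le⟩
  · refine lt_of_le_of_lt (Metric.diam_le_of_forall_dist_le (C := 2 * (δ / 3)) (by positivity) ?_)
      (by linarith)
    rintro _ ⟨s, hs, rfl⟩ _ ⟨t, ht, rfl⟩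
    have := dist_triangle_right (r (A s)) (r (A t)) (r x)
    have := hclose s hs
    have := hclose t ht
    simp only [Function.comp_apply]
    linarith

theorem hasGaussCurvatureAt_sphericalJacobian (hS : IsSurface S) (hn : IsCoorientation S n)
    {P : E3} (hP : P ∈ S) : HasGaussCurvatureAt S n P (sphericalJacobian S n P) := by
  intro ε hε
  obtain ⟨δ, hδ, hδs⟩ := Metric.continuousWithinAt_iff.1
    (continuousOn_sphericalJacobian hS hn P hP) (ε / 2) (by positivity)
  refine ⟨δ, hδ, fun D r hD hr hrS hPr hdiam => ?_⟩
  have h : IsPatch S D r := ⟨Or.inr hD, hr, hrS⟩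
  have hT := h.isSurface_image
  have hnT := hn.mono hrS
  refine ⟨_, hasTotalGaussCurvature_integral hT hnT, ?_⟩
  have hpos := h.area_image_pos
  have hbd : ∀ Q ∈ r '' D, ‖sphericalJacobian (r '' D) n Q - sphericalJacobian S n P‖ ≤ ε / 2 := by
    intro Q hQ
    rw [h.sphericalJacobian_image hS hn hQ, ← dist_eq_norm]
    exact (hδs (hrS hQ) ((Metric.dist_le_diam_of_mem hT.1.isBounded hQ hPr).trans_lt hdiam)).le
  have h1 := norm_setIntegral_le_of_norm_le_const hT.area_lt_top hbd
  rw [integral_sub (hT.integrableOn (continuousOn_sphericalJacobian hT hnT))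
    (hT.integrableOn continuousOn_const), setIntegral_const] at h1
  change ‖_ - area (r '' D) • _‖ ≤ _ * area (r '' D) at h1
  rw [Real.norm_eq_abs, smul_eq_mul] at h1
  have h2 : (∫ Q in r '' D, sphericalJacobian (r '' D) n Q ∂μHE[2]) / area (r '' D) -
      sphericalJacobian S n P = ((∫ Q in r '' D, sphericalJacobian (r '' D) n Q ∂μHE[2]) -
      area (r '' D) * sphericalJacobian S n P) / area (r '' D) := by
    field_simp
  rw [h2, abs_div, abs_of_pos hpos, div_lt_iff₀ hpos]
  nlinarith

theorem hasGaussCurvatureAt_iff (hS : IsSurface S) (hn : IsCoorientation S n) {P : E3}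
    (hP : P ∈ S) (k : ℝ) : HasGaussCurvatureAt S n P k ↔ k = sphericalJacobian S n P := by
  refine ⟨fun hk => ?_, fun hk => hk ▸ hasGaussCurvatureAt_sphericalJacobian hS hn hP⟩
  by_contra hne
  have hε : 0 < |k - sphericalJacobian S n P| / 2 := by
    have := abs_pos.2 (sub_ne_zero.2 hne); positivity
  obtain ⟨δ₁, hδ₁, h1⟩ := hk _ hε
  obtain ⟨δ₂, hδ₂, h2⟩ := hasGaussCurvatureAt_sphericalJacobian hS hn hP _ hε
  -- Both limits are tested on one small rectangle; without such rectangles uniqueness would fail.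
  obtain ⟨D, r, hD, hr, hrS, hPr, hdiam⟩ := hS.exists_small_rectangle hP (lt_min hδ₁ hδ₂)
  obtain ⟨K₁, hK₁, a1⟩ := h1 D r hD hr hrS hPr (hdiam.trans_le (min_le_left _ _))
  obtain ⟨K₂, hK₂, a2⟩ := h2 D r hD hr hrS hPr (hdiam.trans_le (min_le_right _ _))
  rw [hK₁.unique hK₂] at a1
  have h3 : |k - sphericalJacobian S n P| ≤ |K₂ / area (r '' D) - k| +
      |K₂ / area (r '' D) - sphericalJacobian S n P| := by
    have := abs_sub_le k (K₂ / area (r '' D)) (sphericalJacobian S n P)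
    rwa [abs_sub_comm k (K₂ / area (r '' D))] at this
  linarith

end Gauss

/-! ### Green's formula on a disk -/

section Green

/-- The point of the plane with given coordinates. -/
def pt (p : ℝ × ℝ) : E2 := !₂[p.1, p.2]

@[simp] theorem pt_zero (p : ℝ × ℝ) : pt p 0 = p.1 := rfl

@[simp] theorem pt_one (p : ℝ × ℝ) : pt p 1 = p.2 := rfl

theorem continuous_pt : Continuous pt := by
  unfold pt
  refine (PiLp.continuous_toLp 2 _).comp (continuous_pi fun i => ?_)
  fin_cases i
  · exact continuous_fst
  · exact continuous_snd

theorem integral_comp_pt (f : E2 → ℝ) : ∫ p, f (pt p) = ∫ x, f x := by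
  rw [← (PiLp.volume_preserving_toLp (Fin 2)).integral_comp
      (MeasurableEquiv.toLp 2 (Fin 2 → ℝ)).measurableEmbedding,
    ← ((volume_preserving_finTwoArrow ℝ).symm _).integral_comp
      (MeasurableEquiv.finTwoArrow (α := ℝ)).symm.measurableEmbedding]
  rfl

theorem pt_eq (p : ℝ × ℝ) : pt p = p.1 • e2 0 + p.2 • e2 1 := by
  ext i; fin_cases i <;> simp

variable {a b : Fin 2 → ℝ}

/-- The rectangle with the given sides. -/
def rect (a b : Fin 2 → ℝ) : Set E2 := {x : E2 | ∀ i, x i ∈ Icc (a i) (b i)}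

theorem isParamDomain_rect (hab : ∀ i, a i < b i) : IsParamDomain (rect a b) :=
  Or.inr ⟨a, b, hab, rfl⟩

theorem pt_mem_rect {p : ℝ × ℝ} :
    pt p ∈ rect a b ↔ p.1 ∈ Icc (a 0) (b 0) ∧ p.2 ∈ Icc (a 1) (b 1) := by
  simp [rect, Fin.forall_fin_two]

theorem integrableOn_comp_pt {u : E2 → ℝ} (hu : ContinuousOn u (rect a b)) :
    IntegrableOn (fun p => u (pt p)) (Icc (a 0) (b 0) ×ˢ Icc (a 1) (b 1))
      ((volume : Measure ℝ).prod volume) := by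
  rw [← Measure.volume_eq_prod]
  refine ContinuousOn.integrableOn_compact (isCompact_Icc.prod isCompact_Icc) ?_
  exact hu.comp continuous_pt.continuousOn fun p hp => pt_mem_rect.2 hp

theorem hasDerivWithinAt_comp_pt {u : E2 → ℝ}
    (hu : ContDiffOn ℝ ∞ u (rect a b)) {x y : ℝ} (hx : x ∈ Icc (a 0) (b 0))
    (hy : y ∈ Icc (a 1) (b 1)) :
    HasDerivWithinAt (fun x => u (pt (x, y))) (pd (rect a b) u 0 (pt (x, y)))
      (Icc (a 0) (b 0)) x ∧
    HasDerivWithinAt (fun y => u (pt (x, y))) (pd (rect a b) u 1 (pt (x, y)))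
      (Icc (a 1) (b 1)) y := by
  have hd := hasFDerivWithinAt_of_contDiffOn hu ((pt_mem_rect (p := (x, y))).2 ⟨hx, hy⟩)
  constructor
  · refine hd.comp_hasDerivWithinAt (f := fun x => pt (x, y)) x ?_
      (fun t ht => pt_mem_rect.2 ⟨ht, hy⟩)
    simp only [pt_eq]
    simpa using (((hasDerivAt_id x).smul_const (e2 0)).add_const (y • e2 1)).hasDerivWithinAt
  · refine hd.comp_hasDerivWithinAt (f := fun y => pt (x, y)) y ?_
      (fun t ht => pt_mem_rect.2 ⟨hx, ht⟩)
    simp only [pt_eq]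
    simpa using (((hasDerivAt_id y).smul_const (e2 1)).const_add (x • e2 0)).hasDerivWithinAt

theorem integral_deriv_eq_sub {a b : ℝ} (hab : a < b) {u u' : ℝ → ℝ}
    (hu : ∀ t ∈ Icc a b, HasDerivWithinAt u (u' t) (Icc a b) t) (hc : ContinuousOn u' (Icc a b)) :
    ∫ t in Icc a b, u' t = u b - u a := by
  rw [integral_Icc_eq_integral_Ioc, ← intervalIntegral.integral_of_le hab.le]
  refine intervalIntegral.integral_eq_sub_of_hasDerivAt_of_le hab.le
    (fun t ht => (hu t ht).continuousWithinAt) (fun t ht =>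
      (hu t (Ioo_subset_Icc_self ht)).hasDerivAt (Icc_mem_nhds ht.1 ht.2)) ?_
  exact hc.intervalIntegrable_of_Icc hab.le

theorem integral_rect_pd_one (hab : ∀ i, a i < b i) {u : E2 → ℝ}
    (hu : ContDiffOn ℝ ∞ u (rect a b)) :
    ∫ p in Icc (a 0) (b 0) ×ˢ Icc (a 1) (b 1), pd (rect a b) u 1 (pt p) =
      ∫ x in Icc (a 0) (b 0), (u (pt (x, b 1)) - u (pt (x, a 1))) := by
  have hc := (contDiffOn_pd (isParamDomain_rect hab) hu 1).continuousOn
  rw [Measure.volume_eq_prod, setIntegral_prod _ (integrableOn_comp_pt hc)]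
  refine setIntegral_congr_fun measurableSet_Icc fun x hx => ?_
  exact integral_deriv_eq_sub (hab 1) (u := fun y => u (pt (x, y)))
    (fun y hy => (hasDerivWithinAt_comp_pt hu hx hy).2)
    (hc.comp (continuous_pt.comp (by fun_prop)).continuousOn fun y hy => pt_mem_rect.2 ⟨hx, hy⟩)

theorem integral_rect_pd_zero (hab : ∀ i, a i < b i) {u : E2 → ℝ}
    (hu : ContDiffOn ℝ ∞ u (rect a b)) :
    ∫ p in Icc (a 0) (b 0) ×ˢ Icc (a 1) (b 1), pd (rect a b) u 0 (pt p) =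
      ∫ y in Icc (a 1) (b 1), (u (pt (b 0, y)) - u (pt (a 0, y))) := by
  have hc := (contDiffOn_pd (isParamDomain_rect hab) hu 0).continuousOn
  rw [Measure.volume_eq_prod, ← setIntegral_prod_swap, setIntegral_prod]
  swap
  · have := (integrableOn_comp_pt hc).swap
    exact this
  refine setIntegral_congr_fun measurableSet_Icc fun y hy => ?_
  exact integral_deriv_eq_sub (hab 0) (u := fun x => u (pt (x, y)))
    (fun x hx => (hasDerivWithinAt_comp_pt hu hx hy).1)
    (hc.comp (continuous_pt.comp (by fun_prop)).continuousOn fun x hx => pt_mem_rect.2 ⟨hx, hy⟩)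

/-- The unit vector with polar angle `θ`. -/
def dir (θ : ℝ) : E2 := Real.cos θ • e2 0 + Real.sin θ • e2 1

/-- The unit vector with polar angle `θ`, turned by a right angle. -/
def dirPerp (θ : ℝ) : E2 := -Real.sin θ • e2 0 + Real.cos θ • e2 1

@[simp] theorem dir_zero (θ : ℝ) : dir θ 0 = Real.cos θ := by simp [dir]

@[simp] theorem dir_one (θ : ℝ) : dir θ 1 = Real.sin θ := by simp [dir]

@[simp] theorem dirPerp_zero (θ : ℝ) : dirPerp θ 0 = -Real.sin θ := by simp [dirPerp]

@[simp] theorem dirPerp_one (θ : ℝ) : dirPerp θ 1 = Real.cos θ := by simp [dirPerp]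

theorem hasDerivAt_dir (θ : ℝ) : HasDerivAt dir (dirPerp θ) θ :=
  ((Real.hasDerivAt_cos θ).smul_const (e2 0)).add ((Real.hasDerivAt_sin θ).smul_const (e2 1))

theorem norm_dir (θ : ℝ) : ‖dir θ‖ = 1 := by
  rw [EuclideanSpace.norm_eq]
  simp

theorem contDiff_dir : ContDiff ℝ ∞ dir := by
  unfold dir
  exact (Real.contDiff_cos.smul contDiff_const).add (Real.contDiff_sin.smul contDiff_const)

/-- Polar coordinates with centre `c`. -/
def polar (c : E2) (x : E2) : E2 := c + x 0 • dir (x 1)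

theorem contDiff_polar (c : E2) : ContDiff ℝ ∞ (polar c) := by
  have h0 : ContDiff ℝ ∞ fun x : E2 => x 0 := (EuclideanSpace.proj (𝕜 := ℝ) (0 : Fin 2)).contDiff
  have h1 : ContDiff ℝ ∞ fun x : E2 => x 1 := (EuclideanSpace.proj (𝕜 := ℝ) (1 : Fin 2)).contDiff
  exact contDiff_const.add (h0.smul (contDiff_dir.comp h1))

theorem hasFDerivAt_polar (c x : E2) : HasFDerivAt (polar c)
    ((EuclideanSpace.proj 0 : E2 →L[ℝ] ℝ).smulRight (dir (x 1)) +
      (EuclideanSpace.proj 1 : E2 →L[ℝ] ℝ).smulRight (x 0 • dirPerp (x 1))) x := by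
  have h0 : HasFDerivAt (fun x : E2 => x 0) (EuclideanSpace.proj (𝕜 := ℝ) 0) x :=
    (EuclideanSpace.proj (𝕜 := ℝ) 0).hasFDerivAt
  have h1 : HasFDerivAt (fun x : E2 => x 1) (EuclideanSpace.proj (𝕜 := ℝ) 1) x :=
    (EuclideanSpace.proj (𝕜 := ℝ) 1).hasFDerivAt
  have h2 := (h0.smul ((hasDerivAt_dir (x 1)).hasFDerivAt.comp x h1)).const_add c
  refine h2.congr_fderiv ?_
  ext1 ξ
  simp [smul_smul, mul_comm]
  abel

/-- Integration over a disk in polar coordinates. -/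
theorem integral_closedBall_polar (c : E2) {ρ : ℝ} (h : E2 → ℝ) :
    ∫ x in Metric.closedBall c ρ, h x =
      ∫ p in Icc 0 ρ ×ˢ Icc (-Real.pi) Real.pi, p.1 * h (polar c (pt p)) := by
  rw [← integral_indicator Metric.isClosed_closedBall.measurableSet,
    ← integral_add_left_eq_self _ c, ← integral_comp_pt, ← integral_comp_polarCoord_symm]
  have h1 : ∀ p ∈ polarCoord.target, p.1 • (Metric.closedBall c ρ).indicator h
      (c + pt (polarCoord.symm p)) =
      (Iic ρ ×ˢ univ).indicator (fun p => p.1 * h (polar c (pt p))) p := by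
    rintro ⟨t, θ⟩ ⟨ht, -⟩
    have hp : c + pt (polarCoord.symm (t, θ)) = polar c (pt (t, θ)) := by
      ext i; fin_cases i <;> simp [polar]
    rw [hp]
    have hmem : polar c (pt (t, θ)) ∈ Metric.closedBall c ρ ↔
        (t, θ) ∈ (Iic ρ ×ˢ univ : Set (ℝ × ℝ)) := by
      rw [mem_closedBall_iff_norm, polar, add_sub_cancel_left, norm_smul, norm_dir, mul_one,
        Real.norm_eq_abs, pt_zero, abs_of_pos (mem_Ioi.1 ht)]
      simp
    by_cases hm : (t, θ) ∈ (Iic ρ ×ˢ univ : Set (ℝ × ℝ))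
    · rw [indicator_of_mem hm, indicator_of_mem (hmem.2 hm), smul_eq_mul]
    · rw [indicator_of_notMem hm, indicator_of_notMem (fun h => hm (hmem.1 h)), smul_zero]
  rw [setIntegral_congr_fun polarCoord.open_target.measurableSet h1,
    setIntegral_indicator (measurableSet_Iic.prod MeasurableSet.univ)]
  refine setIntegral_congr_set ?_
  have h2 : polarCoord.target ∩ Iic ρ ×ˢ univ = Ioc 0 ρ ×ˢ Ioo (-Real.pi) Real.pi := by
    rw [polarCoord_target, prod_inter_prod, inter_univ, Ioi_inter_Iic]
  rw [h2, Measure.volume_eq_prod]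
  exact Measure.set_prod_ae_eq Ioc_ae_eq_Icc Ioo_ae_eq_Icc

/-- **Green's formula** on a disk, for the differential form `⟪F, dG⟫`. -/
theorem green_closedBall {c : E2} {ρ : ℝ} (hρ : 0 < ρ) {F G : E2 → E3}
    (hF : ContDiffOn ℝ ∞ F (Metric.closedBall c ρ)) (hG : ContDiffOn ℝ ∞ G (Metric.closedBall c ρ)) :
    ∫ x in Metric.closedBall c ρ, (⟪pd (Metric.closedBall c ρ) F 0 x,
      pd (Metric.closedBall c ρ) G 1 x⟫ - ⟪pd (Metric.closedBall c ρ) F 1 x,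
      pd (Metric.closedBall c ρ) G 0 x⟫) =
    ∫ θ in Icc (-Real.pi) Real.pi, ⟪F (c + ρ • dir θ),
      fderivWithin ℝ G (Metric.closedBall c ρ) (c + ρ • dir θ) (ρ • dirPerp θ)⟫ := by
  set D := Metric.closedBall c ρ with hDdef
  -- In polar coordinates the disk becomes a rectangle.
  set a : Fin 2 → ℝ := ![0, -Real.pi] with ha
  set b : Fin 2 → ℝ := ![ρ, Real.pi] with hb
  have hab : ∀ i, a i < b i := by
    intro i; fin_cases i <;> simp [ha, hb, hρ, Real.pi_pos]
  set Q := rect a b with hQ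
  have hQd : IsParamDomain Q := isParamDomain_rect hab
  have hmaps : MapsTo (polar c) Q D := by
    intro x hx
    have h0 := hx 0
    simp only [ha, hb, Matrix.cons_val_zero] at h0
    rw [hDdef, mem_closedBall_iff_norm, polar, add_sub_cancel_left, norm_smul, norm_dir, mul_one,
      Real.norm_eq_abs, abs_of_nonneg h0.1]
    exact h0.2
  have hpd : ∀ {H : E2 → E3}, ContDiffOn ℝ ∞ H D → ∀ x ∈ Q,
      pd Q (H ∘ polar c) 0 x = fderivWithin ℝ H D (polar c x) (dir (x 1)) ∧
      pd Q (H ∘ polar c) 1 x = fderivWithin ℝ H D (polar c x) (x 0 • dirPerp (x 1)) := by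
    intro H hH x hx
    have := (hasFDerivWithinAt_of_contDiffOn hH (hmaps hx)).comp x
      (hasFDerivAt_polar c x).hasFDerivWithinAt hmaps
    rw [pd_eq_of_hasFDerivWithinAt hQd hx this, pd_eq_of_hasFDerivWithinAt hQd hx this]
    simp
  have hFs : ContDiffOn ℝ ∞ (F ∘ polar c) Q := hF.comp (contDiff_polar c).contDiffOn hmaps
  have hGs : ContDiffOn ℝ ∞ (G ∘ polar c) Q := hG.comp (contDiff_polar c).contDiffOn hmaps
  have hi : ∀ i, ContDiffOn ℝ ∞ (fun x => ⟪(F ∘ polar c) x, pd Q (G ∘ polar c) i x⟫) Q :=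
    fun i => hFs.inner ℝ (contDiffOn_pd hQd hGs i)
  have hint : ∀ i j, IntegrableOn (fun p : ℝ × ℝ =>
      pd Q (fun x => ⟪(F ∘ polar c) x, pd Q (G ∘ polar c) i x⟫) j (pt p))
      (Icc (a 0) (b 0) ×ˢ Icc (a 1) (b 1)) := fun i j =>
    integrableOn_comp_pt (contDiffOn_pd hQd (hi i) j).continuousOn
  -- The form `⟪F, dG⟫` is pulled back to polar coordinates; the factor `p.1` is the Jacobian.
  have key : ∀ p ∈ Icc (a 0) (b 0) ×ˢ Icc (a 1) (b 1), p.1 * (⟪pd D F 0 (polar c (pt p)),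
      pd D G 1 (polar c (pt p))⟫ - ⟪pd D F 1 (polar c (pt p)), pd D G 0 (polar c (pt p))⟫) =
      pd Q (fun x => ⟪(F ∘ polar c) x, pd Q (G ∘ polar c) 1 x⟫) 0 (pt p) -
      pd Q (fun x => ⟪(F ∘ polar c) x, pd Q (G ∘ polar c) 0 x⟫) 1 (pt p) := by
    intro p hp
    have hx : pt p ∈ Q := pt_mem_rect.2 hp
    rw [pd_inner hQd hFs (contDiffOn_pd hQd hGs 1) hx,
      pd_inner hQd hFs (contDiffOn_pd hQd hGs 0) hx, pd_comm hQd hGs hx 1 0,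
      (hpd hF _ hx).1, (hpd hF _ hx).2, (hpd hG _ hx).1, (hpd hG _ hx).2]
    simp only [fderivWithin_eq_pd D, dir_zero, dir_one, dirPerp_zero, dirPerp_one, PiLp.smul_apply, smul_eq_mul, pt_one,
      pt_zero, inner_add_left, inner_add_right, inner_smul_left, inner_smul_right, conj_trivial]
    have hcs := Real.sin_sq_add_cos_sq p.2
    linear_combination (-p.1 * (⟪pd D F 0 (polar c (pt p)),
      pd D G 1 (polar c (pt p))⟫ - ⟪pd D F 1 (polar c (pt p)), pd D G 0 (polar c (pt p))⟫)) * hcs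
  have e0 : Icc (0 : ℝ) ρ ×ˢ Icc (-Real.pi) Real.pi = Icc (a 0) (b 0) ×ˢ Icc (a 1) (b 1) := rfl
  rw [integral_closedBall_polar, e0,
    setIntegral_congr_fun (measurableSet_Icc.prod measurableSet_Icc) key,
    integral_sub (hint 1 0) (hint 0 1), integral_rect_pd_zero hab (hi 1),
    integral_rect_pd_one hab (hi 0)]
  -- The sides `θ = ± π` cancel.
  have e1 : ∫ x in Icc (a 0) (b 0), (⟪(F ∘ polar c) (pt (x, b 1)),
      pd Q (G ∘ polar c) 0 (pt (x, b 1))⟫ - ⟪(F ∘ polar c) (pt (x, a 1)),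
      pd Q (G ∘ polar c) 0 (pt (x, a 1))⟫) = 0 := by
    rw [setIntegral_congr_fun (g := fun _ => (0 : ℝ)) measurableSet_Icc, integral_zero]
    intro x hx
    have h1 : pt (x, b 1) ∈ Q := pt_mem_rect.2 ⟨hx, right_mem_Icc.2 (hab 1).le⟩
    have h2 : pt (x, a 1) ∈ Q := pt_mem_rect.2 ⟨hx, left_mem_Icc.2 (hab 1).le⟩
    have h3 : dir (b 1) = dir (a 1) := by simp [dir, ha, hb]
    have h4 : polar c (pt (x, b 1)) = polar c (pt (x, a 1)) := by
      simp only [polar, pt_zero, pt_one, h3]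
    simp only [(hpd hG _ h1).1, (hpd hG _ h2).1, Function.comp_apply, h4, pt_one, h3, sub_self]
  rw [e1, sub_zero]
  refine setIntegral_congr_fun measurableSet_Icc fun θ hθ => ?_
  -- The side of radius `0` contributes nothing, since there the derivative in `θ` vanishes.
  have h1 : pt (b 0, θ) ∈ Q := pt_mem_rect.2 ⟨right_mem_Icc.2 (hab 0).le, hθ⟩
  have h2 : pt (a 0, θ) ∈ Q := pt_mem_rect.2 ⟨left_mem_Icc.2 (hab 0).le, hθ⟩
  simp only [(hpd hG _ h1).2, (hpd hG _ h2).2]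
  simp [polar, ha, hb]

end Green

/-! ### Differential forms on a surface -/

section Smooth

variable {S : Set E3} {F : Type*} [NormedAddCommGroup F] [NormedSpace ℝ F]

theorem isSmoothOn_of_contDiff {f : E3 → F} (hf : ContDiff ℝ ∞ f) (S : Set E3) : IsSmoothOn S f :=
  fun _ _ h => hf.comp_contDiffOn h.param.smooth

theorem isSmoothOn_const (c : F) (S : Set E3) : IsSmoothOn S fun _ => c :=
  isSmoothOn_of_contDiff contDiff_const S

theorem IsSmoothOn.sub {f g : E3 → F} (hf : IsSmoothOn S f) (hg : IsSmoothOn S g) :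
    IsSmoothOn S fun P => f P - g P := fun D r h => (hf D r h).sub (hg D r h)

theorem IsSmoothOn.smul {u : E3 → ℝ} {f : E3 → F} (hu : IsSmoothOn S u) (hf : IsSmoothOn S f) :
    IsSmoothOn S fun P => u P • f P := fun D r h => (hu D r h).smul (hf D r h)

theorem IsSmoothOn.inner {f g : E3 → E3} (hf : IsSmoothOn S f) (hg : IsSmoothOn S g) :
    IsSmoothOn S fun P => ⟪f P, g P⟫ := fun D r h => (hf D r h).inner ℝ (hg D r h)

theorem IsSmoothOn.cross {f g : E3 → E3} (hf : IsSmoothOn S f) (hg : IsSmoothOn S g) :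
    IsSmoothOn S fun P => cross (f P) (g P) := fun D r h =>
  (crossL.contDiff.comp_contDiffOn (hf D r h)).clm_apply (hg D r h)

end Smooth

section Forms

variable {S : Set E3} {n f g : E3 → E3} {D : Set E2} {r : E2 → E3}

/-- The exterior derivative of the 1-form `⟪f, dg⟫` on a cooriented surface, divided by the area
form. -/
def curl (S : Set E3) (n f g : E3 → E3) (P : E3) : ℝ :=
  (⟪surfDeriv S n f P (e3 1), surfDeriv S n g P (e3 2)⟫ -
    ⟪surfDeriv S n f P (e3 2), surfDeriv S n g P (e3 1)⟫) * n P 0 +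
  (⟪surfDeriv S n f P (e3 2), surfDeriv S n g P (e3 0)⟫ -
    ⟪surfDeriv S n f P (e3 0), surfDeriv S n g P (e3 2)⟫) * n P 1 +
  (⟪surfDeriv S n f P (e3 0), surfDeriv S n g P (e3 1)⟫ -
    ⟪surfDeriv S n f P (e3 1), surfDeriv S n g P (e3 0)⟫) * n P 2

/-- The curl is the value of the exterior derivative on any positively oriented pair of unit area;
the coordinate formula that defines it makes its continuity evident. -/
theorem curl_mul_eq (S : Set E3) (n f g : E3 → E3) (P : E3) {p q : E3} {c : ℝ}
    (h : cross p q = c • n P) :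
    c * curl S n f g P = ⟪surfDeriv S n f P p, surfDeriv S n g P q⟫ -
      ⟪surfDeriv S n f P q, surfDeriv S n g P p⟫ := by
  have h0 := congrFun (congrArg WithLp.ofLp h) 0
  have h1 := congrFun (congrArg WithLp.ofLp h) 1
  have h2 := congrFun (congrArg WithLp.ofLp h) 2
  simp only [cross_apply_zero, cross_apply_one, cross_apply_two, PiLp.smul_apply, smul_eq_mul]
    at h0 h1 h2
  have hA := fun w => map_e3 (surfDeriv S n f P : E3 →ₗ[ℝ] E3) w
  have hB := fun w => map_e3 (surfDeriv S n g P : E3 →ₗ[ℝ] E3) w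
  simp only [ContinuousLinearMap.coe_coe] at hA hB
  rw [hA p, hA q, hB p, hB q, curl]
  simp only [inner_add_left, inner_add_right, inner_smul_left, inner_smul_right, conj_trivial]
  linear_combination
    (-(⟪surfDeriv S n f P (e3 1), surfDeriv S n g P (e3 2)⟫ -
    ⟪surfDeriv S n f P (e3 2), surfDeriv S n g P (e3 1)⟫)) * h0 -
  (⟪surfDeriv S n f P (e3 2), surfDeriv S n g P (e3 0)⟫ -
    ⟪surfDeriv S n f P (e3 0), surfDeriv S n g P (e3 2)⟫) * h1 -
  (⟪surfDeriv S n f P (e3 0), surfDeriv S n g P (e3 1)⟫ -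
    ⟪surfDeriv S n f P (e3 1), surfDeriv S n g P (e3 0)⟫) * h2

theorem IsImmersedPatch.curl_mul (hS : IsSurface S) (hn : IsCoorientation S n)
    (hf : IsSmoothOn S f) (hg : IsSmoothOn S g) (h : IsImmersedPatch S D r) {x : E2} (hx : x ∈ D) :
    ⟪n (r x), nrm D r x⟫ * curl S n f g (r x) = ⟪pd D (f ∘ r) 0 x, pd D (g ∘ r) 1 x⟫ -
      ⟪pd D (f ∘ r) 1 x, pd D (g ∘ r) 0 x⟫ := by
  rw [curl_mul_eq S n f g (r x) (h.nrm_eq hn hx), hf.pd_comp hS hn h hx, hf.pd_comp hS hn h hx,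
    hg.pd_comp hS hn h hx, hg.pd_comp hS hn h hx]

theorem continuousOn_curl (hS : IsSurface S) (hn : IsCoorientation S n) (hf : IsSmoothOn S f)
    (hg : IsSmoothOn S g) : ContinuousOn (curl S n f g) S := by
  have h1 := fun i => hf.continuousOn_surfDeriv hS hn (e3 i)
  have h2 := fun i => hg.continuousOn_surfDeriv hS hn (e3 i)
  have h3 : ∀ i : Fin 3, ContinuousOn (fun P => n P i) S := fun i =>
    (EuclideanSpace.proj (𝕜 := ℝ) i).continuous.comp_continuousOn hn.cont
  have h4 : ∀ i j k : Fin 3, ContinuousOn (fun P =>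
      (⟪surfDeriv S n f P (e3 i), surfDeriv S n g P (e3 j)⟫ -
        ⟪surfDeriv S n f P (e3 j), surfDeriv S n g P (e3 i)⟫) * n P k) S := fun i j k =>
    (((h1 i).inner (h2 j)).sub ((h1 j).inner (h2 i))).mul (h3 k)
  exact ((h4 1 2 0).add (h4 2 0 1)).add (h4 0 1 2)

theorem continuous_surfDeriv_comp (hS : IsSurface S) (hn : IsCoorientation S n)
    (hg : IsSmoothOn S g) {γ γ' : ℝ → E3} (hγ : Continuous γ) (hγS : ∀ t, γ t ∈ S)
    (hγ' : Continuous γ') : Continuous fun t => surfDeriv S n g (γ t) (γ' t) := by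
  have h2 : ∀ t, surfDeriv S n g (γ t) (γ' t) = γ' t 0 • surfDeriv S n g (γ t) (e3 0) +
      γ' t 1 • surfDeriv S n g (γ t) (e3 1) + γ' t 2 • surfDeriv S n g (γ t) (e3 2) := fun t =>
    map_e3 (surfDeriv S n g (γ t) : E3 →ₗ[ℝ] E3) (γ' t)
  simp only [h2]
  have h3 : ∀ i : Fin 3, Continuous fun t => γ' t i := fun i =>
    (EuclideanSpace.proj (𝕜 := ℝ) i).continuous.comp hγ'
  have h4 := fun i => (h3 i).smul
    ((hg.continuousOn_surfDeriv hS hn (e3 i)).comp_continuous hγ hγS)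
  exact ((h4 0).add (h4 1)).add (h4 2)

theorem continuous_form_comp (hS : IsSurface S) (hn : IsCoorientation S n) (hf : IsSmoothOn S f)
    (hg : IsSmoothOn S g) {γ γ' : ℝ → E3} (hγ : Continuous γ) (hγS : ∀ t, γ t ∈ S)
    (hγ' : Continuous γ') :
    Continuous fun t => ⟪f (γ t), surfDeriv S n g (γ t) (γ' t)⟫ :=
  ((hf.continuousOn hS).comp_continuous hγ hγS).inner
    (continuous_surfDeriv_comp hS hn hg hγ hγS hγ')

theorem surfDeriv_sum (hS : IsSurface S) (hn : IsCoorientation S n) {ι : Type*} (t : Finset ι)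
    {φ : ι → E3 → E3} (hφ : ∀ i, IsSmoothOn S (φ i)) (hf : IsSmoothOn S f)
    (hsum : ∀ P ∈ S, f P = ∑ i ∈ t, φ i P) {P : E3} (hP : P ∈ S) (w : E3) :
    surfDeriv S n f P w = ∑ i ∈ t, surfDeriv S n (φ i) P w := by
  obtain ⟨D, r, x, h, hx, rfl, -⟩ := hS.exists_patch_point hP
  have h1 : ∀ j, pd D (f ∘ r) j x = ∑ i ∈ t, pd D (φ i ∘ r) j x := fun j => by
    rw [pd_congr (f := f ∘ r) (g := fun y => ∑ i ∈ t, (φ i ∘ r) y) (fun y hy => hsum _ (h.sub ⟨y, hy, rfl⟩)) hx]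
    simp only [pd]
    rw [fderivWithin_fun_sum (h.domain.uniqueDiffOn x hx) fun i _ =>
      ((hφ i D r h).differentiableOn (by simp)) x hx]
    simp
  rw [hf.surfDeriv_eq hS hn h.immersed hx, h1, h1, Finset.smul_sum, Finset.smul_sum,
    ← Finset.sum_add_distrib]
  exact Finset.sum_congr rfl fun i _ => ((hφ i).surfDeriv_eq hS hn h.immersed hx w).symm

theorem curl_sum (hS : IsSurface S) (hn : IsCoorientation S n) {ι : Type*} (t : Finset ι)
    {φ : ι → E3 → E3} (hφ : ∀ i, IsSmoothOn S (φ i)) (hf : IsSmoothOn S f)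
    (hsum : ∀ P ∈ S, f P = ∑ i ∈ t, φ i P) {P : E3} (hP : P ∈ S) :
    curl S n f g P = ∑ i ∈ t, curl S n (φ i) g P := by
  simp only [curl, surfDeriv_sum hS hn t hφ hf hsum hP, sum_inner, Finset.sum_add_distrib,
    ← Finset.sum_mul, Finset.sum_sub_distrib]

theorem surfDeriv_eq_zero_of_eventually (hf0 : ∀ᶠ Q in 𝓝[S] P, f Q = 0) (hP : P ∈ S) (w : E3) :
    surfDeriv S n f P w = 0 := by
  have h1 : f =ᶠ[𝓝[S] P] fun _ => 0 := hf0
  rw [surfDeriv_apply, h1.fderivWithin_eq (h1.self_of_nhdsWithin hP)]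
  simp

theorem curl_eq_zero_of_eventually (hf0 : ∀ᶠ Q in 𝓝[S] P, f Q = 0) (hP : P ∈ S) :
    curl S n f g P = 0 := by
  simp [curl, surfDeriv_eq_zero_of_eventually hf0 hP]

end Forms

/-! ### The boundary in a chart -/

section Chart

/-- A chart of a surface with smooth boundary: a parametrization over a disk of the part of the
surface in a closed set. -/
structure IsDiskChart (S : Set E3) (c : E2) (ρ : ℝ) (r : E2 → E3) (O : Set E3) : Prop where
  pos : 0 < ρ
  closed : IsClosed O
  param : IsRegularParam (Metric.closedBall c ρ) r
  inter_eq : S ∩ O = r '' Metric.closedBall c ρ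

variable {S : Set E3} {n : E3 → E3} {c : E2} {ρ : ℝ} {r : E2 → E3} {O : Set E3}

theorem IsSurfaceWithSmoothBoundary.exists_diskChart (hS : IsSurfaceWithSmoothBoundary S) {P : E3}
    (hP : P ∈ S) : ∃ c ρ r O, IsDiskChart S c ρ r O ∧ P ∈ interior O := by
  obtain ⟨O, hO, hOc, D, r, ⟨c, ρ, hρ, rfl⟩, hr, himg⟩ := hS.2 P hP
  exact ⟨c, ρ, r, O, ⟨hρ, hOc, hr, himg⟩, mem_interior_iff_mem_nhds.2 hO⟩

theorem IsDiskChart.isPatch (h : IsDiskChart S c ρ r O) : IsPatch S (Metric.closedBall c ρ) r :=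
  ⟨Or.inl ⟨c, ρ, h.pos, rfl⟩, h.param, h.inter_eq.symm.le.trans inter_subset_left⟩

theorem IsDiskChart.image_mem_nhdsWithin (h : IsDiskChart S c ρ r O) {P : E3}
    (hP : P ∈ interior O) : r '' Metric.closedBall c ρ ∈ 𝓝[S] P := by
  rw [← h.inter_eq]
  exact inter_mem_nhdsWithin _ (mem_interior_iff_mem_nhds.1 hP)

/-- The squared distance of the parameter from the centre of the disk, as a function on the part of
the surface covered by the chart. It is maximal exactly on the boundary of the surface. -/
def chartRadiusSq (c : E2) (ρ : ℝ) (r : E2 → E3) (P : E3) : ℝ :=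
  ‖Function.invFunOn r (Metric.closedBall c ρ) P - c‖ ^ 2

theorem IsDiskChart.chartRadiusSq_apply (h : IsDiskChart S c ρ r O) {x : E2}
    (hx : x ∈ Metric.closedBall c ρ) : chartRadiusSq c ρ r (r x) = ‖x - c‖ ^ 2 := by
  rw [chartRadiusSq, h.param.inj.leftInvOn_invFunOn hx]

theorem IsDiskChart.hasFDerivWithinAt_chartRadiusSq (h : IsDiskChart S c ρ r O) {x : E2}
    (hx : x ∈ Metric.closedBall c ρ) (hO : r x ∈ interior O) :
    HasFDerivWithinAt (chartRadiusSq c ρ r) (2 • (innerSL ℝ (x - c)).comp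
      (leftInv (pd (Metric.closedBall c ρ) r 0 x) (pd (Metric.closedBall c ρ) r 1 x))) S (r x) := by
  have h1 := ((h.isPatch.hasFDerivWithinAt_invFunOn hx).sub_const c).norm_sq
  rw [h.param.inj.leftInvOn_invFunOn hx] at h1
  exact h1.mono_of_mem_nhdsWithin (h.image_mem_nhdsWithin hO)

theorem IsDiskChart.isLocalMaxOn_chartRadiusSq (h : IsDiskChart S c ρ r O) {x : E2}
    (hx : x ∈ Metric.sphere c ρ) (hO : r x ∈ interior O) :
    IsLocalMaxOn (chartRadiusSq c ρ r) S (r x) := by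
  filter_upwards [h.image_mem_nhdsWithin hO]
  rintro _ ⟨y, hy, rfl⟩
  rw [h.chartRadiusSq_apply hy, h.chartRadiusSq_apply (Metric.sphere_subset_closedBall hx),
    mem_sphere_iff_norm.1 hx]
  exact pow_le_pow_left₀ (norm_nonneg _) (mem_closedBall_iff_norm.1 hy) 2

/-- In a chart, the boundary of the surface corresponds to the boundary of the disk: at a point that
comes from the boundary circle the surface has a tangent vector pointing out of it, but at an inner
point of another chart it has none. -/
theorem IsDiskChart.mem_surfaceBoundary_iff (hn : IsCoorientation S n)
    (h : IsDiskChart S c ρ r O) {x : E2} (hx : x ∈ Metric.closedBall c ρ)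
    (hO : r x ∈ interior O) : r x ∈ surfaceBoundary S ↔ x ∈ Metric.sphere c ρ := by
  have hrS : r x ∈ S := h.isPatch.sub ⟨x, hx, rfl⟩
  constructor
  · rintro ⟨-, hb⟩
    by_contra hxs
    refine hb ⟨O, mem_interior_iff_mem_nhds.1 hO, h.closed, _, r, ⟨c, ρ, h.pos, rfl⟩, h.param,
      h.inter_eq, x, ?_, rfl⟩
    rw [interior_closedBall c h.pos.ne']
    exact lt_of_le_of_ne hx hxs
  · intro hxs
    refine ⟨hrS, ?_⟩
    rintro ⟨O', hO', hOc', D', r', hD', hr', himg, y, hy, hyx⟩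
    have hp' : IsPatch S D' r' := ⟨Or.inl hD', hr', himg.symm.le.trans inter_subset_left⟩
    have hyD := interior_subset hy
    have hφ := h.hasFDerivWithinAt_chartRadiusSq hx hO
    have hmax := h.isLocalMaxOn_chartRadiusSq hxs hO
    rw [← hyx] at hφ hmax
    have hDn : D' ∈ 𝓝 y := mem_interior_iff_mem_nhds.1 hy
    have hmap : MapsTo r' D' S := fun z hz => hp'.sub ⟨z, hz, rfl⟩
    have hr'd := hasFDerivWithinAt_of_contDiffOn hr'.smooth hyD
    have h1 := (hφ.comp y hr'd hmap).hasFDerivAt hDn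
    have h2 : IsLocalMax (chartRadiusSq c ρ r ∘ r') y := by
      have : Filter.Tendsto r' (𝓝 y) (𝓝[S] (r' y)) := tendsto_nhdsWithin_iff.2
        ⟨(hr'd.hasFDerivAt hDn).continuousAt, Filter.mem_of_superset hDn hmap⟩
      exact this.eventually hmax
    -- At an inner point of the second chart the squared radius of the first would have a critical
    -- point.
    have h3 := h2.hasFDerivAt_eq_zero h1
    -- the outward tangent vector in the second chart
    set w := fderivWithin ℝ r (Metric.closedBall c ρ) x (x - c) with hw
    have hwt : ⟪n (r' y), w⟫ = 0 := by
      rw [hyx, hw, fderivWithin_eq_pd, inner_add_right, inner_smul_right, inner_smul_right,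
        h.isPatch.immersed.inner_normal_pd hn hx, h.isPatch.immersed.inner_normal_pd hn hx]
      simp
    have hw' := tangential_part_eq (hn.unit _ (hyx ▸ hrS))
      (hp'.immersed.inner_normal_pd hn hyD 0) (hp'.immersed.inner_normal_pd hn hyD 1)
      (hp'.immersed.nrm_ne_zero hyD) w
    rw [hwt, zero_smul, sub_zero] at hw'
    have h4 : fderivWithin ℝ r' D' y (leftInv (pd D' r' 0 y) (pd D' r' 1 y) w) = w := by
      rw [fderivWithin_eq_pd, leftInv_apply]
      simpa using hw'.symm
    have h5 := DFunLike.congr_fun h3 (leftInv (pd D' r' 0 y) (pd D' r' 1 y) w)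
    simp only [ContinuousLinearMap.comp_apply, h4, smul_apply, zero_apply,
      innerSL_apply_apply] at h5
    rw [hw, h.isPatch.immersed.leftInv_fderivWithin hx, real_inner_self_eq_norm_sq, mem_sphere_iff_norm.1 hxs] at h5
    have := h.pos
    simp at h5
    exact this.ne' h5

theorem IsDiskChart.tangent_eq (hn : IsCoorientation S n)
    (h : IsDiskChart S c ρ r O) {x : E2} (hx : x ∈ Metric.closedBall c ρ) {w : E3}
    (hw : ⟪n (r x), w⟫ = 0) : fderivWithin ℝ r (Metric.closedBall c ρ) x
      (leftInv (pd (Metric.closedBall c ρ) r 0 x) (pd (Metric.closedBall c ρ) r 1 x) w) = w := by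
  have hw' := tangential_part_eq (hn.unit _ (h.isPatch.sub ⟨x, hx, rfl⟩))
    (h.isPatch.immersed.inner_normal_pd hn hx 0) (h.isPatch.immersed.inner_normal_pd hn hx 1)
    (h.isPatch.immersed.nrm_ne_zero hx) w
  rw [hw, zero_smul, sub_zero] at hw'
  rw [fderivWithin_eq_pd, leftInv_apply]
  simpa using hw'.symm

theorem inner_cross_cross_self {m w : E3} (hm : ‖m‖ = 1) (hw : ⟪m, w⟫ = 0) :
    ⟪m, cross w (cross m w)⟫ = ‖w‖ ^ 2 := by
  have h1 : ⟪m, cross w (cross m w)⟫ = ⟪m, m⟫ * ⟪w, w⟫ - ⟪m, w⟫ ^ 2 := by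
    simp only [inner_e3, cross_apply_zero, cross_apply_one, cross_apply_two]
    ring
  rw [h1, hw, real_inner_self_eq_norm_sq, real_inner_self_eq_norm_sq, hm]
  ring

theorem cross_fderivWithin (D : Set E2) (r : E2 → E3) (x ξ η : E2) :
    cross (fderivWithin ℝ r D x ξ) (fderivWithin ℝ r D x η) =
      (ξ 0 * η 1 - ξ 1 * η 0) • nrm D r x := by
  rw [fderivWithin_eq_pd, fderivWithin_eq_pd, nrm]
  apply ext_e3 <;> simp <;> ring

/-- The boundary curves run counterclockwise around the disk of a positively oriented chart (`s = 1`)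
and clockwise around that of a negatively oriented one (`s = -1`). -/
theorem IsDiskChart.deriv_eq (hn : IsCoorientation S n)
    (h : IsDiskChart S c ρ r O) {s : ℝ} (hs : s = 1 ∨ s = -1)
    (hsn : ∀ x ∈ Metric.closedBall c ρ, ⟪n (r x), nrm (Metric.closedBall c ρ) r x⟫ =
      s * ‖nrm (Metric.closedBall c ρ) r x‖)
    {γ : ℝ → E3} (hγb : ∀ t, γ t ∈ surfaceBoundary S) {t : ℝ} {γ' : E3} (hγ : HasDerivAt γ γ' t)
    (hγ0 : γ' ≠ 0) (hpos : cross (n (γ t)) γ' ∈ tangentConeAt ℝ≥0 S (γ t)) {θ : ℝ}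
    (hθ : r (c + ρ • dir θ) = γ t) (hO : γ t ∈ interior O) :
    ∃ μ : ℝ, 0 < μ ∧ s • fderivWithin ℝ r (Metric.closedBall c ρ) (c + ρ • dir θ)
      (ρ • dirPerp θ) = μ • γ' := by
  set D := Metric.closedBall c ρ with hD
  set x := c + ρ • dir θ with hx
  have hxs : x ∈ Metric.sphere c ρ := by
    rw [mem_sphere_iff_norm, hx, add_sub_cancel_left, norm_smul, norm_dir, mul_one,
      Real.norm_eq_abs, abs_of_pos h.pos]
  have hxD : x ∈ D := Metric.sphere_subset_closedBall hxs
  rw [← hθ] at hO hpos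
  have hγS : ∀ t, γ t ∈ S := fun t => (hγb t).1
  have hPS : r x ∈ S := hθ ▸ hγS t
  have hφ := h.hasFDerivWithinAt_chartRadiusSq hxD hO
  set L := leftInv (pd D r 0 x) (pd D r 1 x) with hL
  have hxc : x - c = ρ • dir θ := by rw [hx, add_sub_cancel_left]
  have hγn : ⟪n (r x), γ'⟫ = 0 := by
    have h1 := fderivWithin_mem_tangentPlane (S := S) (T := univ)
      hγ.hasFDerivAt.hasFDerivWithinAt uniqueDiffWithinAt_univ (fun t _ => hγS t) 1
    rw [hθ]
    exact hn.normal _ (hγS t) _ (by simpa using h1)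
  have hdξ := h.tangent_eq hn hxD hγn
  have hcn : ⟪n (r x), cross (n (r x)) γ'⟫ = 0 := inner_cross_left _ _
  have hdη := h.tangent_eq hn hxD hcn
  rw [← hD, ← hL] at hdξ hdη
  set ξ := L γ' with hξ
  set η := L (cross (n (r x)) γ') with hη
  -- the curve stays on the boundary circle
  have hξ0 : ⟪dir θ, ξ⟫ = 0 := by
    have h1 : HasDerivAt (chartRadiusSq c ρ r ∘ γ) ((2 • (innerSL ℝ (x - c)).comp L) γ') t := by
      rw [hθ] at hφ
      exact hφ.comp_hasDerivAt t hγ (Filter.Eventually.of_forall hγS)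
    have h2 : chartRadiusSq c ρ r ∘ γ =ᶠ[𝓝 t] fun _ => ρ ^ 2 := by
      have hev : ∀ᶠ t' in 𝓝 t, γ t' ∈ interior O :=
        hγ.continuousAt.eventually (isOpen_interior.mem_nhds (hθ ▸ hO))
      filter_upwards [hev] with t' ht'
      have h3 : γ t' ∈ S ∩ O := ⟨hγS t', interior_subset ht'⟩
      rw [h.inter_eq] at h3
      obtain ⟨y, hy, hyt⟩ := h3
      have h4 := (h.mem_surfaceBoundary_iff hn hy (hyt ▸ ht')).1 (hyt ▸ hγb t')
      rw [Function.comp_apply, ← hyt, h.chartRadiusSq_apply hy, mem_sphere_iff_norm.1 h4]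
    have h3 := (h1.congr_of_eventuallyEq h2.symm).unique (hasDerivAt_const t (ρ ^ 2))
    simp only [smul_apply, ContinuousLinearMap.comp_apply, ← hξ,
      innerSL_apply_apply, hxc, inner_smul_left, conj_trivial] at h3
    simpa [h.pos.ne'] using h3
  -- The vector `n × γ'` points into the disk.
  have hη0 : ⟪dir θ, η⟫ ≤ 0 := by
    have h1 := (h.isLocalMaxOn_chartRadiusSq hxs hO).hasFDerivWithinAt_nonpos hφ hpos
    simp only [smul_apply, ContinuousLinearMap.comp_apply, ← hη,
      innerSL_apply_apply, hxc, inner_smul_left, conj_trivial] at h1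
    have := h.pos
    simp only [nsmul_eq_mul, Nat.cast_ofNat] at h1
    by_contra! hcon
    have : 0 < 2 * (ρ * ⟪dir θ, η⟫) := by positivity
    linarith
  have hin : ∀ v : E2, ⟪dir θ, v⟫ = Real.cos θ * v 0 + Real.sin θ * v 1 := fun v => by
    rw [PiLp.inner_apply]
    simp [mul_comm]
  rw [hin] at hξ0 hη0
  set l := -Real.sin θ * ξ 0 + Real.cos θ * ξ 1 with hl
  have hcs := Real.sin_sq_add_cos_sq θ
  have e0 : ξ 0 = -l * Real.sin θ := by
    rw [hl]; linear_combination (-ξ 0) * hcs + Real.cos θ * hξ0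
  have e1 : ξ 1 = l * Real.cos θ := by
    rw [hl]; linear_combination (-ξ 1) * hcs + Real.sin θ * hξ0
  have hξl : ξ = l • dirPerp θ := by
    ext i; fin_cases i
    · simp [e0]
    · simp [e1]
  -- the sign of `l`
  have hsl : 0 < s * l := by
    have h1 := inner_cross_cross_self (hn.unit _ hPS) hγn
    have h2 := cross_fderivWithin D r x ξ η
    rw [hdξ, hdη] at h2
    rw [h2, inner_smul_right, hsn x hxD, e0, e1] at h1
    have h3 : 0 < ‖γ'‖ ^ 2 := by have := norm_pos_iff.2 hγ0; positivity
    have h4 : 0 < ‖nrm D r x‖ := norm_pos_iff.2 (h.isPatch.immersed.nrm_ne_zero hxD)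
    rw [← h1] at h3
    have h5 : (-l * Real.sin θ * η 1 - l * Real.cos θ * η 0) * (s * ‖nrm D r x‖) =
        (s * l) * (-(Real.cos θ * η 0 + Real.sin θ * η 1) * ‖nrm D r x‖) := by ring
    rw [h5] at h3
    exact pos_of_mul_pos_left h3 (mul_nonneg (by linarith) h4.le)
  have hss : s * s = 1 := by rcases hs with rfl | rfl <;> norm_num
  refine ⟨ρ / (s * l), div_pos h.pos hsl, ?_⟩
  rw [← hdξ, hξl, ← map_smul, ← map_smul, smul_smul, smul_smul]
  congr 2
  have hl0 : l ≠ 0 := fun h0 => by rw [h0, mul_zero] at hsl; exact lt_irrefl _ hsl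
  have hs0 : s ≠ 0 := fun h0 => by rw [h0, zero_mul] at hsl; exact lt_irrefl _ hsl
  field_simp
  linear_combination ρ * hss

end Chart

/-! ### Line integrals -/

section Curves

theorem volFactor_toSpanSingleton (v : E3) :
    volFactor (ContinuousLinearMap.toSpanSingleton ℝ v) = ‖v‖ := by
  rw [volFactor_eq_sqrt _ (OrthonormalBasis.singleton (Fin 1) ℝ), Matrix.det_unique,
    Matrix.gram_apply]
  simp

/-- Change of variables for the length measure of a curve. -/
theorem integral_curve {γ γ' : ℝ → E3} {a b : ℝ}
    (hγ : ∀ t ∈ Icc a b, HasDerivWithinAt γ (γ' t) (Icc a b) t) (hc : ContinuousOn γ' (Icc a b))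
    {s : Set ℝ} (hs : MeasurableSet s) (hsD : s ⊆ Icc a b) (hinj : InjOn γ s)
    (h0 : ∀ t ∈ s, γ' t ≠ 0) (Φ : E3 → ℝ) :
    MeasurableSet (γ '' s) ∧ ∫ P in γ '' s, Φ P ∂μHE[1] = ∫ t in s, ‖γ' t‖ * Φ (γ t) ∧
      (IntegrableOn Φ (γ '' s) μHE[1] ↔ IntegrableOn (fun t => ‖γ' t‖ * Φ (γ t)) s) := by
  have h : HasC1DerivOn γ (fun t => ContinuousLinearMap.toSpanSingleton ℝ (γ' t)) (Icc a b) :=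
    ⟨convex_Icc a b, fun t ht => (hγ t ht).hasFDerivWithinAt,
      (LinearMap.continuous_of_finiteDimensional
        (ContinuousLinearMap.toSpanSingletonLE ℝ ℝ E3).toLinearMap).comp_continuousOn hc⟩
  have himm : ∀ t ∈ s, Function.Injective (ContinuousLinearMap.toSpanSingleton ℝ (γ' t)) :=
    fun t ht x y hxy => smul_left_injective ℝ (h0 t ht) hxy
  have h1 := h.integral_image hs hsD hinj himm Φ
  have h2 := h.integrableOn_image_iff hs hsD hinj himm Φ
  simp only [volFactor_toSpanSingleton, Module.finrank_self] at h1 h2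
  exact ⟨h.measurableSet_image hs hsD hinj, h1, h2⟩

end Curves

/-! ### Stokes' formula -/

section Stokes

variable {S : Set E3} {n f g : E3 → E3} {m : ℕ} {γ : Fin m → ℝ → E3}

theorem IsBoundaryParam.mem_boundary (hγ : IsBoundaryParam S n γ) (i : Fin m) (t : ℝ) :
    γ i t ∈ surfaceBoundary S := by
  rw [← hγ.cover]
  exact mem_iUnion.2 ⟨i, t, rfl⟩

theorem IsBoundaryParam.mem (hγ : IsBoundaryParam S n γ) (i : Fin m) (t : ℝ) : γ i t ∈ S :=
  (hγ.mem_boundary i t).1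

theorem IsBoundaryParam.hasDerivAt (hγ : IsBoundaryParam S n γ) (i : Fin m) (t : ℝ) :
    HasDerivAt (γ i) (deriv (γ i) t) t :=
  ((hγ.smooth i).differentiable (by simp) t).hasDerivAt

theorem IsBoundaryParam.continuous_deriv (hγ : IsBoundaryParam S n γ) (i : Fin m) :
    Continuous (deriv (γ i)) := (hγ.smooth i).continuous_deriv (by simp)

theorem IsBoundaryParam.surfaceBoundary_eq (hγ : IsBoundaryParam S n γ) :
    surfaceBoundary S = ⋃ i, γ i '' Ico 0 1 := by
  rw [← hγ.cover]
  congr 1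
  ext1 i
  refine subset_antisymm ?_ (image_subset_range _ _)
  rintro _ ⟨t, rfl⟩
  obtain ⟨u, hu, he⟩ := Function.Periodic.exists_mem_Ico₀ (hγ.closed i) one_pos t
  exact ⟨u, hu, he.symm⟩

theorem IsBoundaryParam.eq_of_eq (hγ : IsBoundaryParam S n γ) {i j : Fin m} {t u : ℝ}
    (ht : t ∈ Ico (0 : ℝ) 1) (hu : u ∈ Ico (0 : ℝ) 1) (h : γ i t = γ j u) : i = j ∧ t = u := by
  by_cases hij : i = j
  · subst hij
    exact ⟨rfl, hγ.simple i ht hu h⟩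
  · exact absurd h fun h => Set.disjoint_left.1 (hγ.disj hij) ⟨t, rfl⟩ ⟨u, h.symm⟩

/-- The value of a 1-form `α` on the positive unit tangent vector of the boundary. -/
theorem IsBoundaryParam.exists_boundary_density (hγ : IsBoundaryParam S n γ)
    (α : E3 → E3 →L[ℝ] ℝ) : ∃ Φ : E3 → ℝ, ∀ i, ∀ t ∈ Ico (0 : ℝ) 1,
      ‖deriv (γ i) t‖ * Φ (γ i t) = α (γ i t) (deriv (γ i) t) := by
  classical
  refine ⟨fun P => if h : ∃ q : Fin m × ℝ, q.2 ∈ Ico (0 : ℝ) 1 ∧ γ q.1 q.2 = P then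
    ‖deriv (γ h.choose.1) h.choose.2‖⁻¹ * α P (deriv (γ h.choose.1) h.choose.2) else 0,
    fun i t ht => ?_⟩
  have hex : ∃ q : Fin m × ℝ, q.2 ∈ Ico (0 : ℝ) 1 ∧ γ q.1 q.2 = γ i t := ⟨(i, t), ht, rfl⟩
  obtain ⟨e1, e2⟩ := hγ.eq_of_eq hex.choose_spec.1 ht hex.choose_spec.2
  beta_reduce
  rw [dif_pos hex, e1, e2, mul_inv_cancel_left₀ (norm_ne_zero_iff.2 (hγ.regular i t))]

/-- A 1-form supported in a chart has the same integral over the boundary circle of the disk, with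
the sign `s` of the chart, as over the boundary curves. -/
theorem IsDiskChart.integral_boundary (hS : IsSurface S) (hn : IsCoorientation S n)
    (hγ : IsBoundaryParam S n γ) (hf : IsSmoothOn S f) (hg : IsSmoothOn S g) {c : E2} {ρ : ℝ}
    {r : E2 → E3} {O : Set E3} (h : IsDiskChart S c ρ r O) {s : ℝ} (hs : s = 1 ∨ s = -1)
    (hsn : ∀ x ∈ Metric.closedBall c ρ, ⟪n (r x), nrm (Metric.closedBall c ρ) r x⟫ =
      s * ‖nrm (Metric.closedBall c ρ) r x‖)
    {K : Set E3} (hK : IsClosed K) (hKO : K ⊆ interior O) (hfK : ∀ P ∈ S, P ∉ K → f P = 0) :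
    s * ∫ θ in Icc (-Real.pi) Real.pi, ⟪f (r (c + ρ • dir θ)),
      fderivWithin ℝ (g ∘ r) (Metric.closedBall c ρ) (c + ρ • dir θ) (ρ • dirPerp θ)⟫ =
    ∑ i, ∫ t in Icc (0 : ℝ) 1, ⟪f (γ i t), surfDeriv S n g (γ i t) (deriv (γ i) t)⟫ := by
  set D := Metric.closedBall c ρ with hD
  obtain ⟨Φ, hΦ⟩ := hγ.exists_boundary_density
    fun P => (innerSL ℝ (f P)).comp (surfDeriv S n g P)
  simp only [ContinuousLinearMap.comp_apply, innerSL_apply_apply] at hΦ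
  -- the boundary circle of the chart
  set x : ℝ → E2 := fun θ => c + ρ • dir θ with hx
  set C : ℝ → E3 := fun θ => r (x θ) with hC
  set C' : ℝ → E3 := fun θ => fderivWithin ℝ r D (x θ) (ρ • dirPerp θ) with hC'
  have hxs : ∀ θ, x θ ∈ Metric.sphere c ρ := fun θ => by
    rw [mem_sphere_iff_norm, hx, add_sub_cancel_left, norm_smul, norm_dir, mul_one,
      Real.norm_eq_abs, abs_of_pos h.pos]
  have hxD : ∀ θ, x θ ∈ D := fun θ => Metric.sphere_subset_closedBall (hxs θ)
  have hCS : ∀ θ, C θ ∈ S := fun θ => h.isPatch.sub ⟨x θ, hxD θ, rfl⟩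
  have hxd : ∀ θ, HasDerivAt x (ρ • dirPerp θ) θ := fun θ =>
    ((hasDerivAt_dir θ).const_smul ρ).const_add c
  have hCd : ∀ θ, HasDerivAt C (C' θ) θ := fun θ =>
    (hasFDerivWithinAt_of_contDiffOn h.param.smooth (hxD θ)).comp_hasDerivAt θ (hxd θ)
      (Filter.Eventually.of_forall hxD)
  have hxc : Continuous x := continuous_iff_continuousAt.2 fun θ => (hxd θ).continuousAt
  have hpc : Continuous dirPerp := by unfold dirPerp; fun_prop
  have hCc : Continuous C := continuous_iff_continuousAt.2 fun θ => (hCd θ).continuousAt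
  have hC'c : Continuous C' :=
    ((h.param.smooth.continuousOn_fderivWithin h.isPatch.domain.uniqueDiffOn
      (by simp)).comp_continuous hxc hxD).clm_apply (hpc.const_smul ρ)
  have hC'0 : ∀ θ, C' θ ≠ 0 := fun θ h0 => by
    have h1 := h.param.regular (x θ) (hxD θ) (h0.trans (map_zero _).symm)
    have h2 : dirPerp θ = 0 := (smul_eq_zero.1 h1).resolve_left h.pos.ne'
    have h3 := congrFun (congrArg WithLp.ofLp h2) 0
    have h4 := congrFun (congrArg WithLp.ofLp h2) 1
    simp at h3 h4
    have := Real.sin_sq_add_cos_sq θ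
    rw [h3, h4] at this
    norm_num at this
  have hCinj : InjOn C (Ioc (-Real.pi) Real.pi) := by
    intro θ hθ θ' hθ' he
    have h1 := h.param.inj (hxD θ) (hxD θ') he
    have h2 : dir θ = dir θ' := smul_right_injective E2 h.pos.ne' (add_left_cancel h1)
    have h3 := congrFun (congrArg WithLp.ofLp h2) 0
    have h4 := congrFun (congrArg WithLp.ofLp h2) 1
    simp only [dir_zero, dir_one] at h3 h4
    have h5 := (Real.Angle.cos_sin_inj h3 h4)
    rw [← Real.Angle.toReal_coe_eq_self_iff_mem_Ioc.2 hθ,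
      ← Real.Angle.toReal_coe_eq_self_iff_mem_Ioc.2 hθ', h5]
  have hint : ∀ θ, fderivWithin ℝ (g ∘ r) D (x θ) (ρ • dirPerp θ) =
      surfDeriv S n g (C θ) (C' θ) := fun θ => by
    have h1 := hg.hasFDerivWithinAt_comp hS hn (hxD θ)
      (hasFDerivWithinAt_of_contDiffOn h.param.smooth (hxD θ))
      (h.isPatch.domain.uniqueDiffOn _ (hxD θ)) h.isPatch.immersed.mapsTo
    rw [h1.fderivWithin (h.isPatch.domain.uniqueDiffOn _ (hxD θ))]
    rfl
  set Θ : Set ℝ := Ioc (-Real.pi) Real.pi ∩ C ⁻¹' K with hΘ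
  set T : Fin m → Set ℝ := fun i => Ico 0 1 ∩ γ i ⁻¹' K with hT
  have hΘm : MeasurableSet Θ := measurableSet_Ioc.inter (hK.preimage hCc).measurableSet
  have hTm : ∀ i, MeasurableSet (T i) := fun i =>
    measurableSet_Ico.inter (hK.preimage (hγ.smooth i).continuous).measurableSet
  -- the two parametrizations of the boundary within `K`
  have hbd : ∀ θ, C θ ∈ K → ∃ i, ∃ t ∈ T i, γ i t = C θ := fun θ hθ => by
    have h1 := (h.mem_surfaceBoundary_iff hn (hxD θ) (hKO hθ)).2 (hxs θ)
    rw [hγ.surfaceBoundary_eq] at h1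
    obtain ⟨i, t, ht, hti⟩ := mem_iUnion.1 h1
    exact ⟨i, t, ⟨ht, by rw [mem_preimage, hti]; exact hθ⟩, hti⟩
  have himg : C '' Θ = ⋃ i, γ i '' T i := by
    ext P
    simp only [mem_iUnion]
    constructor
    · rintro ⟨θ, hθ, rfl⟩
      obtain ⟨i, t, ht, hti⟩ := hbd θ hθ.2
      exact ⟨i, t, ht, hti⟩
    · rintro ⟨i, t, ht, rfl⟩
      have h1 : γ i t ∈ S ∩ O := ⟨hγ.mem i t, interior_subset (hKO ht.2)⟩
      rw [h.inter_eq] at h1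
      obtain ⟨y, hy, hyt⟩ := h1
      have h2 := (h.mem_surfaceBoundary_iff hn hy (hyt ▸ hKO ht.2)).1 (hyt ▸ hγ.mem_boundary i t)
      obtain ⟨θ, hθ, hyθ⟩ : ∃ θ ∈ Ioc (-Real.pi) Real.pi, y = x θ := by
        have h3 : ‖y - c‖ = ρ := mem_sphere_iff_norm.1 h2
        have h4 := h.pos
        set z : ℂ := ⟨(y - c) 0, (y - c) 1⟩ with hz
        have hzn : ‖z‖ = ρ := by
          rw [← h3, EuclideanSpace.norm_eq, Complex.norm_def, Complex.normSq_apply, hz]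
          simp [sq]
        refine ⟨Complex.arg z, Complex.arg_mem_Ioc z, ?_⟩
        have h5 := Complex.norm_mul_cos_arg z
        have h6 := Complex.norm_mul_sin_arg z
        rw [hzn] at h5 h6
        simp only [hz, PiLp.sub_apply] at h5 h6
        ext i; fin_cases i
        · simp [hx, hz, h5]
        · simp [hx, hz, h6]
      exact ⟨θ, ⟨hθ, by rw [mem_preimage]; show r (x θ) ∈ K; rw [← hyθ, hyt]; exact ht.2⟩,
        by show r (x θ) = _; rw [← hyθ, hyt]⟩
  -- Both parametrizations are compared through the density `Φ` with respect to length on the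
  -- common image.
  have hdens : ∀ θ ∈ Θ, s * ⟪f (C θ), surfDeriv S n g (C θ) (C' θ)⟫ = ‖C' θ‖ * Φ (C θ) := by
    intro θ hθ
    obtain ⟨i, t, ht, hti⟩ := hbd θ hθ.2
    obtain ⟨μ, hμ, hμe⟩ := h.deriv_eq hn hs hsn (hγ.mem_boundary i) (hγ.hasDerivAt i t)
      (hγ.regular i t) (hγ.positive i t) hti.symm (hti ▸ hKO hθ.2)
    change s • C' θ = _ at hμe
    have h1 := congrArg (fun w => ‖w‖) hμe
    have hs1 : ‖s‖ = 1 := by rcases hs with rfl | rfl <;> simp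
    simp only [norm_smul, hs1, one_mul, Real.norm_eq_abs, abs_of_pos hμ] at h1
    rw [h1, ← inner_smul_right, ← map_smul, hμe, map_smul, inner_smul_right, ← hti, mul_assoc,
      hΦ i t ht.1]
  have hC1 := integral_curve (a := -Real.pi) (b := Real.pi)
    (fun θ _ => (hCd θ).hasDerivWithinAt) hC'c.continuousOn hΘm
    (inter_subset_left.trans Ioc_subset_Icc_self) (hCinj.mono inter_subset_left)
    (fun θ _ => hC'0 θ) Φ
  have hγ1 := fun i => integral_curve (a := 0) (b := 1)
    (fun t _ => (hγ.hasDerivAt i t).hasDerivWithinAt) (hγ.continuous_deriv i).continuousOn (hTm i)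
    (inter_subset_left.trans Ico_subset_Icc_self) ((hγ.simple i).mono inter_subset_left)
    (fun t _ => hγ.regular i t) Φ
  have hfc := fun i => continuous_form_comp hS hn hf hg (hγ.smooth i).continuous (hγ.mem i)
    (hγ.continuous_deriv i)
  have hdisj : Pairwise (Function.onFun Disjoint fun i => γ i '' T i) := fun i j hij =>
    (hγ.disj hij).mono (image_subset_range _ _) (image_subset_range _ _)
  have hTI : ∀ i, IntegrableOn Φ (γ i '' T i) μHE[1] := fun i => by
    rw [(hγ1 i).2.2]
    refine IntegrableOn.congr_fun ((hfc i).integrableOn_Icc.mono_set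
      (inter_subset_left.trans Ico_subset_Icc_self)) (fun t ht => (hΦ i t ht.1).symm) (hTm i)
  calc _ = ∫ θ in Θ, ‖C' θ‖ * Φ (C θ) := by
        rw [← integral_const_mul, integral_Icc_eq_integral_Ioc,
          ← setIntegral_congr_fun hΘm hdens]
        have h1 : ∀ θ, s * ⟪f (r (c + ρ • dir θ)), fderivWithin ℝ (g ∘ r) D (c + ρ • dir θ)
            (ρ • dirPerp θ)⟫ = s * ⟪f (C θ), surfDeriv S n g (C θ) (C' θ)⟫ := fun θ => by
          rw [← hint]
        simp only [h1]
        refine setIntegral_eq_of_subset_of_forall_sdiff_eq_zero measurableSet_Ioc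
          inter_subset_left fun θ hθ => ?_
        rw [hfK _ (hCS θ) fun hk => hθ.2 ⟨hθ.1, hk⟩, inner_zero_left, mul_zero]
    _ = ∑ i, ∫ P in γ i '' T i, Φ P ∂μHE[1] := by
        rw [← hC1.2.1, himg, integral_iUnion_fintype (fun i => (hγ1 i).1) hdisj hTI]
    _ = _ := by
        refine Finset.sum_congr rfl fun i _ => ?_
        rw [(hγ1 i).2.1, integral_Icc_eq_integral_Ico, setIntegral_congr_fun (hTm i)
          fun t ht => hΦ i t ht.1]
        symm
        refine setIntegral_eq_of_subset_of_forall_sdiff_eq_zero measurableSet_Ico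
          inter_subset_left fun t ht => ?_
        rw [hfK _ (hγ.mem i t) fun hk => ht.2 ⟨ht.1, hk⟩, inner_zero_left]

/-- Stokes' formula for a form supported in a chart. -/
theorem IsDiskChart.stokes (hS : IsSurface S) (hn : IsCoorientation S n)
    (hγ : IsBoundaryParam S n γ) (hf : IsSmoothOn S f) (hg : IsSmoothOn S g) {c : E2} {ρ : ℝ}
    {r : E2 → E3} {O : Set E3} (h : IsDiskChart S c ρ r O)
    {K : Set E3} (hK : IsClosed K) (hKO : K ⊆ interior O) (hfK : ∀ P ∈ S, P ∉ K → f P = 0) :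
    ∫ P in S, curl S n f g P ∂μHE[2] =
    ∑ i, ∫ t in Icc (0 : ℝ) 1, ⟪f (γ i t), surfDeriv S n g (γ i t) (deriv (γ i) t)⟫ := by
  have hp := h.isPatch
  obtain ⟨s, hs, hsn⟩ := hp.immersed.exists_sign hn
  have hss : s * s = 1 := by rcases hs with rfl | rfl <;> norm_num
  rw [← h.integral_boundary hS hn hγ hf hg hs hsn hK hKO hfK]
  have h1 := green_closedBall h.pos (hf _ _ hp) (hg _ _ hp)
  simp only [Function.comp_apply] at h1
  change _ = s * ∫ θ in Icc (-Real.pi) Real.pi, ⟪f (r (c + ρ • dir θ)),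
      fderivWithin ℝ (g ∘ r) (Metric.closedBall c ρ) (c + ρ • dir θ) (ρ • dirPerp θ)⟫
  rw [← h1, ← integral_const_mul, setIntegral_eq_of_subset_of_forall_sdiff_eq_zero
    hS.measurableSet hp.sub, hp.integral_image hp.domain.measurableSet subset_rfl]
  · refine setIntegral_congr_fun hp.domain.measurableSet fun x hx => ?_
    change _ = s * (⟪pd _ (f ∘ r) 0 x, pd _ (g ∘ r) 1 x⟫ - ⟪pd _ (f ∘ r) 1 x, pd _ (g ∘ r) 0 x⟫)
    rw [← hp.immersed.curl_mul hS hn hf hg hx, hsn x hx]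
    linear_combination (-‖nrm (Metric.closedBall c ρ) r x‖ * curl S n f g (r x)) * hss
  · rintro P ⟨hPS, hP⟩
    refine curl_eq_zero_of_eventually ?_ hPS
    have hPK : P ∉ K := fun hk => hP (h.inter_eq ▸ ⟨hPS, interior_subset (hKO hk)⟩)
    filter_upwards [self_mem_nhdsWithin, mem_nhdsWithin_of_mem_nhds (hK.isOpen_compl.mem_nhds hPK)]
      with Q hQ hQK using hfK Q hQ hQK

/-- **Stokes' formula** on a surface with smooth boundary. -/
theorem stokes (hS : IsSurfaceWithSmoothBoundary S) (hn : IsCoorientation S n)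
    (hγ : IsBoundaryParam S n γ) (hf : IsSmoothOn S f) (hg : IsSmoothOn S g) :
    ∫ P in S, curl S n f g P ∂μHE[2] =
    ∑ i, ∫ t in Icc (0 : ℝ) 1, ⟪f (γ i t), surfDeriv S n g (γ i t) (deriv (γ i) t)⟫ := by
  have hS' := hS.isSurface
  choose! c ρ r O hch hO using fun P (hP : P ∈ S) => hS.exists_diskChart hP
  obtain ⟨t, htS, hcov⟩ := hS.1.elim_nhds_subcover (fun P => interior (O P))
    fun P hP => isOpen_interior.mem_nhds (hO P hP)
  -- A partition of unity cuts the form into forms supported in charts.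
  obtain ⟨χ, hχ⟩ := SmoothPartitionOfUnity.exists_isSubordinate (modelWithCornersSelf ℝ E3)
    hS'.1.isClosed (fun P : t => interior (O P)) (fun P => isOpen_interior)
    (fun P hP => by simpa using hcov hP)
  have hχs : ∀ P, ContDiff ℝ ∞ (χ P) := fun P => (χ P).contMDiff.contDiff
  have hφ : ∀ P, IsSmoothOn S fun Q => χ P Q • f Q := fun P =>
    (isSmoothOn_of_contDiff (hχs P) S).smul hf
  have hsum : ∀ Q ∈ S, f Q = ∑ P : t, χ P Q • f Q := fun Q hQ => by
    rw [← Finset.sum_smul, ← finsum_eq_sum_of_fintype, χ.sum_eq_one hQ, one_smul]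
  rw [setIntegral_congr_fun hS'.measurableSet fun Q hQ =>
    curl_sum hS' hn Finset.univ hφ hf hsum hQ, integral_finsetSum]
  swap
  · exact fun P _ => hS'.integrableOn (continuousOn_curl hS' hn (hφ P) hg)
  have h1 : ∀ P : t, ∫ Q in S, curl S n (fun Q => χ P Q • f Q) g Q ∂μHE[2] = _ := fun P =>
    (hch P (htS P P.2)).stokes hS' hn hγ (hφ P) hg (isClosed_tsupport (χ P)) (hχ P)
      fun Q _ hQ => by rw [image_eq_zero_of_notMem_tsupport hQ, zero_smul]
  simp only [h1]
  rw [Finset.sum_comm]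
  refine Finset.sum_congr rfl fun i _ => ?_
  rw [← integral_finsetSum]
  · refine integral_congr_ae (Filter.Eventually.of_forall fun u => ?_)
    simp only
    rw [← sum_inner, ← hsum _ (hγ.mem i u)]
  · exact fun P _ => (continuous_form_comp hS' hn (hφ P) hg (hγ.smooth i).continuous (hγ.mem i)
      (hγ.continuous_deriv i)).integrableOn_Icc

end Stokes

/-! ### Parallel transport along a curve -/

section FrameAlgebra

variable {m b : E3} (hm : ‖m‖ = 1) (hb : ‖b‖ = 1) (hmb : ⟪m, b⟫ = 0)
include hm hb hmb

theorem norm_cross_frame : ⟪cross m b, cross m b⟫ = 1 := by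
  rw [inner_cross_cross, real_inner_self_eq_norm_sq, real_inner_self_eq_norm_sq, hm, hb, hmb]
  norm_num

/-- Expansion in the orthonormal frame `m`, `b`, `m × b`. -/
theorem frame_decomposition (w : E3) :
    w = ⟪m, w⟫ • m + ⟪b, w⟫ • b + ⟪cross m b, w⟫ • cross m b := by
  have h := cross_decomposition m b w
  rw [norm_cross_frame hm hb hmb, inner_cross_cross, inner_cross_cross, real_inner_comm m b,
    real_inner_self_eq_norm_sq, real_inner_self_eq_norm_sq, hm, hb, hmb] at h
  rw [real_inner_comm w m, real_inner_comm w b, real_inner_comm w]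
  simpa using h

theorem cross_cross_frame : cross m (cross m b) = -b := by
  have h : cross m (cross m b) = ⟪m, b⟫ • m - ⟪m, m⟫ • b := by
    apply ext_e3 <;> simp only [inner_e3, cross_apply_zero, cross_apply_one, cross_apply_two,
      PiLp.sub_apply, PiLp.smul_apply, smul_eq_mul] <;> ring
  rw [h, hmb, real_inner_self_eq_norm_sq, hm]
  simp

theorem cross_frame_right : cross b (cross m b) = m := by
  have h : cross b (cross m b) = ⟪b, b⟫ • m - ⟪m, b⟫ • b := by
    apply ext_e3 <;> simp only [inner_e3, cross_apply_zero, cross_apply_one, cross_apply_two,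
      PiLp.sub_apply, PiLp.smul_apply, smul_eq_mul] <;> ring
  rw [h, hmb, real_inner_self_eq_norm_sq, hb]
  simp

/-- Composition of rotations of the plane perpendicular to `m`. -/
theorem rotate_add (φ α : ℝ) :
    Real.cos φ • (Real.cos α • b + Real.sin α • cross m b) +
      Real.sin φ • cross m (Real.cos α • b + Real.sin α • cross m b) =
    Real.cos (φ + α) • b + Real.sin (φ + α) • cross m b := by
  rw [cross_add_right, cross_smul_right, cross_smul_right, cross_cross_frame hm hb hmb,
    Real.cos_add, Real.sin_add]
  module

/-- Polar coordinates in the plane perpendicular to `m`. -/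
theorem exists_angle {w : E3} (hw : ⟪m, w⟫ = 0) :
    ∃ φ ∈ Ioc (-Real.pi) Real.pi,
      w = ‖w‖ • (Real.cos φ • b + Real.sin φ • cross m b) := by
  set z : ℂ := ⟨⟪b, w⟫, ⟪cross m b, w⟫⟩ with hz
  have hd := frame_decomposition hm hb hmb w
  rw [hw, zero_smul, zero_add] at hd
  have hzn : ‖z‖ = ‖w‖ := by
    have h1 : ‖w‖ ^ 2 = ⟪b, w⟫ ^ 2 + ⟪cross m b, w⟫ ^ 2 := by
      conv_lhs => rw [← real_inner_self_eq_norm_sq, hd]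
      simp only [inner_add_left, inner_add_right, inner_smul_left, inner_smul_right, conj_trivial,
        norm_cross_frame hm hb hmb, inner_cross_right, real_inner_comm b (cross m b),
        real_inner_self_eq_norm_sq b, hb]
      ring
    rw [Complex.norm_def, Complex.normSq_apply, ← Real.sqrt_sq (norm_nonneg w), h1, hz]
    simp only [sq]
  refine ⟨z.arg, Complex.arg_mem_Ioc z, ?_⟩
  have h5 := Complex.norm_mul_cos_arg z
  have h6 := Complex.norm_mul_sin_arg z
  rw [hzn] at h5 h6
  rw [smul_add, smul_smul, smul_smul, h5, h6, hz]
  exact hd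

end FrameAlgebra

section Transport

variable {S : Set E3} {n : E3 → E3} {γ B B' v : ℝ → E3}

/-- A differentiable field `B` of unit tangent vectors along a curve on a cooriented surface. -/
structure IsFrameAlong (S : Set E3) (n : E3 → E3) (γ B B' : ℝ → E3) : Prop where
  mem : ∀ t, γ t ∈ S
  normal : Differentiable ℝ (n ∘ γ)
  deriv : ∀ t, HasDerivAt B (B' t) t
  cont : Continuous B'
  unit : ∀ t, ‖B t‖ = 1
  orth : ∀ t, ⟪n (γ t), B t⟫ = 0

/-- The rate of rotation of a field of unit tangent vectors along a curve. -/
def rotationRate (n : E3 → E3) (γ B B' : ℝ → E3) (t : ℝ) : ℝ := ⟪cross (n (γ t)) (B t), B' t⟫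

theorem IsFrameAlong.continuous_rotationRate (h : IsFrameAlong S n γ B B') :
    Continuous (rotationRate n γ B B') := by
  have h1 : Continuous B := continuous_iff_continuousAt.2 fun t => (h.deriv t).continuousAt
  have h2 : Continuous fun t => cross (n (γ t)) (B t) :=
    (crossL.continuous.comp h.normal.continuous).clm_apply h1
  exact h2.inner h.cont

/-- Two parallel fields that agree initially are equal, since their difference has constant
length. -/
theorem IsParallelAlong.eqOn {w : ℝ → E3} (hv : IsParallelAlong S γ v) (hw : IsParallelAlong S γ w)
    (h0 : v 0 = w 0) : EqOn v w (Icc 0 1) := by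
  have hd : DifferentiableOn ℝ (fun t => v t - w t) (Icc 0 1) := hv.diff.sub hw.diff
  have hder : ∀ t ∈ Icc (0 : ℝ) 1,
      HasDerivWithinAt (fun t => ‖v t - w t‖ ^ 2) 0 (Icc 0 1) t := fun t ht => by
    have h1 := ((hv.diff t ht).hasDerivWithinAt.sub (hw.diff t ht).hasDerivWithinAt).norm_sq
    have h2 : ⟪v t - w t, derivWithin v (Icc 0 1) t - derivWithin w (Icc 0 1) t⟫ = 0 :=
      Submodule.inner_right_of_mem_orthogonal (sub_mem (hv.tangent t ht) (hw.tangent t ht))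
        (sub_mem (hv.parallel t ht) (hw.parallel t ht))
    rw [Pi.sub_apply, h2, mul_zero] at h1
    exact h1
  have hconst := constant_of_derivWithin_zero (a := 0) (b := 1)
    (fun t ht => (hder t ht).differentiableWithinAt)
    fun t ht => (hder t (Ico_subset_Icc_self ht)).derivWithin
      (uniqueDiffOn_Icc zero_lt_one t (Ico_subset_Icc_self ht))
  intro t ht
  have := hconst t ht
  simp only [h0, sub_self, norm_zero] at this
  simpa [sub_eq_zero] using this

/-- Parallel transport with respect to a frame along the curve is rotation with the opposite of the
rate of rotation of the frame. -/
theorem IsFrameAlong.isParallelAlong (hS : IsSurface S) (hn : IsCoorientation S n)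
    (h : IsFrameAlong S n γ B B') (l φ₀ : ℝ) :
    IsParallelAlong S γ fun t => l •
      (Real.cos (φ₀ - ∫ u in (0 : ℝ)..t, rotationRate n γ B B' u) • B t +
        Real.sin (φ₀ - ∫ u in (0 : ℝ)..t, rotationRate n γ B B' u) • cross (n (γ t)) (B t)) := by
  set τ := rotationRate n γ B B' with hτ
  set Φ : ℝ → ℝ := fun t => φ₀ - ∫ u in (0 : ℝ)..t, τ u with hΦ
  have hΦd : ∀ t, HasDerivAt Φ (-τ t) t := fun t =>
    (h.continuous_rotationRate.integral_hasStrictDerivAt 0 t).hasDerivAt.const_sub φ₀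
  set C : ℝ → E3 := fun t => cross (n (γ t)) (B t) with hC
  set N' : ℝ → E3 := fun t => _root_.deriv (n ∘ γ) t with hN'
  have hNd : ∀ t, HasDerivAt (n ∘ γ) (N' t) t := fun t => (h.normal t).hasDerivAt
  have hu : ∀ t, ‖n (γ t)‖ = 1 := fun t => hn.unit _ (h.mem t)
  have hCd : ∀ t, HasDerivAt C (cross (n (γ t)) (B' t) + cross (N' t) (B t)) t := fun t =>
    crossL.hasDerivAt_of_bilinear (fun _ => hNd t) fun _ => h.deriv t
  have hvd : ∀ t, HasDerivAt (fun t => l • (Real.cos (Φ t) • B t + Real.sin (Φ t) • C t))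
      (l • ((Real.cos (Φ t) • B' t + (-Real.sin (Φ t) * -τ t) • B t) +
        (Real.sin (Φ t) • (cross (n (γ t)) (B' t) + cross (N' t) (B t)) +
        (Real.cos (Φ t) * -τ t) • C t))) t := fun t =>
    ((((hΦd t).cos.smul (h.deriv t)).add ((hΦd t).sin.smul (hCd t))).const_smul l)
  refine ⟨fun t _ => (hvd t).differentiableAt.differentiableWithinAt, fun t _ => ?_, fun t ht => ?_⟩
  · rw [hn.mem_tangentPlane_iff hS (h.mem t)]
    simp only [inner_smul_right, inner_add_right, h.orth, inner_cross_left, mul_zero, add_zero]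
  · rw [(hvd t).hasDerivWithinAt.derivWithin (uniqueDiffOn_Icc zero_lt_one t ht)]
    have hBB : ⟪B t, B' t⟫ = 0 := by
      have h1 := (h.deriv t).norm_sq
      have h2 : (fun t => ‖B t‖ ^ 2) = fun _ => 1 := by ext t; rw [h.unit]; norm_num
      rw [h2] at h1
      have := h1.unique (hasDerivAt_const t 1)
      linarith
    have hNN : ⟪n (γ t), N' t⟫ = 0 := by
      have h1 := (hNd t).norm_sq
      have h2 : (fun t => ‖(n ∘ γ) t‖ ^ 2) = fun _ => 1 := by
        ext t; rw [Function.comp_apply, hu]; norm_num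
      rw [h2] at h1
      have := h1.unique (hasDerivAt_const t 1)
      simp only [Function.comp_apply] at this
      linarith
    have hCC := norm_cross_frame (hu t) (h.unit t) (h.orth t)
    have hBB1 : ⟪B t, B t⟫ = 1 := by rw [real_inner_self_eq_norm_sq, h.unit]; norm_num
    have hB1 : ⟪B t, C t⟫ = 0 := inner_cross_right _ _
    have hC1 : ⟪C t, B t⟫ = 0 := by rw [real_inner_comm]; exact hB1
    have hBn : ⟪B t, n (γ t)⟫ = 0 := by rw [real_inner_comm]; exact h.orth t
    have a1 : ⟪B t, cross (n (γ t)) (B' t)⟫ = -τ t := by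
      simp only [hτ, rotationRate, inner_e3, cross_apply_zero, cross_apply_one, cross_apply_two]
      ring
    have a2 : ⟪B t, cross (N' t) (B t)⟫ = 0 := inner_cross_right _ _
    have a3 : ⟪C t, cross (n (γ t)) (B' t)⟫ = 0 := by
      rw [hC, inner_cross_cross, hBB, hBn]; ring
    have a4 : ⟪C t, cross (N' t) (B t)⟫ = 0 := by
      rw [hC, inner_cross_cross, hNN, h.orth]; ring
    have a5 : ⟪C t, B' t⟫ = τ t := rfl
    -- The derivative of the field has no components along `B` and `C`.
    rw [Submodule.mem_orthogonal]
    intro w hw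
    rw [hn.mem_tangentPlane_iff hS (h.mem t)] at hw
    rw [frame_decomposition (hu t) (h.unit t) (h.orth t) w, hw]
    change ⟪_ + _ + _ • C t, _⟫ = 0
    simp only [inner_add_left, inner_add_right, inner_smul_left, inner_smul_right, conj_trivial,
      hBB, hBB1, hB1, hC1, a1, a2, a3, a4, a5, zero_smul, inner_zero_left]
    rw [show ⟪C t, C t⟫ = 1 from hCC]
    ring

/-- Every parallel field rotates relative to the frame as in `IsFrameAlong.isParallelAlong`. -/
theorem IsFrameAlong.exists_angle_of_isParallelAlong (hS : IsSurface S) (hn : IsCoorientation S n)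
    (h : IsFrameAlong S n γ B B') (hv : IsParallelAlong S γ v) :
    ∃ φ₀ : ℝ, ∀ t ∈ Icc (0 : ℝ) 1, v t = ‖v 0‖ •
      (Real.cos (φ₀ - ∫ u in (0 : ℝ)..t, rotationRate n γ B B' u) • B t +
        Real.sin (φ₀ - ∫ u in (0 : ℝ)..t, rotationRate n γ B B' u) • cross (n (γ t)) (B t)) := by
  have h0 : (0 : ℝ) ∈ Icc (0 : ℝ) 1 := ⟨le_rfl, zero_le_one⟩
  obtain ⟨φ₀, -, hφ⟩ := exists_angle (hn.unit _ (h.mem 0)) (h.unit 0) (h.orth 0)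
    ((hn.mem_tangentPlane_iff hS (h.mem 0) _).1 (hv.tangent 0 h0))
  refine ⟨φ₀, hv.eqOn (h.isParallelAlong hS hn ‖v 0‖ φ₀) ?_⟩
  rw [intervalIntegral.integral_same, sub_zero]
  exact hφ

/-- Parallel transport along a closed curve with a closed frame. -/
theorem IsFrameAlong.isTransportRotation (hS : IsSurface S) (hn : IsCoorientation S n)
    (h : IsFrameAlong S n γ B B') (hγ : γ 1 = γ 0) (hB : B 1 = B 0) :
    IsTransportRotation S n γ ((-∫ u in (0 : ℝ)..1, rotationRate n γ B B' u : ℝ) : Real.Angle) := by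
  have hfr := fun {w : E3} => exists_angle (w := w) (hn.unit _ (h.mem 0)) (h.unit 0) (h.orth 0)
  refine ⟨fun w hw => ?_, fun v hv => ?_⟩
  · obtain ⟨φ₀, -, hφ⟩ := hfr ((hn.mem_tangentPlane_iff hS (h.mem 0) _).1 hw)
    refine ⟨_, h.isParallelAlong hS hn ‖w‖ φ₀, ?_⟩
    rw [intervalIntegral.integral_same, sub_zero]
    exact hφ.symm
  · obtain ⟨φ₀, hφ⟩ := h.exists_angle_of_isParallelAlong hS hn hv
    have e0 := hφ 0 ⟨le_rfl, zero_le_one⟩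
    have e1 := hφ 1 ⟨zero_le_one, le_rfl⟩
    rw [intervalIntegral.integral_same, sub_zero] at e0
    rw [hγ, hB] at e1
    set w := v 0 with hw
    rw [e1, Real.Angle.cos_coe, Real.Angle.sin_coe]
    have h2 := rotate_add (hn.unit _ (h.mem 0)) (h.unit 0) (h.orth 0)
      (-∫ u in (0 : ℝ)..1, rotationRate n γ B B' u) φ₀
    rw [show φ₀ - ∫ u in (0 : ℝ)..1, rotationRate n γ B B' u =
      (-∫ u in (0 : ℝ)..1, rotationRate n γ B B' u) + φ₀ by ring, ← h2]
    conv_rhs => rw [e0]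
    rw [cross_smul_right]
    module

end Transport

/-! ### The rotation of a parallel field relative to a tangent field -/

section Field

variable {S : Set E3} {n b : E3 → E3}

/-- The exterior derivative of the connection form of a tangent frame is the opposite of the
Jacobian of the spherical map. -/
theorem curl_connection (hS : IsSurface S) (hn : IsCoorientation S n) (hb : IsSmoothOn S b)
    (hb1 : ∀ P ∈ S, ‖b P‖ = 1) (hbn : ∀ P ∈ S, ⟪n P, b P⟫ = 0) {P : E3} (hP : P ∈ S) :
    curl S n (fun P => cross (n P) (b P)) b P = -sphericalJacobian S n P := by
  obtain ⟨D, r, x, h, hx, rfl, -⟩ := hS.exists_patch_point hP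
  set c : E3 → E3 := fun P => cross (n P) (b P) with hc
  have hcs : IsSmoothOn S c := hn.isSmoothOn.cross hb
  have hD := h.domain
  have hmem : ∀ y ∈ D, r y ∈ S := fun y hy => h.sub ⟨y, hy, rfl⟩
  have hs : ∀ {u w : E3 → E3}, IsSmoothOn S u → IsSmoothOn S w → ∀ k : ℝ,
      (∀ P ∈ S, ⟪u P, w P⟫ = k) → ∀ i,
      ⟪u (r x), pd D (w ∘ r) i x⟫ = -⟪pd D (u ∘ r) i x, w (r x)⟫ := fun {u w} hu hw k hk i => by
    have h1 := pd_inner hD (hu D r h) (hw D r h) hx i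
    have h2 : pd D (fun y => ⟪(u ∘ r) y, (w ∘ r) y⟫) i x = 0 := by
      rw [pd_congr (f := fun y => ⟪(u ∘ r) y, (w ∘ r) y⟫) (g := fun _ => k)
        (fun y hy => hk _ (hmem y hy)) hx]
      simp [pd]
    rw [h2] at h1
    simp only [Function.comp_apply] at h1
    change 0 = ⟪u (r x), pd D (w ∘ r) i x⟫ + ⟪pd D (u ∘ r) i x, w (r x)⟫ at h1
    linarith
  have hcn : ∀ P ∈ S, ⟪n P, c P⟫ = 0 := fun P _ => inner_cross_left _ _
  have hbb : ∀ P ∈ S, ⟪b P, b P⟫ = 1 := fun P hP => by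
    rw [real_inner_self_eq_norm_sq, hb1 P hP]; norm_num
  have hcc : ∀ P ∈ S, ⟪c P, c P⟫ = 1 := fun P hP =>
    norm_cross_frame (hn.unit P hP) (hb1 P hP) (hbn P hP)
  have hbpd : ∀ i, ⟪b (r x), pd D (b ∘ r) i x⟫ = 0 := fun i => by
    have := hs hb hb 1 hbb i
    rw [real_inner_comm] at this
    linarith [real_inner_comm (b (r x)) (pd D (b ∘ r) i x)]
  have hcpd : ∀ i, ⟪c (r x), pd D (c ∘ r) i x⟫ = 0 := fun i => by
    have := hs hcs hcs 1 hcc i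
    rw [real_inner_comm] at this
    linarith [real_inner_comm (c (r x)) (pd D (c ∘ r) i x)]
  have hnb := hs hn.isSmoothOn hb 0 hbn
  have hnc := hs hn.isSmoothOn hcs 0 hcn
  have hu := hn.unit _ (hmem x hx)
  have hdec := frame_decomposition hu (hb1 _ (hmem x hx)) (hbn _ (hmem x hx))
  -- Of the components of `db` and `dc` only the normal ones contribute to the product, and these
  -- are components of `dN`.
  have key : ∀ i j, ⟪pd D (c ∘ r) i x, pd D (b ∘ r) j x⟫ =
      ⟪pd D (n ∘ r) i x, c (r x)⟫ * ⟪pd D (n ∘ r) j x, b (r x)⟫ := fun i j => by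
    rw [hdec (pd D (b ∘ r) j x), hbpd, hnb]
    simp only [inner_add_right, inner_smul_right, zero_smul, inner_zero_right]
    change _ + _ + _ * ⟪pd D (c ∘ r) i x, c (r x)⟫ = _
    rw [real_inner_comm (c (r x)), hcpd, real_inner_comm (n (r x)), hnc]
    ring
  have h1 := h.immersed.curl_mul hS hn hcs hb hx
  rw [key, key] at h1
  -- `N` is the vector product of `b` and `c`.
  have h2 : ⟪n (r x), nrm D (n ∘ r) x⟫ = ⟪pd D (n ∘ r) 0 x, b (r x)⟫ *
      ⟪pd D (n ∘ r) 1 x, c (r x)⟫ - ⟪pd D (n ∘ r) 0 x, c (r x)⟫ * ⟪pd D (n ∘ r) 1 x, b (r x)⟫ := by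
    conv_lhs => rw [← cross_frame_right hu (hb1 _ (hmem x hx)) (hbn _ (hmem x hx)), nrm,
      inner_cross_cross]
    rw [real_inner_comm (b (r x)), real_inner_comm (b (r x)), real_inner_comm (cross _ _),
      real_inner_comm (cross _ _)]
    ring
  rw [h.immersed.cross_pd_normal hS hn hx, inner_smul_right] at h2
  have h3 := inner_normal_cross_ne_zero hu (h.immersed.inner_normal_pd hn hx 0)
    (h.immersed.inner_normal_pd hn hx 1) (h.immersed.nrm_ne_zero hx)
  change ⟪n (r x), nrm D r x⟫ ≠ 0 at h3
  refine mul_left_cancel₀ h3 ?_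
  rw [h1]
  linear_combination h2

variable {m : ℕ} {γ : Fin m → ℝ → E3}

theorem IsBoundaryParam.hasDerivAt_comp (hS : IsSurface S) (hn : IsCoorientation S n)
    (hγ : IsBoundaryParam S n γ) (hb : IsSmoothOn S b) (i : Fin m) (t : ℝ) :
    HasDerivAt (b ∘ γ i) (surfDeriv S n b (γ i t) (deriv (γ i) t)) t := by
  have := hb.hasFDerivWithinAt_comp hS hn (T := univ) (mem_univ t)
    (hγ.hasDerivAt i t).hasFDerivAt.hasFDerivWithinAt uniqueDiffWithinAt_univ
    fun t _ => hγ.mem i t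
  simpa using (hasFDerivWithinAt_univ.1 this).hasDerivAt

theorem IsBoundaryParam.isFrameAlong (hS : IsSurface S) (hn : IsCoorientation S n)
    (hγ : IsBoundaryParam S n γ) (hb : IsSmoothOn S b) (hb1 : ∀ P ∈ S, ‖b P‖ = 1)
    (hbn : ∀ P ∈ S, ⟪n P, b P⟫ = 0) (i : Fin m) : IsFrameAlong S n (γ i) (b ∘ γ i)
      fun t => surfDeriv S n b (γ i t) (deriv (γ i) t) where
  mem := hγ.mem i
  normal := fun t => (hγ.hasDerivAt_comp hS hn hn.isSmoothOn i t).differentiableAt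
  deriv := hγ.hasDerivAt_comp hS hn hb i
  cont := continuous_surfDeriv_comp hS hn hb (hγ.smooth i).continuous (hγ.mem i)
    (hγ.continuous_deriv i)
  unit := fun t => hb1 _ (hγ.mem i t)
  orth := fun t => hbn _ (hγ.mem i t)

/-- A continuous field of unit tangent vectors makes an acute angle with a smooth one. -/
theorem IsUnitTangentField.exists_smooth (hS : IsSurface S) (hn : IsCoorientation S n) {a : E3 → E3}
    (ha : IsUnitTangentField S a) : ∃ b : E3 → E3, IsSmoothOn S b ∧ (∀ P ∈ S, ‖b P‖ = 1) ∧
      (∀ P ∈ S, ⟪n P, b P⟫ = 0) ∧ ∀ P ∈ S, 0 < ⟪b P, a P⟫ := by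
  classical
  obtain ⟨u, hu⟩ := exists_contMDiffMap_forall_mem_convex_of_local_const
    (modelWithCornersSelf ℝ E3) (n := (⊤ : ℕ∞))
    (t := fun P => if P ∈ S then Metric.ball (a P) 1 else univ)
    (fun P => by split_ifs; exacts [convex_ball _ _, convex_univ]) (fun P => by
      by_cases hP : P ∈ S
      · refine ⟨a P, ?_⟩
        have h1 := eventually_nhdsWithin_iff.1
          ((ha.cont P hP).eventually (Metric.ball_mem_nhds (a P) one_pos))
        filter_upwards [h1] with Q hQ
        split_ifs with hQS
        · rw [Metric.mem_ball, dist_comm]; exact hQ hQS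
        · trivial
      · refine ⟨0, ?_⟩
        filter_upwards [hS.1.isClosed.isOpen_compl.mem_nhds hP] with Q hQ
        rw [if_neg hQ]; trivial)
  have hus : IsSmoothOn S u := isSmoothOn_of_contDiff u.contMDiff.contDiff S
  have hua : ∀ P ∈ S, 0 < ⟪u P, a P⟫ := fun P hP => by
    have h1 := hu P
    rw [if_pos hP, mem_ball_iff_norm] at h1
    have h2 : ⟪u P, a P⟫ = 1 + ⟪u P - a P, a P⟫ := by
      rw [inner_sub_left, real_inner_self_eq_norm_sq, ha.unit P hP]; ring
    have h3 := abs_le.1 (abs_real_inner_le_norm (u P - a P) (a P))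
    rw [ha.unit P hP, mul_one] at h3
    linarith [h3.1]
  -- The tangential part of the approximation has the same products with the tangent field `a`.
  set p : E3 → E3 := fun P => u P - ⟪n P, u P⟫ • n P with hp
  have hps : IsSmoothOn S p := hus.sub ((hn.isSmoothOn.inner hus).smul hn.isSmoothOn)
  have hpa : ∀ P ∈ S, ⟪p P, a P⟫ = ⟪u P, a P⟫ := fun P hP => by
    rw [hp, inner_sub_left, inner_smul_left, hn.normal P hP _ (ha.tangent P hP)]
    simp
  have hp0 : ∀ P ∈ S, p P ≠ 0 := fun P hP h0 => by
    have := hua P hP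
    rw [← hpa P hP, h0, inner_zero_left] at this
    exact lt_irrefl _ this
  refine ⟨fun P => ‖p P‖⁻¹ • p P, fun D r h => ?_, fun P hP => ?_, fun P hP => ?_, fun P hP => ?_⟩
  · have h0 : ∀ x ∈ D, (p ∘ r) x ≠ 0 := fun x hx => hp0 _ (h.sub ⟨x, hx, rfl⟩)
    exact (((hps D r h).norm ℝ h0).inv fun x hx => norm_ne_zero_iff.2 (h0 x hx)).smul (hps D r h)
  · rw [norm_smul, norm_inv, norm_norm, inv_mul_cancel₀ (norm_ne_zero_iff.2 (hp0 P hP))]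
  · rw [inner_smul_right, hp, inner_sub_right, inner_smul_right, real_inner_self_eq_norm_sq,
      hn.unit P hP]
    ring
  · rw [inner_smul_left, hpa P hP]
    exact mul_pos (by simpa using hp0 P hP) (hua P hP)

/-- Two continuous choices of the same angle differ by a constant. -/
theorem sub_eq_sub_of_cos_sin_eq {φ ψ : ℝ → ℝ} (hφ : ContinuousOn φ (Icc 0 1))
    (hψ : ContinuousOn ψ (Icc 0 1)) (hcos : ∀ t ∈ Icc (0 : ℝ) 1, Real.cos (φ t) = Real.cos (ψ t))
    (hsin : ∀ t ∈ Icc (0 : ℝ) 1, Real.sin (φ t) = Real.sin (ψ t)) :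
    φ 1 - φ 0 = ψ 1 - ψ 0 := by
  have h1 : MapsTo (fun t => φ t - ψ t) (Icc 0 1)
      (AddSubgroup.zmultiples (2 * Real.pi) : Set ℝ) := fun t ht => by
    have h2 := Real.Angle.cos_sin_inj (hcos t ht) (hsin t ht)
    exact QuotientAddGroup.eq_iff_sub_mem.1 h2
  have h2 := isPreconnected_Icc.constant_of_mapsTo ⟨inferInstanceAs
    (DiscreteTopology (AddSubgroup.zmultiples (2 * Real.pi)))⟩ (hφ.sub hψ) h1
    (left_mem_Icc.2 zero_le_one) (right_mem_Icc.2 zero_le_one)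
  change φ 0 - ψ 0 = φ 1 - ψ 1 at h2
  linarith

/-- The rotation of parallel fields relative to a tangent field. Relative to a smooth field `b` it
is given by Stokes' formula for the connection form of `b`; the angle from `b` to `a` is a
continuous function on the surface, so it takes the same value at both ends of a closed curve. -/
theorem sum_angle_eq_integral (hS : IsSurfaceWithSmoothBoundary S) (hn : IsCoorientation S n)
    (hγ : IsBoundaryParam S n γ) {a : E3 → E3} {v : Fin m → ℝ → E3} {φ : Fin m → ℝ → ℝ}
    (ha : IsUnitTangentField S a)
    (hv : ∀ i, IsParallelAlong S (γ i) (v i) ∧ v i 0 ≠ 0 ∧ IsAngleFrom n a (γ i) (v i) (φ i)) :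
    ∑ i, (φ i 1 - φ i 0) = ∫ P in S, sphericalJacobian S n P ∂μHE[2] := by
  have hS' := hS.isSurface
  obtain ⟨b, hb, hb1, hbn, hba⟩ := ha.exists_smooth hS' hn
  have h1 := stokes hS hn hγ (hn.isSmoothOn.cross hb) hb
  rw [setIntegral_congr_fun hS'.measurableSet fun P hP => curl_connection hS' hn hb hb1 hbn hP,
    integral_neg] at h1
  rw [← neg_neg (∫ P in S, sphericalJacobian S n P ∂μHE[2]), h1, ← Finset.sum_neg_distrib]
  refine Finset.sum_congr rfl fun i _ => ?_
  obtain ⟨hpar, hv0, hφc, hφ⟩ := hv i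
  have hfr := hγ.isFrameAlong hS' hn hb hb1 hbn i
  obtain ⟨φ₀, hφ₀⟩ := hfr.exists_angle_of_isParallelAlong hS' hn hpar
  set τ := rotationRate n (γ i) (b ∘ γ i) fun t => surfDeriv S n b (γ i t) (deriv (γ i) t) with hτ
  set Φ : ℝ → ℝ := fun t => φ₀ - ∫ u in (0 : ℝ)..t, τ u with hΦ
  have hΦc : Continuous Φ := continuous_const.sub
    (intervalIntegral.continuous_primitive
      (fun _ _ => hfr.continuous_rotationRate.intervalIntegrable _ _) 0)
  -- the angle from `b` to `a`
  set α : E3 → ℝ := fun P => Real.arcsin ⟪cross (n P) (b P), a P⟫ with hα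
  have hαc : ContinuousOn α S := Real.continuous_arcsin.comp_continuousOn
    (((hn.isSmoothOn.cross hb).continuousOn hS').inner ha.cont)
  have hα : ∀ P ∈ S, a P = Real.cos (α P) • b P + Real.sin (α P) • cross (n P) (b P) := by
    intro P hP
    have hd := frame_decomposition (hn.unit P hP) (hb1 P hP) (hbn P hP) (a P)
    rw [hn.normal P hP _ (ha.tangent P hP), zero_smul, zero_add] at hd
    have h2 : ⟪b P, a P⟫ ^ 2 + ⟪cross (n P) (b P), a P⟫ ^ 2 = 1 := by
      have h3 : ⟪a P, a P⟫ = 1 := by rw [real_inner_self_eq_norm_sq, ha.unit P hP]; norm_num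
      nth_rewrite 1 [hd] at h3
      rw [inner_add_left, inner_smul_left, inner_smul_left] at h3
      simp only [conj_trivial] at h3
      linarith
    have h4 : Real.sin (α P) = ⟪cross (n P) (b P), a P⟫ :=
      Real.sin_arcsin (by nlinarith [sq_nonneg ⟪b P, a P⟫]) (by nlinarith [sq_nonneg ⟪b P, a P⟫])
    have h5 : Real.cos (α P) = ⟪b P, a P⟫ := by
      rw [hα, Real.cos_arcsin, ← h2, add_sub_cancel_right, Real.sqrt_sq (hba P hP).le]
    rw [h4, h5]
    exact hd
  have hnorm : ∀ t ∈ Icc (0 : ℝ) 1, Real.cos (φ i t + α (γ i t)) = Real.cos (Φ t) ∧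
      Real.sin (φ i t + α (γ i t)) = Real.sin (Φ t) := by
    intro t ht
    have hPS := hγ.mem i t
    have hu := hn.unit _ hPS
    have hcc := norm_cross_frame hu (hb1 _ hPS) (hbn _ hPS)
    have hbb : ⟪b (γ i t), b (γ i t)⟫ = 1 := by
      rw [real_inner_self_eq_norm_sq, hb1 _ hPS]; norm_num
    have hbc : ⟪b (γ i t), cross (n (γ i t)) (b (γ i t))⟫ = 0 := inner_cross_right _ _
    have e1 := hφ t ht
    rw [hα _ hPS, rotate_add hu (hb1 _ hPS) (hbn _ hPS)] at e1
    have e2 := hφ₀ t ht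
    simp only [Function.comp_apply] at e2
    change _ = ‖v i 0‖ • (Real.cos (Φ t) • _ + Real.sin (Φ t) • _) at e2
    have hn2 : ‖v i t‖ = ‖v i 0‖ := by
      have e3 : ‖Real.cos (Φ t) • b (γ i t) + Real.sin (Φ t) • cross (n (γ i t)) (b (γ i t))‖ ^ 2
          = 1 := by
        rw [← real_inner_self_eq_norm_sq]
        simp only [inner_add_left, inner_add_right, inner_smul_left, inner_smul_right,
          conj_trivial, hbb, hcc, hbc, real_inner_comm (b (γ i t)) (cross (n (γ i t)) (b (γ i t)))]
        linear_combination Real.sin_sq_add_cos_sq (Φ t)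
      rw [e2, norm_smul, norm_norm, (pow_eq_one_iff_of_nonneg (norm_nonneg _) two_ne_zero).1 e3, mul_one]
    rw [hn2, e2] at e1
    have e4 := smul_right_injective E3 (norm_ne_zero_iff.2 hv0) e1
    have e5 := congrArg (fun w => ⟪b (γ i t), w⟫) e4
    have e6 := congrArg (fun w => ⟪cross (n (γ i t)) (b (γ i t)), w⟫) e4
    simp only [inner_add_right, inner_smul_right, hbb, hcc, hbc,
      real_inner_comm (b (γ i t)) (cross (n (γ i t)) (b (γ i t)))] at e5 e6
    constructor <;> linarith
  -- The angle from `b` to the parallel field, written in two ways.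
  have h6 := sub_eq_sub_of_cos_sin_eq (φ := fun t => φ i t + α (γ i t)) (ψ := Φ)
    (hφc.add (hαc.comp (hγ.smooth i).continuous.continuousOn fun t _ => hγ.mem i t))
    hΦc.continuousOn (fun t ht => (hnorm t ht).1) fun t ht => (hnorm t ht).2
  have h7 : γ i 1 = γ i 0 := by
    have := hγ.closed i 0
    rwa [zero_add] at this
  have h8 : Φ 1 - Φ 0 = -∫ u in (0 : ℝ)..1, τ u := by
    simp only [hΦ, intervalIntegral.integral_same]; ring
  rw [h7, h8, intervalIntegral.integral_of_le zero_le_one, ← integral_Icc_eq_integral_Ioc] at h6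
  have h9 : φ i 1 - φ i 0 = -∫ t in Icc (0 : ℝ) 1, τ t := by linarith
  exact h9

end Field

/-! ### Integration over the sphere in spherical coordinates -/

section Sphere

/-- The point of the unit sphere at the angle `x 0` from the pole `m`, on the meridian that makes
the angle `x 1` with the meridian of `b`. -/
def sphPt (m b : E3) (x : E2) : E3 :=
  Real.cos (x 0) • m + Real.sin (x 0) • (Real.cos (x 1) • b + Real.sin (x 1) • cross m b)

theorem contDiff_sphPt (m b : E3) : ContDiff ℝ ∞ (sphPt m b) := by
  have h0 : ContDiff ℝ ∞ fun x : E2 => x 0 := (EuclideanSpace.proj (𝕜 := ℝ) (0 : Fin 2)).contDiff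
  have h1 : ContDiff ℝ ∞ fun x : E2 => x 1 := (EuclideanSpace.proj (𝕜 := ℝ) (1 : Fin 2)).contDiff
  exact (h0.cos.smul contDiff_const).add
    (h0.sin.smul ((h1.cos.smul contDiff_const).add (h1.sin.smul contDiff_const)))

theorem hasFDerivAt_sphPt (m b : E3) (x : E2) : HasFDerivAt (sphPt m b)
    ((EuclideanSpace.proj 0 : E2 →L[ℝ] ℝ).smulRight (-Real.sin (x 0) • m +
      Real.cos (x 0) • (Real.cos (x 1) • b + Real.sin (x 1) • cross m b)) +
    (EuclideanSpace.proj 1 : E2 →L[ℝ] ℝ).smulRight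
      (Real.sin (x 0) • (-Real.sin (x 1) • b + Real.cos (x 1) • cross m b))) x := by
  have h0 : HasFDerivAt (fun x : E2 => x 0) (EuclideanSpace.proj (𝕜 := ℝ) 0) x :=
    (EuclideanSpace.proj (𝕜 := ℝ) 0).hasFDerivAt
  have h1 : HasFDerivAt (fun x : E2 => x 1) (EuclideanSpace.proj (𝕜 := ℝ) 1) x :=
    (EuclideanSpace.proj (𝕜 := ℝ) 1).hasFDerivAt
  have h2 := (h0.cos.smul_const m).add
    (h0.sin.smul ((h1.cos.smul_const b).add (h1.sin.smul_const (cross m b))))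
  refine h2.congr_fderiv ?_
  ext1 ξ
  simp only [add_apply, ContinuousLinearMap.smulRight_apply, smul_apply, Pi.add_apply, smul_eq_mul]
  module

variable {m b : E3} (hm : ‖m‖ = 1) (hb : ‖b‖ = 1) (hmb : ⟪m, b⟫ = 0)
include hm hb hmb

theorem volFactor_sphPt (x : E2) : volFactor (fderiv ℝ (sphPt m b) x) = |Real.sin (x 0)| := by
  have hmm : ⟪m, m⟫ = 1 := by rw [real_inner_self_eq_norm_sq, hm]; norm_num
  have hbb : ⟪b, b⟫ = 1 := by rw [real_inner_self_eq_norm_sq, hb]; norm_num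
  have hcc := norm_cross_frame hm hb hmb
  have hbm : ⟪b, m⟫ = 0 := by rw [real_inner_comm]; exact hmb
  have hmc : ⟪m, cross m b⟫ = 0 := inner_cross_left _ _
  have hcm : ⟪cross m b, m⟫ = 0 := by rw [real_inner_comm]; exact hmc
  have hbc : ⟪b, cross m b⟫ = 0 := inner_cross_right _ _
  have hcb : ⟪cross m b, b⟫ = 0 := by rw [real_inner_comm]; exact hbc
  have hA0 : fderiv ℝ (sphPt m b) x (e2 0) = -Real.sin (x 0) • m +
      Real.cos (x 0) • (Real.cos (x 1) • b + Real.sin (x 1) • cross m b) := by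
    rw [(hasFDerivAt_sphPt m b x).fderiv]; simp
  have hA1 : fderiv ℝ (sphPt m b) x (e2 1) =
      Real.sin (x 0) • (-Real.sin (x 1) • b + Real.cos (x 1) • cross m b) := by
    rw [(hasFDerivAt_sphPt m b x).fderiv]; simp
  rw [volFactor_eq_norm_cross, ← Real.sqrt_sq_eq_abs, @norm_eq_sqrt_real_inner, inner_cross_cross,
    hA0, hA1]
  congr 1
  simp only [inner_add_left, inner_add_right, inner_smul_left, inner_smul_right, hmm, hbb, hcc, hbm,
    hmb, hmc, hcm, hbc, hcb, conj_trivial]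
  have h0 := Real.sin_sq_add_cos_sq (x 0)
  have h1 := Real.sin_sq_add_cos_sq (x 1)
  have h2 : Real.sin (x 0) ^ 2 * ((Real.sin (x 0) ^ 2 +
      Real.cos (x 0) ^ 2 * (Real.sin (x 1) ^ 2 + Real.cos (x 1) ^ 2)) *
      (Real.sin (x 1) ^ 2 + Real.cos (x 1) ^ 2)) = Real.sin (x 0) ^ 2 := by
    rw [h1, mul_one, mul_one, h0, mul_one]
  linear_combination h2

theorem inner_sphPt (x : E2) : ⟪m, sphPt m b x⟫ = Real.cos (x 0) := by
  simp only [sphPt, inner_add_right, inner_smul_right, real_inner_self_eq_norm_sq, hm, hmb,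
    inner_cross_left]
  ring

omit hm hb hmb in
/-- The domain of the spherical coordinates. -/
def sphDomain : Set E2 := {x : E2 | x 0 ∈ Ioo 0 Real.pi ∧ x 1 ∈ Ioc (-Real.pi) Real.pi}

omit hm hb hmb in
theorem mem_sphDomain {x : E2} :
    x ∈ sphDomain ↔ x 0 ∈ Ioo 0 Real.pi ∧ x 1 ∈ Ioc (-Real.pi) Real.pi := Iff.rfl

omit hm hb hmb in
theorem measurableSet_sphDomain : MeasurableSet sphDomain :=
  ((EuclideanSpace.proj (𝕜 := ℝ) (0 : Fin 2)).continuous.measurable measurableSet_Ioo).inter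
    ((EuclideanSpace.proj (𝕜 := ℝ) (1 : Fin 2)).continuous.measurable measurableSet_Ioc)

theorem injOn_sphPt : InjOn (sphPt m b) sphDomain := by
  intro x hx y hy h
  have h0 := congrArg (fun w => ⟪m, w⟫) h
  simp only [inner_sphPt hm hb hmb] at h0
  have h0' := Real.injOn_cos (Ioo_subset_Icc_self hx.1) (Ioo_subset_Icc_self hy.1) h0
  have hs := (Real.sin_pos_of_pos_of_lt_pi hx.1.1 hx.1.2).ne'
  have hbb : ⟪b, b⟫ = 1 := by rw [real_inner_self_eq_norm_sq, hb]; norm_num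
  have hcc := norm_cross_frame hm hb hmb
  have hbm : ⟪b, m⟫ = 0 := by rw [real_inner_comm]; exact hmb
  have hcm : ⟪cross m b, m⟫ = 0 := by rw [real_inner_comm]; exact inner_cross_left _ _
  have hbc : ⟪b, cross m b⟫ = 0 := inner_cross_right _ _
  have hcb : ⟪cross m b, b⟫ = 0 := by rw [real_inner_comm]; exact hbc
  have h1 := congrArg (fun w => ⟪b, w⟫) h
  have h2 := congrArg (fun w => ⟪cross m b, w⟫) h
  simp only [sphPt, inner_add_right, inner_smul_right, hbb, hcc, hbm, hcm, hbc, hcb, ← h0',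
    mul_zero, mul_one, zero_add, add_zero] at h1 h2
  have h3 := Real.Angle.cos_sin_inj (mul_left_cancel₀ hs h1) (mul_left_cancel₀ hs h2)
  have h4 := congrArg Real.Angle.toReal h3
  rw [Real.Angle.toReal_coe_eq_self_iff_mem_Ioc.2 hx.2,
    Real.Angle.toReal_coe_eq_self_iff_mem_Ioc.2 hy.2] at h4
  ext i; fin_cases i
  · exact h0'
  · exact h4

theorem image_sphPt : sphPt m b '' sphDomain = Metric.sphere (0 : E3) 1 \ {m, -m} := by
  have hmm : ⟪m, m⟫ = 1 := by rw [real_inner_self_eq_norm_sq, hm]; norm_num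
  have hbb : ⟪b, b⟫ = 1 := by rw [real_inner_self_eq_norm_sq, hb]; norm_num
  have hcc := norm_cross_frame hm hb hmb
  have hbm : ⟪b, m⟫ = 0 := by rw [real_inner_comm]; exact hmb
  have hmc : ⟪m, cross m b⟫ = 0 := inner_cross_left _ _
  have hcm : ⟪cross m b, m⟫ = 0 := by rw [real_inner_comm]; exact hmc
  have hbc : ⟪b, cross m b⟫ = 0 := inner_cross_right _ _
  have hcb : ⟪cross m b, b⟫ = 0 := by rw [real_inner_comm]; exact hbc
  ext q
  rw [mem_sdiff, mem_insert_iff, mem_singleton_iff, not_or, mem_sphere_zero_iff_norm]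
  constructor
  · rintro ⟨x, hx, rfl⟩
    have hz := inner_sphPt hm hb hmb x
    have h0 := Real.sin_sq_add_cos_sq (x 0)
    have hs := Real.sin_pos_of_pos_of_lt_pi hx.1.1 hx.1.2
    refine ⟨?_, fun h => ?_, fun h => ?_⟩
    · rw [← sq_eq_sq₀ (norm_nonneg _) zero_le_one, ← real_inner_self_eq_norm_sq]
      simp only [sphPt, inner_add_left, inner_add_right, inner_smul_left, inner_smul_right, hmm,
        hbb, hcc, hbm, hmb, hmc, hcm, hbc, hcb, conj_trivial]
      linear_combination h0 + Real.sin (x 0) ^ 2 * Real.sin_sq_add_cos_sq (x 1)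
    · rw [h, hmm] at hz
      rw [← hz] at h0
      nlinarith
    · rw [h, inner_neg_right, hmm] at hz
      rw [← hz] at h0
      nlinarith
  · rintro ⟨hq, h1, h2⟩
    set z := ⟪m, q⟫ with hz
    have hz1 : |z| ≤ 1 := by simpa [hm, hq] using abs_real_inner_le_norm m q
    have hz2 := abs_le.1 hz1
    have hne1 : z ≠ 1 := fun h => h1 ((inner_eq_one_iff_of_norm_eq_one hm hq).1 h).symm
    have hne2 : z ≠ -1 := fun h => h2 (by
      have := (inner_eq_one_iff_of_norm_eq_one (𝕜 := ℝ) (x := m) (y := -q) hm (by rwa [norm_neg])).1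
        (by rw [inner_neg_right, ← hz, h, neg_neg])
      rw [this, neg_neg])
    set w := q - z • m with hw
    have hmw : ⟪m, w⟫ = 0 := by rw [hw, inner_sub_right, inner_smul_right, hmm, ← hz]; ring
    have hwn : ‖w‖ = Real.sqrt (1 - z ^ 2) := by
      rw [@norm_eq_sqrt_real_inner]
      congr 1
      rw [hw, inner_sub_left, inner_sub_right, inner_sub_right, inner_smul_left, inner_smul_right,
        inner_smul_left, inner_smul_right, real_inner_self_eq_norm_sq, hq, real_inner_comm m q,
        ← hz, hmm, conj_trivial]
      ring
    obtain ⟨φ, hφ, hwφ⟩ := exists_angle hm hb hmb hmw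
    refine ⟨pt (Real.arccos z, φ), ?_, ?_⟩
    · rw [mem_sphDomain, pt_zero, pt_one]
      exact ⟨⟨Real.arccos_pos.2 (lt_of_le_of_ne hz2.2 hne1),
        Real.arccos_lt_pi.2 (lt_of_le_of_ne hz2.1 hne2.symm)⟩, hφ⟩
    · rw [sphPt, pt_zero, pt_one, Real.cos_arccos hz2.1 hz2.2, Real.sin_arccos, ← hwn, ← hwφ, hw]
      module

omit hm hb hmb in
theorem area_singleton (q : E3) : μHE[2] ({q} : Set E3) = 0 := by
  have := Measure.nullSingletonClass_hausdorff E3 (d := 2) (by norm_num)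
  rw [Measure.euclideanHausdorffMeasure_def, Measure.smul_apply]
  simp

theorem sphere_ae_eq : sphPt m b '' sphDomain =ᵐ[μHE[2]] Metric.sphere (0 : E3) 1 := by
  rw [image_sphPt hm hb hmb]
  refine sdiff_ae_eq_self.2 (measure_mono_null inter_subset_right ?_)
  rw [insert_eq]
  exact measure_union_null (area_singleton _) (area_singleton _)

omit hm hb hmb in
theorem hasC1DerivOn_sphPt (m b : E3) : HasC1DerivOn (sphPt m b) (fderiv ℝ (sphPt m b)) univ where
  convex := convex_univ
  deriv x _ := ((contDiff_sphPt m b).differentiable (by simp) x).hasFDerivAt.hasFDerivWithinAt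
  cont := ((contDiff_sphPt m b).continuous_fderiv (by simp)).continuousOn

theorem injective_fderiv_sphPt {x : E2} (hx : x ∈ sphDomain) :
    Function.Injective (fderiv ℝ (sphPt m b) x) := by
  by_contra h
  have h1 := volFactor_sphPt hm hb hmb x
  rw [volFactor_eq_zero h] at h1
  exact (Real.sin_pos_of_pos_of_lt_pi hx.1.1 hx.1.2).ne' (abs_eq_zero.1 h1.symm)

/-- The integral over the sphere of a function of the height above the equator of the pole `m`. -/
theorem integral_sphere (k : ℝ → ℝ) :
    ∫ q in Metric.sphere (0 : E3) 1, k ⟪m, q⟫ ∂μHE[2] =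
      2 * Real.pi * ∫ θ in Ioo 0 Real.pi, Real.sin θ * k (Real.cos θ) := by
  have h1 := (hasC1DerivOn_sphPt m b).integral_image measurableSet_sphDomain (subset_univ _)
    (injOn_sphPt hm hb hmb) (fun x => injective_fderiv_sphPt hm hb hmb) fun q => k ⟪m, q⟫
  rw [finrank_e2] at h1
  rw [← setIntegral_congr_set (sphere_ae_eq hm hb hmb), h1,
    setIntegral_congr_fun (g := fun x => Real.sin (x 0) * k (Real.cos (x 0)))
      measurableSet_sphDomain fun x hx => by
        simp only [volFactor_sphPt hm hb hmb, inner_sphPt hm hb hmb,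
          abs_of_pos (Real.sin_pos_of_pos_of_lt_pi hx.1.1 hx.1.2)],
    ← integral_indicator measurableSet_sphDomain, ← integral_comp_pt]
  have h2 : (fun p : ℝ × ℝ => sphDomain.indicator
      (fun x : E2 => Real.sin (x 0) * k (Real.cos (x 0))) (pt p)) =
      (Ioo 0 Real.pi ×ˢ Ioc (-Real.pi) Real.pi).indicator
        fun p : ℝ × ℝ => Real.sin p.1 * k (Real.cos p.1) * 1 := by
    ext p
    by_cases hp : p ∈ Ioo 0 Real.pi ×ˢ Ioc (-Real.pi) Real.pi
    · rw [indicator_of_mem hp, indicator_of_mem (mem_sphDomain.2 (by simpa using hp)), pt_zero,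
        mul_one]
    · rw [indicator_of_notMem hp, indicator_of_notMem]
      rw [mem_sphDomain]; simpa using hp
  rw [h2, integral_indicator (measurableSet_Ioo.prod measurableSet_Ioc), Measure.volume_eq_prod,
    setIntegral_prod_mul (fun θ => Real.sin θ * k (Real.cos θ)) fun _ => (1 : ℝ)]
  simp [Real.pi_pos.le]
  ring

theorem area_sphere_lt_top : μHE[2] (Metric.sphere (0 : E3) 1) < ⊤ := by
  have h1 := ((hasC1DerivOn_sphPt m b).integrableOn_image_iff measurableSet_sphDomain
    (subset_univ _) (injOn_sphPt hm hb hmb) (fun x => injective_fderiv_sphPt hm hb hmb)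
    fun _ => 1).2 (by
      have hab : ∀ i, (![0, -Real.pi] : Fin 2 → ℝ) i < (![Real.pi, Real.pi] : Fin 2 → ℝ) i := by
        intro i; fin_cases i <;> simp [Real.pi_pos]
      refine IntegrableOn.mono_set ?_ (t := rect ![0, -Real.pi] ![Real.pi, Real.pi]) fun x hx => ?_
      · refine ContinuousOn.integrableOn_compact (isParamDomain_rect hab).isCompact
          (Continuous.continuousOn ?_)
        exact (continuous_volFactor.comp ((contDiff_sphPt m b).continuous_fderiv (by simp))).mul
          continuous_const
      · intro i; fin_cases i
        · exact Ioo_subset_Icc_self hx.1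
        · exact Ioc_subset_Icc_self hx.2)
  rw [finrank_e2, integrableOn_const_iff, measure_congr (sphere_ae_eq hm hb hmb)] at h1
  simpa using h1

/-- The area of a spherical cap is proportional to the square of its radius. -/
theorem area_cap_le {ρ : ℝ} (hρ : 0 < ρ) (hρ1 : ρ ≤ 1) :
    (μHE[2] (Metric.sphere (0 : E3) 1 ∩ Metric.closedBall (-m) ρ)).toReal ≤
      Real.pi * ρ ^ 2 := by
  -- On the sphere `‖q + m‖ ^ 2 = 2 (1 + ⟪m, q⟫)`, so that the cap is `1 + ⟪m, q⟫ ≤ ρ ^ 2 / 2`.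
  set δ := ρ ^ 2 / 2 with hδ
  have hδ0 : 0 < δ := by positivity
  have hδ1 : δ ≤ 1 := by rw [hδ]; nlinarith
  have hmem : ∀ q ∈ Metric.sphere (0 : E3) 1, q ∈ Metric.closedBall (-m) ρ ↔ ⟪m, q⟫ ∈ Iic (δ - 1) :=
    fun q hq => by
      rw [mem_sphere_zero_iff_norm] at hq
      rw [mem_closedBall_iff_norm, sub_neg_eq_add, ← sq_le_sq₀ (norm_nonneg _) hρ.le,
        norm_add_sq_real, hq, hm, real_inner_comm, mem_Iic, hδ]
      constructor <;> intro h <;> linarith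
  have h1 := integral_sphere hm hb hmb ((Iic (δ - 1)).indicator fun _ => 1)
  have h2 : ∫ q in Metric.sphere (0 : E3) 1, (Iic (δ - 1)).indicator (fun _ => (1 : ℝ)) ⟪m, q⟫ ∂μHE[2]
      = (μHE[2] (Metric.sphere (0 : E3) 1 ∩ Metric.closedBall (-m) ρ)).toReal := by
    rw [setIntegral_congr_fun (g := (Metric.closedBall (-m) ρ).indicator fun _ => (1 : ℝ))
      Metric.isClosed_sphere.measurableSet fun q hq => by
        by_cases h : q ∈ Metric.closedBall (-m) ρ
        · simp only [indicator_of_mem h, indicator_of_mem ((hmem q hq).1 h)]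
        · simp only [indicator_of_notMem h, indicator_of_notMem (fun h' => h ((hmem q hq).2 h'))],
      setIntegral_indicator Metric.isClosed_closedBall.measurableSet]
    simp [measureReal_def]
  rw [← h2, h1]
  have h3 : ∫ θ in Ioo 0 Real.pi, Real.sin θ * (Iic (δ - 1)).indicator (fun _ => (1 : ℝ)) (Real.cos θ) ≤
      ∫ θ in Icc (Real.arccos (δ - 1)) Real.pi, Real.sin θ := by
    have hsub : Icc (Real.arccos (δ - 1)) Real.pi ⊆ Icc 0 Real.pi :=
      Icc_subset_Icc_left (Real.arccos_nonneg _)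
    have h4 : ∫ θ in Icc (Real.arccos (δ - 1)) Real.pi, Real.sin θ =
        ∫ θ in Icc 0 Real.pi, (Icc (Real.arccos (δ - 1)) Real.pi).indicator Real.sin θ := by
      rw [setIntegral_indicator measurableSet_Icc, inter_eq_self_of_subset_right hsub]
    rw [h4, ← integral_Icc_eq_integral_Ioo]
    refine setIntegral_mono_on₀ ?_ ?_ measurableSet_Icc.nullMeasurableSet fun θ hθ => ?_
    · have h6 : (fun θ => Real.sin θ * (Iic (δ - 1)).indicator (fun _ => (1 : ℝ)) (Real.cos θ)) =
          (Real.cos ⁻¹' Iic (δ - 1)).indicator Real.sin := by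
        ext θ
        by_cases h : Real.cos θ ∈ Iic (δ - 1)
        · rw [indicator_of_mem h, indicator_of_mem (mem_preimage.2 h), mul_one]
        · rw [indicator_of_notMem h, mul_zero]
          exact (indicator_of_notMem (s := Real.cos ⁻¹' Iic (δ - 1)) h _).symm
      rw [h6]
      exact Real.continuous_sin.integrableOn_Icc.indicator
        (Real.continuous_cos.measurable measurableSet_Iic)
    · exact (Real.continuous_sin.integrableOn_Icc).indicator measurableSet_Icc
    · by_cases h : Real.cos θ ∈ Iic (δ - 1)
      · rw [indicator_of_mem h, indicator_of_mem, mul_one]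
        refine ⟨?_, hθ.2⟩
        rw [← Real.arccos_cos hθ.1 hθ.2]
        exact Real.antitone_arccos h
      · rw [indicator_of_notMem h, mul_zero]
        exact indicator_nonneg (fun θ hθ => Real.sin_nonneg_of_mem_Icc (hsub hθ)) θ
  rw [integral_deriv_eq_sub (u := fun θ => -Real.cos θ) (Real.arccos_lt_pi.2 (by linarith))
    (fun t _ => by
      have := (Real.hasDerivAt_cos t).neg
      rw [neg_neg] at this
      exact this.hasDerivWithinAt)
    Real.continuous_sin.continuousOn, Real.cos_arccos (by linarith) (by linarith), Real.cos_pi] at h3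
  have h5 : ρ ^ 2 = 2 * δ := by rw [hδ]; ring
  rw [h5]
  nlinarith [Real.pi_pos]

end Sphere

/-! ### The connection form of the frame with a pole -/

section PoleForm

/-- A smooth function equal to `0` for `z ≤ δ / 2 - 1` and to `1` for `z ≥ δ - 1`. -/
def capStep (δ z : ℝ) : ℝ := Real.smoothTransition (2 / δ * (1 + z) - 1)

/-- A smooth function equal to `1 / (1 + z)` for `z ≥ δ - 1`. -/
def capCutoff (δ z : ℝ) : ℝ := capStep δ z * (1 + z)⁻¹

/-- The derivative of `z + (1 - z²) capCutoff δ z`, which vanishes for `z > δ - 1`. -/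
def capWeight (δ z : ℝ) : ℝ :=
  1 - capStep δ z + (1 - z) * (2 / δ * deriv Real.smoothTransition (2 / δ * (1 + z) - 1))

theorem continuous_deriv_smoothTransition : Continuous (deriv Real.smoothTransition) :=
  (Real.smoothTransition.contDiff (n := 1)).continuous_deriv le_rfl

theorem contDiff_capStep (δ : ℝ) : ContDiff ℝ ∞ (capStep δ) :=
  Real.smoothTransition.contDiff.comp (by fun_prop)

theorem continuous_capWeight (δ : ℝ) : Continuous (capWeight δ) := by
  have h1 := (contDiff_capStep δ).continuous
  have h2 : Continuous fun z : ℝ => deriv Real.smoothTransition (2 / δ * (1 + z) - 1) :=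
    continuous_deriv_smoothTransition.comp (by fun_prop)
  unfold capWeight
  fun_prop

variable {δ : ℝ} (hδ : 0 < δ)
include hδ

theorem capStep_of_le {z : ℝ} (hz : 1 + z ≤ δ / 2) : capStep δ z = 0 :=
  Real.smoothTransition.zero_of_nonpos (by
    have : 2 / δ * (1 + z) ≤ 2 / δ * (δ / 2) := by gcongr
    rw [show 2 / δ * (δ / 2) = 1 by field_simp] at this
    linarith)

theorem capStep_of_ge {z : ℝ} (hz : δ ≤ 1 + z) : capStep δ z = 1 :=
  Real.smoothTransition.one_of_one_le (by
    have : 2 / δ * δ ≤ 2 / δ * (1 + z) := by gcongr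
    rw [show 2 / δ * δ = 2 by field_simp] at this
    linarith)

theorem contDiff_capCutoff : ContDiff ℝ ∞ (capCutoff δ) := by
  rw [contDiff_iff_contDiffAt]
  intro z
  by_cases hz : 1 + z = 0
  · have h1 : capCutoff δ =ᶠ[𝓝 z] fun _ => 0 := by
      have : ∀ᶠ y in 𝓝 z, 1 + y < δ / 2 :=
        (continuous_const.add continuous_id).continuousAt.eventually_lt continuousAt_const
          (show 1 + z < δ / 2 by linarith)
      filter_upwards [this] with y hy
      rw [capCutoff, capStep_of_le hδ hy.le, zero_mul]
    exact contDiffAt_const.congr_of_eventuallyEq h1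
  · exact (contDiff_capStep δ).contDiffAt.mul ((contDiffAt_const.add contDiffAt_id).inv hz)

theorem capCutoff_of_ge {z : ℝ} (hz : δ ≤ 1 + z) : capCutoff δ z = (1 + z)⁻¹ := by
  rw [capCutoff, capStep_of_ge hδ hz, one_mul]

theorem sq_mul_capCutoff (z : ℝ) : (1 - z ^ 2) * capCutoff δ z = (1 - z) * capStep δ z := by
  rw [capCutoff]
  by_cases hz : 1 + z = 0
  · rw [capStep_of_le hδ (by linarith)]; ring
  · field_simp
    ring

omit hδ in
theorem hasDerivAt_add_capStep (z : ℝ) :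
    HasDerivAt (fun z => z + (1 - z) * capStep δ z) (capWeight δ z) z := by
  have h1 : HasDerivAt (fun z : ℝ => 2 / δ * (1 + z) - 1) (2 / δ) z := by
    simpa using (((hasDerivAt_id z).const_add 1).const_mul (2 / δ)).sub_const 1
  have h2 : HasDerivAt Real.smoothTransition
      (deriv Real.smoothTransition (2 / δ * (1 + z) - 1)) (2 / δ * (1 + z) - 1) :=
    ((Real.smoothTransition.contDiff (n := 1)).differentiable (by simp) _).hasDerivAt
  have h3 : HasDerivAt (capStep δ) _ z := h2.comp z h1
  refine ((hasDerivAt_id z).add (((hasDerivAt_id z).const_sub 1).mul h3)).congr_deriv ?_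
  simp only [capWeight, id]
  ring

/-- The identity behind the choice of the weight: cutting off the connection form changes its
exterior derivative by `capWeight`. -/
theorem deriv_capCutoff (z : ℝ) :
    (1 - z ^ 2) * deriv (capCutoff δ) z - 2 * z * capCutoff δ z = capWeight δ z - 1 := by
  have h1 := ((contDiff_capCutoff hδ).differentiable (by simp) z).hasDerivAt
  have h2 := (((hasDerivAt_id z).pow 2).const_sub 1).mul h1
  have h3 := (hasDerivAt_add_capStep (δ := δ) z).sub (hasDerivAt_id z)
  have h4 : ((fun z : ℝ => 1 - (id ^ 2) z) * capCutoff δ) =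
      ((fun z => z + (1 - z) * capStep δ z) - id) := by
    ext z
    simp only [Pi.mul_apply, Pi.sub_apply, Pi.pow_apply, id]
    rw [sq_mul_capCutoff hδ]; ring
  rw [h4] at h2
  have h5 := h2.unique h3
  simp at h5
  linarith

theorem capWeight_of_ge {z : ℝ} (hz : δ ≤ 1 + z) : capWeight δ z = 0 := by
  have h1 : deriv Real.smoothTransition (2 / δ * (1 + z) - 1) = 0 := by
    refine IsLocalMax.deriv_eq_zero (Filter.Eventually.of_forall fun y => ?_)
    have := capStep_of_ge hδ hz
    rw [capStep] at this
    rw [this]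
    exact Real.smoothTransition.le_one y
  rw [capWeight, capStep_of_ge hδ hz, h1]
  ring

omit hδ in
/-- The weight is of the order of the inverse of the area of its support. -/
theorem exists_capWeight_le : ∃ C : ℝ, 0 ≤ C ∧ ∀ δ : ℝ, 0 < δ → δ ≤ 1 → ∀ z ∈ Icc (-1 : ℝ) 1,
    |capWeight δ z| ≤ C / δ := by
  obtain ⟨C, hC⟩ := (isCompact_Icc (a := (-1 : ℝ)) (b := 1)).exists_bound_of_continuousOn
    continuous_deriv_smoothTransition.continuousOn
  have hC0 : 0 ≤ C := (norm_nonneg _).trans (hC 0 ⟨by norm_num, by norm_num⟩)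
  refine ⟨1 + 4 * C, by positivity, fun δ hδ hδ1 z hz => ?_⟩
  by_cases h : δ ≤ 1 + z
  · rw [capWeight_of_ge hδ h, abs_zero]; positivity
  · push Not at h
    have h0 : (0 : ℝ) ≤ 2 / δ := by positivity
    have h1 : 2 / δ * (1 + z) ≤ 2 / δ * δ := by gcongr
    rw [show 2 / δ * δ = 2 by field_simp] at h1
    have h2 := hC (2 / δ * (1 + z) - 1) ⟨by
      have := mul_nonneg h0 (show 0 ≤ 1 + z by linarith [hz.1])
      linarith, by linarith⟩
    rw [Real.norm_eq_abs] at h2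
    have h3 : |1 - capStep δ z| ≤ 1 := by
      have e1 := Real.smoothTransition.nonneg (2 / δ * (1 + z) - 1)
      have e2 := Real.smoothTransition.le_one (2 / δ * (1 + z) - 1)
      rw [capStep, abs_le]
      constructor <;> linarith
    have h4 : |1 - z| ≤ 2 := by rw [abs_le]; constructor <;> linarith [hz.1, hz.2]
    calc |capWeight δ z| ≤ |1 - capStep δ z| + |(1 - z) * (2 / δ *
          deriv Real.smoothTransition (2 / δ * (1 + z) - 1))| := abs_add_le _ _
      _ ≤ 1 + 2 * (2 / δ * C) := by
          rw [abs_mul, abs_mul, abs_of_nonneg h0]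
          gcongr
      _ ≤ (1 + 4 * C) / δ := by
          rw [le_div_iff₀ hδ]
          have : 2 / δ * C * δ = 2 * C := by field_simp
          nlinarith

/-- The total mass of the weight does not depend on `δ`: the primitive takes the values `-1` and
`1` at the poles. -/
theorem integral_sin_mul_capWeight :
    ∫ θ in Ioo 0 Real.pi, Real.sin θ * capWeight δ (Real.cos θ) = 2 := by
  have h1 : ∀ θ, HasDerivAt (fun θ => -(Real.cos θ + (1 - Real.cos θ) * capStep δ (Real.cos θ)))
      (Real.sin θ * capWeight δ (Real.cos θ)) θ := fun θ => by
    have := ((hasDerivAt_add_capStep (δ := δ) (Real.cos θ)).comp θ (Real.hasDerivAt_cos θ)).neg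
    refine this.congr_deriv ?_
    ring
  rw [← integral_Icc_eq_integral_Ioo, integral_deriv_eq_sub Real.pi_pos
    (fun t _ => (h1 t).hasDerivWithinAt)
    (Real.continuous_sin.mul ((continuous_capWeight δ).comp Real.continuous_cos)).continuousOn,
    Real.cos_pi, Real.cos_zero, capStep_of_le hδ (z := -1) (by linarith)]
  norm_num

end PoleForm

section PoleCurl

variable {S : Set E3} {n : E3 → E3} {e : E3}

/-- The exterior derivative of the pull-back of the connection form `h(z) (e × N) · dN`,
`z = e · N`, of the sphere. -/
theorem curl_pole (hS : IsSurface S) (hn : IsCoorientation S n) (he : ‖e‖ = 1) {h : ℝ → ℝ}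
    (hh : ContDiff ℝ ∞ h) {P : E3} (hP : P ∈ S) :
    curl S n (fun P => h ⟪e, n P⟫ • cross e (n P)) n P =
      (2 * ⟪e, n P⟫ * h ⟪e, n P⟫ - (1 - ⟪e, n P⟫ ^ 2) * deriv h ⟪e, n P⟫) *
        sphericalJacobian S n P := by
  obtain ⟨D, r, x, hr, hx, rfl, -⟩ := hS.exists_patch_point hP
  have hz : IsSmoothOn S fun P => ⟪e, n P⟫ := (isSmoothOn_const e S).inner hn.isSmoothOn
  have hhz : IsSmoothOn S fun P => h ⟪e, n P⟫ := fun D r hr => hh.comp_contDiffOn (hz D r hr)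
  have hf : IsSmoothOn S fun P => h ⟪e, n P⟫ • cross e (n P) :=
    hhz.smul ((isSmoothOn_const e S).cross hn.isSmoothOn)
  have hD := hr.domain
  have hPS := hr.sub ⟨x, hx, rfl⟩
  have hN := hasFDerivWithinAt_of_contDiffOn (hn.isSmoothOn D r hr) hx
  have hNe : HasFDerivWithinAt (fun y => ⟪e, n (r y)⟫)
      ((innerSL ℝ e).comp (fderivWithin ℝ (n ∘ r) D x)) D x :=
    (innerSL ℝ e).hasFDerivAt.comp_hasFDerivWithinAt x hN
  have hNh := (hh.differentiable (by simp) ⟪e, n (r x)⟫).hasDerivAt.hasFDerivAt.comp_hasFDerivWithinAt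
    x hNe
  have hNc : HasFDerivWithinAt (fun y => cross e (n (r y)))
      ((crossL e).comp (fderivWithin ℝ (n ∘ r) D x)) D x :=
    (crossL e).hasFDerivAt.comp_hasFDerivWithinAt x hN
  have hpd : ∀ i, pd D ((fun P => h ⟪e, n P⟫ • cross e (n P)) ∘ r) i x =
      h ⟪e, n (r x)⟫ • cross e (pd D (n ∘ r) i x) +
        (deriv h ⟪e, n (r x)⟫ * ⟪e, pd D (n ∘ r) i x⟫) • cross e (n (r x)) := fun i => by
    refine (pd_eq_of_hasFDerivWithinAt hD hx (hNh.smul hNc) i).trans ?_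
    simp [pd, crossL_apply, mul_comm]
  have h1 := hr.immersed.curl_mul hS hn hf hn.isSmoothOn hx
  rw [hpd, hpd] at h1
  have h2 := hr.immersed.cross_pd_normal hS hn hx
  have hn0 := fun i => hr.immersed.inner_normal_pd_normal hn hx i
  have h3 := inner_normal_cross_ne_zero (hn.unit _ hPS) (hr.immersed.inner_normal_pd hn hx 0)
    (hr.immersed.inner_normal_pd hn hx 1) (hr.immersed.nrm_ne_zero hx)
  change ⟪n (r x), nrm D r x⟫ ≠ 0 at h3
  refine mul_left_cancel₀ h3 ?_
  rw [h1]
  set N := n (r x)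
  set p := pd D (n ∘ r) 0 x
  set q := pd D (n ∘ r) 1 x
  have hNN : ⟪N, N⟫ = 1 := by rw [real_inner_self_eq_norm_sq, hn.unit _ hPS]; norm_num
  have hee : ⟪e, e⟫ = 1 := by rw [real_inner_self_eq_norm_sq, he]; norm_num
  have hM : cross p q = (sphericalJacobian S n (r x) * ⟪N, nrm D r x⟫) • N := by
    rw [mul_smul, ← hr.immersed.nrm_eq hn hx]
    exact h2
  have e1 : ⟪cross e p, q⟫ = ⟪e, cross p q⟫ := by
    simp only [inner_e3, cross_apply_zero, cross_apply_one, cross_apply_two]; ring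
  have e2 : ⟪cross e q, p⟫ = -⟪e, cross p q⟫ := by
    simp only [inner_e3, cross_apply_zero, cross_apply_one, cross_apply_two]; ring
  have e3 : ⟪e, p⟫ * ⟪cross e N, q⟫ - ⟪e, q⟫ * ⟪cross e N, p⟫ =
      ⟪e, cross p q⟫ * ⟪e, N⟫ - ⟪e, e⟫ * ⟪N, cross p q⟫ := by
    simp only [inner_e3, cross_apply_zero, cross_apply_one, cross_apply_two]; ring
  rw [hM, inner_smul_right, inner_smul_right, hNN, hee] at e3
  rw [hM, inner_smul_right] at e1 e2
  simp only [inner_add_left, inner_smul_left, conj_trivial, e1, e2]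
  linear_combination deriv h ⟪e, N⟫ * e3

end PoleCurl

section PoleFrame

variable {e p : E3}

/-- The unit vector perpendicular to `N` obtained from the unit vector `p`, perpendicular to `e`, by
the rotation that takes `e` to `N` along the great circle. -/
def poleFrame (e p N : E3) : E3 := p - (⟪p, N⟫ / (1 + ⟪e, N⟫)) • (e + N)

/-- The derivative of `poleFrame` at `N` in the direction of `N'`. -/
def poleFrameDeriv (e p N N' : E3) : E3 :=
  -(((⟪p, N'⟫ - ⟪p, N⟫ / (1 + ⟪e, N⟫) * ⟪e, N'⟫) / (1 + ⟪e, N⟫)) • (e + N) +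
    (⟪p, N⟫ / (1 + ⟪e, N⟫)) • N')

theorem hasDerivAt_poleFrame {N : ℝ → E3} {N' : E3} {t : ℝ} (h : HasDerivAt N N' t)
    (h0 : 1 + ⟪e, N t⟫ ≠ 0) :
    HasDerivAt (fun t => poleFrame e p (N t)) (poleFrameDeriv e p (N t) N') t := by
  have h1 : ∀ v : E3, HasDerivAt (fun t => ⟪v, N t⟫) ⟪v, N'⟫ t := fun v =>
    (innerSL ℝ v).hasFDerivAt.comp_hasDerivAt t h
  have h2 := ((h1 p).div ((h1 e).const_add 1) h0).smul (h.const_add e)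
  refine (h2.const_sub p).congr_deriv ?_
  rw [poleFrameDeriv, add_comm]
  simp only [Pi.div_apply]
  congr 3
  field_simp

variable (he : ‖e‖ = 1) (hp : ‖p‖ = 1) (hep : ⟪e, p⟫ = 0) {N N' : E3} (hN : ‖N‖ = 1)
  (hNN' : ⟪N, N'⟫ = 0) (h0 : 1 + ⟪e, N⟫ ≠ 0)
include he hp hep hN h0

theorem inner_poleFrame : ⟪N, poleFrame e p N⟫ = 0 := by
  rw [poleFrame, inner_sub_right, inner_smul_right, inner_add_right, real_inner_self_eq_norm_sq,
    hN, real_inner_comm p N, real_inner_comm e N]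
  field_simp
  ring

theorem norm_poleFrame : ‖poleFrame e p N‖ = 1 := by
  have h1 : ‖poleFrame e p N‖ ^ 2 = 1 := by
    rw [poleFrame, norm_sub_sq_real, hp, norm_smul, mul_pow, norm_add_sq_real, he, hN,
      inner_smul_right, inner_add_right, real_inner_comm e p, hep, Real.norm_eq_abs, sq_abs]
    field_simp
    ring
  exact (pow_eq_one_iff_of_nonneg (norm_nonneg _) two_ne_zero).1 h1

include hNN'

/-- The rate of rotation of the frame with a pole is the opposite of the form
`(e × N) · dN / (1 + e · N)`. -/
theorem inner_cross_poleFrame :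
    ⟪cross N (poleFrame e p N), poleFrameDeriv e p N N'⟫ = -((1 + ⟪e, N⟫)⁻¹ * ⟪cross e N, N'⟫) := by
  set c := cross e p with hc
  have hdec : ∀ v w : E3, ⟪v, w⟫ = ⟪e, v⟫ * ⟪e, w⟫ + ⟪p, v⟫ * ⟪p, w⟫ + ⟪c, v⟫ * ⟪c, w⟫ := by
    intro v w
    conv_lhs => rw [frame_decomposition he hp hep w]
    simp only [inner_add_right, inner_smul_right, real_inner_comm v]
    ring
  have d1 := hdec N N
  have d2 := hdec N N'
  rw [real_inner_self_eq_norm_sq, hN] at d1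
  rw [hNN'] at d2
  have f1 : ⟪cross N p, e⟫ = -⟪c, N⟫ := by
    simp only [hc, inner_e3, cross_apply_zero, cross_apply_one, cross_apply_two]; ring
  have f2 : ⟪cross N p, N'⟫ = ⟪e, N⟫ * ⟪c, N'⟫ - ⟪c, N⟫ * ⟪e, N'⟫ := by
    have h1 : ⟪cross N p, N'⟫ = ⟪p, cross N' N⟫ := by
      simp only [inner_e3, cross_apply_zero, cross_apply_one, cross_apply_two]; ring
    have h2 : p = cross c e := by
      rw [← neg_neg p, ← cross_cross_frame he hp hep, ← cross_anticomm]
    rw [h1]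
    conv_lhs => rw [h2]
    rw [inner_cross_cross]; ring
  have f3 : ⟪cross N e, N'⟫ = ⟪c, N⟫ * ⟪p, N'⟫ - ⟪p, N⟫ * ⟪c, N'⟫ := by
    have h1 : ⟪cross N e, N'⟫ = ⟪e, cross N' N⟫ := by
      simp only [inner_e3, cross_apply_zero, cross_apply_one, cross_apply_two]; ring
    have h2 : e = cross p c := (cross_frame_right he hp hep).symm
    rw [h1]
    conv_lhs => rw [h2]
    rw [inner_cross_cross]; ring
  have f4 : ⟪cross e N, N'⟫ = -⟪cross N e, N'⟫ := by rw [cross_anticomm N e, inner_neg_left]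
  have f5 : ⟪cross N p, N⟫ = 0 := by rw [real_inner_comm]; exact inner_cross_left _ _
  have f6 : ⟪cross N e, N⟫ = 0 := by rw [real_inner_comm]; exact inner_cross_left _ _
  have f7 : ⟪cross N e, e⟫ = 0 := by rw [real_inner_comm]; exact inner_cross_right _ _
  rw [f4, f3, poleFrame, poleFrameDeriv, sub_eq_add_neg p, ← neg_smul, cross_add_right,
    cross_smul_right, cross_add_right, cross_self, add_zero]
  simp only [inner_add_left, inner_add_right, inner_smul_left, inner_smul_right, inner_neg_right,
    conj_trivial, f1, f2, f3, f5, f6, f7]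
  -- What remains is an identity between the coordinates of `N` and `N'` in the frame `e, p, c`.
  generalize ⟪e, N⟫ = z at *
  generalize ⟪e, N'⟫ = z' at *
  generalize ⟪p, N⟫ = s at *
  generalize ⟪p, N'⟫ = s' at *
  generalize ⟪c, N⟫ = t at *
  generalize ⟪c, N'⟫ = t' at *
  field_simp
  linear_combination ((1 + z) * s * t') * d1 - ((1 + z) * s * t) * d2

end PoleFrame

section PoleFrameAlong

variable {S : Set E3} {n : E3 → E3} {e p : E3} {γ N' : ℝ → E3}

theorem isFrameAlong_poleFrame (hn : IsCoorientation S n) (hγ : ∀ t, γ t ∈ S)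
    (hN' : ∀ t, HasDerivAt (n ∘ γ) (N' t) t) (hc : Continuous N') (he : ‖e‖ = 1) (hp : ‖p‖ = 1)
    (hep : ⟪e, p⟫ = 0) (h0 : ∀ t, 1 + ⟪e, n (γ t)⟫ ≠ 0) :
    IsFrameAlong S n γ (fun t => poleFrame e p (n (γ t)))
      fun t => poleFrameDeriv e p (n (γ t)) (N' t) where
  mem := hγ
  normal := fun t => (hN' t).differentiableAt
  deriv := fun t => hasDerivAt_poleFrame (hN' t) (h0 t)
  cont := by
    have h1 : Continuous fun t => n (γ t) :=
      continuous_iff_continuousAt.2 fun t => (hN' t).continuousAt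
    have h2 : ∀ v : E3, Continuous fun t => ⟪v, n (γ t)⟫ := fun v => continuous_const.inner h1
    have h3 : ∀ v : E3, Continuous fun t => ⟪v, N' t⟫ := fun v => continuous_const.inner hc
    have h4 : Continuous fun t => ⟪p, n (γ t)⟫ / (1 + ⟪e, n (γ t)⟫) :=
      (h2 p).div (continuous_const.add (h2 e)) h0
    exact (((((h3 p).sub (h4.mul (h3 e))).div (continuous_const.add (h2 e)) h0).smul
      (continuous_const.add h1)).add (h4.smul hc)).neg
  unit := fun t => norm_poleFrame he hp hep (hn.unit _ (hγ t)) (h0 t)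
  orth := fun t => inner_poleFrame he hp hep (hn.unit _ (hγ t)) (h0 t)

end PoleFrameAlong

/-! ### Parallel transport along the boundary -/

section Boundary

variable {S : Set E3} {n : E3 → E3} {m : ℕ} {γ : Fin m → ℝ → E3} {e : E3}

theorem exists_unit_orthogonal (he : ‖e‖ = 1) : ∃ p : E3, ‖p‖ = 1 ∧ ⟪e, p⟫ = 0 := by
  have h : ∃ i, cross e (e3 i) ≠ 0 := by
    by_contra! h
    have h0 := h 0
    have h1 := h 1
    have a1 := congrArg (fun w : E3 => w 1) h0
    have a2 := congrArg (fun w : E3 => w 2) h0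
    have a3 := congrArg (fun w : E3 => w 2) h1
    simp at a1 a2 a3
    have : e = 0 := ext_e3 (by simpa using a3) (by simpa using a2) (by simpa using a1)
    rw [this, norm_zero] at he
    exact zero_ne_one he
  obtain ⟨i, hi⟩ := h
  exact ⟨‖cross e (e3 i)‖⁻¹ • cross e (e3 i), norm_smul_inv_norm hi, by
    rw [inner_smul_right, inner_cross_left, mul_zero]⟩

/-- A curve of class `C¹` has area zero. -/
theorem area_range_eq_zero {N : ℝ → E3} (hN : ContDiff ℝ 1 N) : μHE[2] (range N) = 0 := by
  have h1 : dimH (range N) < (2 : ℝ≥0) := hN.dimH_range_le.trans_lt (by simp)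
  have h2 := hausdorffMeasure_of_dimH_lt h1
  rw [Measure.euclideanHausdorffMeasure_def, Measure.smul_apply]
  simp only [NNReal.coe_ofNat] at h2
  simp [h2]

/-- The area measure on the unit sphere. -/
def sphereMeasure : Measure E3 := (μHE[2]).restrict (Metric.sphere (0 : E3) 1)

instance : IsFiniteMeasure sphereMeasure := by
  obtain ⟨p, hp, hep⟩ := exists_unit_orthogonal (e := e3 0) (by simp)
  exact ⟨by simpa [sphereMeasure] using area_sphere_lt_top (m := e3 0) (by simp) hp hep⟩

theorem sphereMeasure_ne_zero : sphereMeasure ≠ 0 := fun h => by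
  obtain ⟨p, hp, hep⟩ := exists_unit_orthogonal (e := e3 0) (by simp)
  have h1 := integral_sphere (m := e3 0) (by simp) hp hep fun _ => 1
  have h2 : ∫ q in Metric.sphere (0 : E3) 1, (1 : ℝ) ∂μHE[2] = ∫ q, (1 : ℝ) ∂sphereMeasure := rfl
  rw [h2, h, integral_zero_measure, ← integral_Icc_eq_integral_Ioo,
    integral_deriv_eq_sub (u := fun θ => -Real.cos θ) Real.pi_pos (fun t _ => by
      have := (Real.hasDerivAt_cos t).neg
      rw [neg_neg, ← mul_one (Real.sin t)] at this
      exact this.hasDerivWithinAt) (by fun_prop)] at h1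
  rw [Real.cos_pi, Real.cos_zero] at h1
  have := Real.pi_pos
  linarith

/-- Almost every point of the sphere lies off the spherical images of the boundary curves and is a
Lebesgue point of the degree. -/
theorem exists_pole (hS : IsSurface S) (hn : IsCoorientation S n) (hγ : IsBoundaryParam S n γ) :
    ∃ e : E3, ‖e‖ = 1 ∧ (∀ i t, n (γ i t) ≠ -e) ∧
      Filter.Tendsto (fun ρ => ⨍ q in Metric.closedBall (-e) ρ,
        ‖sphericalDegree S n q - sphericalDegree S n (-e)‖ ∂sphereMeasure) (𝓝[>] 0) (𝓝 0) := by
  have hint : Integrable (sphericalDegree S n) sphereMeasure :=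
    (integral_sphericalDegree hS hn (g := fun _ => 1) continuous_const).1
  have h1 := (Besicovitch.vitaliFamily sphereMeasure).ae_tendsto_average_norm_sub
    hint.locallyIntegrable
  have h2 : ∀ᵐ q ∂sphereMeasure, ∀ i, q ∉ range (n ∘ γ i) := by
    rw [ae_all_iff]
    intro i
    have hd := hγ.hasDerivAt_comp hS hn hn.isSmoothOn i
    have hc : ContDiff ℝ 1 (n ∘ γ i) := by
      rw [contDiff_one_iff_deriv]
      refine ⟨fun t => (hd t).differentiableAt, ?_⟩
      rw [funext fun t => (hd t).deriv]
      exact continuous_surfDeriv_comp hS hn hn.isSmoothOn (hγ.smooth i).continuous (hγ.mem i)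
        (hγ.continuous_deriv i)
    exact ae_restrict_of_ae (measure_eq_zero_iff_ae_notMem.1 (area_range_eq_zero hc))
  have h3 : ∀ᵐ q ∂sphereMeasure, q ∈ Metric.sphere (0 : E3) 1 :=
    ae_restrict_mem Metric.isClosed_sphere.measurableSet
  have : (ae sphereMeasure).NeBot := ae_neBot.2 sphereMeasure_ne_zero
  obtain ⟨q, hq1, hq2, hq3⟩ := (h1.and (h2.and h3)).exists
  refine ⟨-q, by simpa using hq3, fun i t h => hq2 i ⟨t, by simpa using h⟩, ?_⟩
  rw [neg_neg]
  exact hq1.comp (Besicovitch.tendsto_filterAt _ q)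

/-- The integral over the boundary of the connection form of the frame with a pole `e` is the
curvature diminished by the integral of the degree against a weight concentrated near `-e`. -/
theorem integral_sub_sum_pole (hS : IsSurfaceWithSmoothBoundary S) (hn : IsCoorientation S n)
    (hγ : IsBoundaryParam S n γ) (he : ‖e‖ = 1) {δ : ℝ} (hδ : 0 < δ)
    (hδe : ∀ i, ∀ t ∈ Icc (0 : ℝ) 1, δ ≤ 1 + ⟪e, n (γ i t)⟫) :
    (∫ P in S, sphericalJacobian S n P ∂μHE[2]) - ∑ i, ∫ t in Icc (0 : ℝ) 1,
      (1 + ⟪e, n (γ i t)⟫)⁻¹ * ⟪cross e (n (γ i t)), surfDeriv S n n (γ i t) (deriv (γ i) t)⟫ =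
    ∫ q, sphericalDegree S n q * capWeight δ ⟪e, q⟫ ∂sphereMeasure := by
  have hS' := hS.isSurface
  have hh := contDiff_capCutoff hδ
  have hf : IsSmoothOn S fun P => capCutoff δ ⟪e, n P⟫ • cross e (n P) :=
    IsSmoothOn.smul (fun D r hr => hh.comp_contDiffOn
      ((isSmoothOn_const e S).inner hn.isSmoothOn D r hr))
      ((isSmoothOn_const e S).cross hn.isSmoothOn)
  have h1 := stokes hS hn hγ hf hn.isSmoothOn
  have h2 : ∀ i, ∫ t in Icc (0 : ℝ) 1, ⟪capCutoff δ ⟪e, n (γ i t)⟫ • cross e (n (γ i t)),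
      surfDeriv S n n (γ i t) (deriv (γ i) t)⟫ = ∫ t in Icc (0 : ℝ) 1,
      (1 + ⟪e, n (γ i t)⟫)⁻¹ * ⟪cross e (n (γ i t)), surfDeriv S n n (γ i t) (deriv (γ i) t)⟫ :=
    fun i => setIntegral_congr_fun measurableSet_Icc fun t ht => by
      simp only [capCutoff_of_ge hδ (hδe i t ht), inner_smul_left, conj_trivial]
  simp only [h2] at h1
  have hz : ContinuousOn (fun P => ⟪e, n P⟫) S := continuousOn_const.inner hn.cont
  have hJ := continuousOn_sphericalJacobian hS' hn
  rw [← h1, ← integral_sub (hS'.integrableOn hJ) (hS'.integrableOn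
    (continuousOn_curl hS' hn hf hn.isSmoothOn))]
  have h3 := (integral_sphericalDegree hS' hn (g := fun q => capWeight δ ⟪e, q⟫)
    ((continuous_capWeight δ).comp (continuous_const.inner continuous_id))).2
  refine Eq.trans ?_ h3.symm
  refine setIntegral_congr_fun hS'.measurableSet fun P hP => ?_
  beta_reduce
  rw [curl_pole hS' hn he hh hP]
  linear_combination sphericalJacobian S n P * deriv_capCutoff hδ ⟪e, n P⟫

theorem integral_capWeight (he : ‖e‖ = 1) {δ : ℝ} (hδ : 0 < δ) :
    ∫ q, capWeight δ ⟪e, q⟫ ∂sphereMeasure = 4 * Real.pi := by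
  obtain ⟨p, hp, hep⟩ := exists_unit_orthogonal he
  refine (integral_sphere he hp hep (capWeight δ)).trans ?_
  rw [integral_sin_mul_capWeight hδ]
  ring

theorem inner_mem_Icc {q : E3} (he : ‖e‖ = 1) (hq : ‖q‖ = 1) : ⟪e, q⟫ ∈ Icc (-1 : ℝ) 1 := by
  have := abs_real_inner_le_norm e q
  rw [he, hq, mul_one] at this
  exact abs_le.1 this

theorem one_add_inner_pos {q : E3} (he : ‖e‖ = 1) (hq : ‖q‖ = 1) (h : q ≠ -e) :
    0 < 1 + ⟪e, q⟫ := by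
  have h1 : 0 < ‖q + e‖ ^ 2 := by
    have : q + e ≠ 0 := fun h' => h (eq_neg_of_add_eq_zero_left h')
    positivity
  rw [norm_add_sq_real, hq, he, real_inner_comm] at h1
  linarith

/-- A weight concentrated near `-e` evaluates an integrable function at `-e`, up to its mean
oscillation. -/
theorem exists_abs_integral_capWeight_sub_le (he : ‖e‖ = 1) {d : E3 → ℝ}
    (hd : Integrable d sphereMeasure) : ∃ C : ℝ, 0 ≤ C ∧ ∀ ρ : ℝ, 0 < ρ → ρ ≤ 1 →
      |(∫ q, d q * capWeight (ρ ^ 2 / 2) ⟪e, q⟫ ∂sphereMeasure) - 4 * Real.pi * d (-e)| ≤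
        C * ⨍ q in Metric.closedBall (-e) ρ, ‖d q - d (-e)‖ ∂sphereMeasure := by
  obtain ⟨p, hp, hep⟩ := exists_unit_orthogonal he
  obtain ⟨C, hC0, hC⟩ := exists_capWeight_le
  refine ⟨2 * Real.pi * C, by positivity, fun ρ hρ hρ1 => ?_⟩
  -- The weight for this `δ` is supported in the ball of radius `ρ` about `-e`.
  set δ := ρ ^ 2 / 2 with hδdef
  have hδ : 0 < δ := by positivity
  have hδ1 : δ ≤ 1 := by rw [hδdef]; nlinarith
  have hwc : Continuous fun q : E3 => capWeight δ ⟪e, q⟫ :=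
    (continuous_capWeight δ).comp (continuous_const.inner continuous_id)
  have hsph : ∀ᵐ q ∂sphereMeasure, ‖q‖ = 1 := by
    filter_upwards [ae_restrict_mem (μ := μHE[2])
      (Metric.isClosed_sphere (x := (0 : E3)) (ε := 1)).measurableSet] with q hq
    exact mem_sphere_zero_iff_norm.1 hq
  have hwb : ∀ᵐ q ∂sphereMeasure, ‖capWeight δ ⟪e, q⟫‖ ≤ C / δ := by
    filter_upwards [hsph] with q hq
    exact hC δ hδ hδ1 _ (inner_mem_Icc he hq)
  have hi1 : Integrable (fun q => d q * capWeight δ ⟪e, q⟫) sphereMeasure :=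
    hd.mul_bdd hwc.aestronglyMeasurable hwb
  have hi2 : Integrable (fun q : E3 => capWeight δ ⟪e, q⟫) sphereMeasure :=
    Integrable.of_bound hwc.aestronglyMeasurable _ hwb
  have hi3 : Integrable (fun q => ‖d q - d (-e)‖) sphereMeasure :=
    (hd.sub (integrable_const _)).norm
  have h1 : (∫ q, d q * capWeight δ ⟪e, q⟫ ∂sphereMeasure) - 4 * Real.pi * d (-e) =
      ∫ q, (d q - d (-e)) * capWeight δ ⟪e, q⟫ ∂sphereMeasure := by
    rw [← integral_capWeight he hδ, mul_comm, ← integral_const_mul,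
      ← integral_sub hi1 (hi2.const_mul _)]
    exact integral_congr_ae (Filter.Eventually.of_forall fun q => by ring)
  rw [h1]
  have h2 : ∀ᵐ q ∂sphereMeasure, ‖(d q - d (-e)) * capWeight δ ⟪e, q⟫‖ ≤
      (Metric.closedBall (-e) ρ).indicator (fun q => C / δ * ‖d q - d (-e)‖) q := by
    filter_upwards [hsph, hwb] with q hq hb
    rw [norm_mul, mul_comm]
    by_cases h : q ∈ Metric.closedBall (-e) ρ
    · rw [indicator_of_mem h]
      gcongr
    · rw [indicator_of_notMem h, capWeight_of_ge hδ, norm_zero, zero_mul]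
      rw [mem_closedBall_iff_norm, sub_neg_eq_add, ← sq_le_sq₀ (norm_nonneg _) hρ.le,
        norm_add_sq_real, hq, he, real_inner_comm] at h
      rw [hδdef]
      linarith
  have hcap : sphereMeasure.real (Metric.closedBall (-e) ρ) ≤ Real.pi * ρ ^ 2 := by
    have := area_cap_le he hp hep hρ hρ1
    rwa [inter_comm, ← Measure.restrict_apply Metric.isClosed_closedBall.measurableSet] at this
  have havg : 0 ≤ ⨍ q in Metric.closedBall (-e) ρ, ‖d q - d (-e)‖ ∂sphereMeasure :=
    integral_nonneg fun q => norm_nonneg _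
  calc |∫ q, (d q - d (-e)) * capWeight δ ⟪e, q⟫ ∂sphereMeasure|
      ≤ ∫ q, (Metric.closedBall (-e) ρ).indicator (fun q => C / δ * ‖d q - d (-e)‖) q
          ∂sphereMeasure := norm_integral_le_of_norm_le
            ((hi3.const_mul _).indicator Metric.isClosed_closedBall.measurableSet) h2
    _ = C / δ * (sphereMeasure.real (Metric.closedBall (-e) ρ) *
          ⨍ q in Metric.closedBall (-e) ρ, ‖d q - d (-e)‖ ∂sphereMeasure) := by
        rw [integral_indicator Metric.isClosed_closedBall.measurableSet, integral_const_mul,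
          ← smul_eq_mul (sphereMeasure.real _), measure_smul_setAverage _ (measure_ne_top _ _)]
    _ ≤ C / δ * (Real.pi * ρ ^ 2 *
          ⨍ q in Metric.closedBall (-e) ρ, ‖d q - d (-e)‖ ∂sphereMeasure) := by gcongr
    _ = _ := by
        rw [← mul_assoc]
        congr 1
        rw [hδdef]
        field_simp

/-- The integral over the boundary of the connection form of the frame with a pole `e` differs from
the curvature by a multiple of the area of the sphere. -/
theorem integral_sub_sum_pole_eq (hS : IsSurfaceWithSmoothBoundary S) (hn : IsCoorientation S n)
    (hγ : IsBoundaryParam S n γ) (he : ‖e‖ = 1) (hne : ∀ i t, n (γ i t) ≠ -e)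
    (hlim : Filter.Tendsto (fun ρ => ⨍ q in Metric.closedBall (-e) ρ,
      ‖sphericalDegree S n q - sphericalDegree S n (-e)‖ ∂sphereMeasure) (𝓝[>] 0) (𝓝 0)) :
    (∫ P in S, sphericalJacobian S n P ∂μHE[2]) - ∑ i, ∫ t in Icc (0 : ℝ) 1,
      (1 + ⟪e, n (γ i t)⟫)⁻¹ * ⟪cross e (n (γ i t)), surfDeriv S n n (γ i t) (deriv (γ i) t)⟫ =
    4 * Real.pi * sphericalDegree S n (-e) := by
  have hS' := hS.isSurface
  obtain ⟨C, hC0, hC⟩ := exists_abs_integral_capWeight_sub_le he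
    (integral_sphericalDegree hS' hn (g := fun _ => 1) continuous_const).1
  have hpos : ∀ i, ∃ δ > 0, ∀ t ∈ Icc (0 : ℝ) 1, δ ≤ 1 + ⟪e, n (γ i t)⟫ := fun i => by
    have hc : ContinuousOn (fun t => 1 + ⟪e, n (γ i t)⟫) (Icc 0 1) :=
      continuousOn_const.add (continuousOn_const.inner (hn.cont.comp
        (hγ.smooth i).continuous.continuousOn fun t _ => hγ.mem i t))
    obtain ⟨t₀, -, ht₀⟩ := isCompact_Icc.exists_isMinOn (nonempty_Icc.2 zero_le_one) hc
    exact ⟨_, one_add_inner_pos he (hn.unit _ (hγ.mem i t₀)) (hne i t₀), fun t ht => ht₀ ht⟩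
  choose η hη0 hη using hpos
  have hev : ∀ᶠ ρ : ℝ in 𝓝[>] 0, 0 < ρ ∧ ρ ≤ 1 ∧ ∀ i, ρ ^ 2 / 2 ≤ η i := by
    have h1 : Filter.Tendsto (fun ρ : ℝ => ρ ^ 2 / 2) (𝓝[>] 0) (𝓝 0) := by
      have : Continuous fun ρ : ℝ => ρ ^ 2 / 2 := by fun_prop
      simpa using (this.tendsto 0).mono_left nhdsWithin_le_nhds
    filter_upwards [self_mem_nhdsWithin, Ioc_mem_nhdsGT zero_lt_one,
      Filter.eventually_all.2 fun i => h1.eventually_le_const (hη0 i)] with ρ a1 a2 a3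
    exact ⟨a1, a2.2, a3⟩
  -- The left hand side does not depend on `ρ`, and the bound tends to `0`.
  refine eq_of_abs_sub_eq_zero (le_antisymm ?_ (abs_nonneg _))
  have hlim' := hlim.const_mul C
  rw [mul_zero] at hlim'
  refine ge_of_tendsto hlim' ?_
  filter_upwards [hev] with ρ ⟨h0, h1, h2⟩
  rw [integral_sub_sum_pole hS hn hγ he (by positivity)
    fun i t ht => (h2 i).trans (hη i t ht)]
  exact hC ρ h0 h1

/-- The total rotation of parallel transport along the boundary, modulo `2π`. -/
theorem isTotalSectionalCurvature (hS : IsSurfaceWithSmoothBoundary S) (hn : IsCoorientation S n)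
    (hγ : IsBoundaryParam S n γ) :
    IsTotalSectionalCurvature S n γ ((∫ P in S, sphericalJacobian S n P ∂μHE[2] : ℝ) : Real.Angle) := by
  have hS' := hS.isSurface
  obtain ⟨e, he, hne, hlim⟩ := exists_pole hS' hn hγ
  obtain ⟨p, hp, hep⟩ := exists_unit_orthogonal he
  have h0 : ∀ i t, 1 + ⟪e, n (γ i t)⟫ ≠ 0 := fun i t =>
    (one_add_inner_pos he (hn.unit _ (hγ.mem i t)) (hne i t)).ne'
  set N' : Fin m → ℝ → E3 := fun i t => surfDeriv S n n (γ i t) (deriv (γ i) t) with hN'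
  have hd := hγ.hasDerivAt_comp hS' hn hn.isSmoothOn
  have hfr : ∀ i, IsFrameAlong S n (γ i) (fun t => poleFrame e p (n (γ i t)))
      fun t => poleFrameDeriv e p (n (γ i t)) (N' i t) := fun i =>
    isFrameAlong_poleFrame hn (hγ.mem i) (hd i)
      (continuous_surfDeriv_comp hS' hn hn.isSmoothOn (hγ.smooth i).continuous (hγ.mem i)
        (hγ.continuous_deriv i)) he hp hep (h0 i)
  have hclosed : ∀ i, γ i 1 = γ i 0 := fun i => by
    have := hγ.closed i 0
    rwa [zero_add] at this
  refine ⟨_, fun i => (hfr i).isTransportRotation hS' hn (hclosed i) (by rw [hclosed i]), ?_⟩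
  have hrate : ∀ i, -∫ u in (0 : ℝ)..1, rotationRate n (γ i) (fun t => poleFrame e p (n (γ i t)))
      (fun t => poleFrameDeriv e p (n (γ i t)) (N' i t)) u = ∫ t in Icc (0 : ℝ) 1,
      (1 + ⟪e, n (γ i t)⟫)⁻¹ * ⟪cross e (n (γ i t)), N' i t⟫ := fun i => by
    rw [intervalIntegral.integral_of_le zero_le_one, ← integral_Icc_eq_integral_Ioc, ← integral_neg]
    refine setIntegral_congr_fun measurableSet_Icc fun t _ => ?_
    have hNN : ⟪n (γ i t), N' i t⟫ = 0 :=
      inner_normal_surfDeriv_normal hS' hn (hγ.mem i t) _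
    simp only [rotationRate]
    rw [inner_cross_poleFrame he hp hep (hn.unit _ (hγ.mem i t)) hNN (h0 i t), neg_neg]
  simp only [hrate]
  have hsum := integral_sub_sum_pole_eq hS hn hγ he hne hlim
  obtain ⟨k, hk⟩ := exists_int_sphericalDegree S n (-e)
  rw [hk] at hsum
  have hcoe := map_sum Real.Angle.coeHom (fun i => ∫ t in Icc (0 : ℝ) 1,
    (1 + ⟪e, n (γ i t)⟫)⁻¹ * ⟪cross e (n (γ i t)), N' i t⟫) Finset.univ
  refine hcoe.symm.trans ?_
  -- The difference is `4π` times the integer degree `k`.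
  refine Real.Angle.angle_eq_iff_two_pi_dvd_sub.2 ⟨-2 * k, ?_⟩
  push_cast
  linear_combination -hsum

end Boundary

end SurfaceGeometry

end

open SurfaceGeometry in
theorem mainTheorem5 :
    -- total Gaussian curvature exists and is the signed area of the spherical image
    (∀ (S : Set E3) (n : E3 → E3), IsSurface S → IsCoorientation S n →
      HasTotalGaussCurvature S n (signedSphericalArea S n) ∧
      ∀ K : ℝ, HasTotalGaussCurvature S n K → K = signedSphericalArea S n) ∧
    -- the rotation angle of parallel transport along the boundary, modulo `2π`
    (∀ (S : Set E3) (n : E3 → E3) (m : ℕ) (γ : Fin m → ℝ → E3),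
      IsSurfaceWithSmoothBoundary S → IsCoorientation S n → IsBoundaryParam S n γ →
      IsTotalSectionalCurvature S n γ ((signedSphericalArea S n : ℝ) : Real.Angle)) ∧
    -- the same for the angle as a real number, measured from a tangent field on the surface
    (∀ (S : Set E3) (n : E3 → E3) (m : ℕ) (γ : Fin m → ℝ → E3),
      IsSurfaceWithSmoothBoundary S → IsCoorientation S n → IsBoundaryParam S n γ →
      ∀ (a : E3 → E3) (v : Fin m → ℝ → E3) (φ : Fin m → ℝ → ℝ), IsUnitTangentField S a →
        (∀ i, IsParallelAlong S (γ i) (v i) ∧ v i 0 ≠ 0 ∧ IsAngleFrom n a (γ i) (v i) (φ i)) →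
        ∑ i, (φ i 1 - φ i 0) = signedSphericalArea S n) ∧
    -- intrinsic isometries preserve the total Gaussian curvature
    (∀ (S S' : Set E3) (n n' f : E3 → E3), IsSurface S → IsSurface S' →
      IsCoorientation S n → IsCoorientation S' n' → IsIntrinsicIsometry S S' f →
      ∀ K : ℝ, HasTotalGaussCurvature S n K ↔ HasTotalGaussCurvature S' n' K) ∧
    -- the Gaussian curvature exists at every point and is preserved by length preserving maps
    (∀ (S S' : Set E3) (n n' f : E3 → E3), IsSurface S → IsSurface S' →
      IsCoorientation S n → IsCoorientation S' n' → IsLengthPreservingMap S S' f →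
      ∀ P ∈ S, (∃! k : ℝ, HasGaussCurvatureAt S n P k) ∧
        ∀ k : ℝ, HasGaussCurvatureAt S n P k ↔ HasGaussCurvatureAt S' n' (f P) k) := by
  refine ⟨fun S n hS hn => ?_, ?_, ?_, ?_, ?_⟩
  · rw [signedSphericalArea_eq_integral hS hn]
    exact ⟨hasTotalGaussCurvature_integral hS hn, fun K hK => hK.unique
      (hasTotalGaussCurvature_integral hS hn)⟩
  · intro S n m γ hS hn hγ
    rw [signedSphericalArea_eq_integral hS.isSurface hn]
    exact isTotalSectionalCurvature hS hn hγ
  · intro S n m γ hS hn hγ a v φ ha hv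
    rw [signedSphericalArea_eq_integral hS.isSurface hn]
    exact sum_angle_eq_integral hS hn hγ ha hv
  · intro S S' n n' f hS hS' hn hn' hf K
    rw [hasTotalGaussCurvature_iff hS hn, hasTotalGaussCurvature_iff hS' hn',
      hf.integral_sphericalJacobian_eq hS hS' hn hn']
  · intro S S' n n' f hS hS' hn hn' hf P hP
    have h1 := hasGaussCurvatureAt_iff hS hn hP
    refine ⟨⟨_, (h1 _).2 rfl, fun k hk => (h1 k).1 hk⟩, fun k => ?_⟩
    rw [h1, hasGaussCurvatureAt_iff hS' hn' (hf.mapsTo hP), hf.sphericalJacobian_eq hS hS' hn hn' hP]
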